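/- Fix $c_{\rm trunc}>0$. For real $d>1$ and $n\ge d$ put $p=d/n$ and let $G\sim G(n,d/n)$. Let $M_G\in\mathbb R^{n\times n}$ be the symmetric matrix with $M_G[u,v]=\chi_G(u,v)$ if $u\neq v$ and both $u,v$ have degree at most $c_{\rm trunc}\,d$ in $G$, and $M_G[u,v]=0$ otherwise, where $\chi_G(u,v)=\sqrt{(1-p)/p}$ if $uv$ is an edge of $G$ and $\chi_G(u,v)=-\sqrt{p/(1-p)}$ if not. A graph is *2-cycle free* if any two vertices are joined by at most two simple paths; the *2-cycle free radius* of $G$ is the largest $r\in\mathbb N\cup\{\infty\}$ such that for every vertex $v$ the subgraph induced on the vertices within distance $r$ of $v$ is 2-cycle free. For $c>0$ let $\mathcal E_c$ be the event that $G$ has 2-cycle free radius at least $\kappa=c\log_d n$. *Assignment scheme.* Let $K\ge 1$. A walk of length $2q$ is a sequence $w_0,\dots,w_{2q}=w_0$ in $[n]$ with $w_i\ne w_{i+1}$; its $i$-th block-step goes from $w_i$ to $w_{i+1}$, uses the edge $\{w_i,w_{i+1}\}$ and contains these two vertices. A step is labelled Singleton if its edge is used only once in the walk; otherwise it is labelled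 $F$ (resp. $S$) if its edge is used for the first time and its destination is contained in no (resp. some) earlier block-step, $R$ if its edge is used for the last time, and $H$ if its edge is used for neither the first nor the last time. The edge-value $\mathsf{edgeval}$ of a step is $\sqrt{n/d}\cdot\frac dn\cdot e^{-d}$ for Singleton, $1$ for $F,S,R$, and $\sqrt{(1-p)/p}$ for $H$. Its vertex-cost $\mathsf{vtxcost}$ is the product of a source factor, which is $\sqrt n$ if $w_i$ is contained in no later block-step and $1$ otherwise, and a destination factor, which is $\sqrt n$ if $w_{i+1}$ is contained in no earlier block-step, and otherwise $(2q)^3$ for an $S$ or Singleton step, $K$ for an $R$-step and $K\sqrt d$ for an $H$-step. *Block-value.* For a sequence $q=q(n)$, a function $B_q(n)\ge 0$ is a valid block-value of $M_G$ conditioned on $\mathcal E_c$ if there is $\mathsf{auxcost}(n)>0$ with $(n\cdot\mathsf{auxcost}(n))^{1/(2q)}\le 1+o_n(1)$ such that, for all large $n$, $$\mathbb E\big[\operatorname{tr}\big((M_GM_G^{\top})^{q}\big)\,\big|\,\mathcal E_c\big]\le n\cdot \mathsf{auxcost}(n)\cdot B_q(n)^{2q},$$ and $\mathsf{vtxcost}\cdot\mathsf{edgeval}\le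 B_q(n)$ for every block-step of every walk of length $2q$. **Lemma.** For all $c_{\rm trunc}>0$ and $K\ge1$ there is a constant $C>0$ (independent of $d$, $c$ and $n$) such that for every $0<c<\tfrac12$ and every real $d>1$ the following hold. 1. There are $\delta>0$ and a function $B_q(n)$ such that $B_q(n)\le C\sqrt n$ for all large $n$ and all $q\le n^{\delta}$, and such that, for every sequence $q=q(n)$ with $\log n=o(q(n))$ and $q(n)\le n^{\delta}$ for all large $n$, $B_{q(n)}(n)$ is a valid block-value of $M_G$ conditioned on $\mathcal E_c$. 2. $\Pr\big[\|M_G\|\le C\sqrt n\,\big|\,\mathcal E_c\big]\to 1$ as $n\to\infty$, where $\|\cdot\|$ is the spectral norm. -/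

import Mathlib

open MeasureTheory ProbabilityTheory Filter Topology Asymptotics
open scoped Classical

noncomputable section

namespace SparseNorm

/-! ### The random graph and the event of having large 2-cycle free radius -/

/-- The edge probability `p = d / n` (truncated to `[0, 1]`, which matters only for `n < d`). -/
def edgeProb (n : ℕ) (d : ℝ) : unitInterval :=
  Set.projIcc 0 1 zero_le_one (d / n)

/-- The law of the random graph `G(n, d / n)` on the vertex set `Fin n`. -/
def gnp (n : ℕ) (d : ℝ) : Measure (SimpleGraph (Fin n)) :=
  SimpleGraph.binomialRandom (Fin n) (edgeProb n d)

/-- A graph is 2-cycle free if there are at most two simple paths between any two vertices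
(equivalently, each connected component has at most one cycle). -/
def TwoCycleFree {V : Type*} (G : SimpleGraph V) : Prop :=
  ∀ u v : V, ENat.card (G.Path u v) ≤ 2

/-- For every vertex `v`, the subgraph induced on the vertices within distance `r` of `v` is
2-cycle free. -/
def TwoCycleFreeWithin {V : Type*} (G : SimpleGraph V) (r : ℕ) : Prop :=
  ∀ v : V, TwoCycleFree (G.induce {w | G.edist v w ≤ r})

/-- The 2-cycle free radius: the largest `r` such that all balls of radius `r` are 2-cycle free
(it is `⊤` if this holds for all `r`). -/
def twoCycleFreeRadius {V : Type*} (G : SimpleGraph V) : ℕ∞ :=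
  sSup ((fun r : ℕ => (r : ℕ∞)) '' {r | TwoCycleFreeWithin G r})

/-- The event that the 2-cycle free radius is at least `κ = c * log_d n`. The radius is an integer
or infinite, so this says that it is at least `⌈κ⌉`. -/
def radiusEvent (n : ℕ) (c d : ℝ) : Set (SimpleGraph (Fin n)) :=
  {G | (⌈c * Real.logb d n⌉₊ : ℕ∞) ≤ twoCycleFreeRadius G}

/-- The law of `G(n, d / n)` conditioned on having 2-cycle free radius at least `c * log_d n`. -/
def condGnp (n : ℕ) (c d : ℝ) : Measure (SimpleGraph (Fin n)) :=
  ProbabilityTheory.cond (gnp n d) (radiusEvent n c d)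

/-! ### The pruned matrix in the `p`-biased basis -/

/-- The `p`-biased character of the pair `u, v`: `√((1 - p) / p)` on an edge and
`-√(p / (1 - p))` on a non-edge. -/
def chi {V : Type*} (p : ℝ) (G : SimpleGraph V) (u v : V) : ℝ :=
  if G.Adj u v then √((1 - p) / p) else -√(p / (1 - p))

/-- The matrix `M_G` with entries `chi G u v` off the diagonal and `0` on the diagonal, after the
vertices of degree more than `cTrunc * d` have been removed (their rows and columns are `0`). -/
def prunedMatrix (n : ℕ) (cTrunc d : ℝ) (G : SimpleGraph (Fin n)) :
    Matrix (Fin n) (Fin n) ℝ :=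
  Matrix.of fun u v =>
    if u ≠ v ∧ (G.degree u : ℝ) ≤ cTrunc * d ∧ (G.degree v : ℝ) ≤ cTrunc * d then
      chi (edgeProb n d : ℝ) G u v
    else 0

/-- The spectral norm (the operator norm for the Euclidean norm). -/
def specNorm {n : ℕ} (M : Matrix (Fin n) (Fin n) ℝ) : ℝ :=
  ‖Matrix.toEuclideanCLM (n := Fin n) (𝕜 := ℝ) M‖

/-! ### Shape walks of the line graph, step labels, and the factor assignment scheme

A shape walk of length `2 * q` of the line graph is a closed walk with `2 * q` block-steps; the
`i`-th block-step goes from `w i.castSucc` to `w i.succ`. -/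

/-- Closed walks with `k` steps, each step joining two distinct vertices. -/
def IsShapeWalk {V : Type*} {k : ℕ} (w : Fin (k + 1) → V) : Prop :=
  w 0 = w (Fin.last k) ∧ ∀ i : Fin k, w i.castSucc ≠ w i.succ

variable {V : Type*} {k : ℕ}

/-- The underlying edge (random variable) of the `i`-th step. -/
def stepEdge (w : Fin (k + 1) → V) (i : Fin k) : Sym2 V :=
  s(w i.castSucc, w i.succ)

/-- The vertex `x` is contained in the `i`-th block-step. -/
def InBlock (w : Fin (k + 1) → V) (i : Fin k) (x : V) : Prop :=
  x = w i.castSucc ∨ x = w i.succ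

/-- The destination of the `i`-th step is contained in no earlier block-step. -/
def DestFirst (w : Fin (k + 1) → V) (i : Fin k) : Prop :=
  ∀ j < i, ¬ InBlock w j (w i.succ)

/-- The source of the `i`-th step is contained in no later block-step. -/
def SourceLast (w : Fin (k + 1) → V) (i : Fin k) : Prop :=
  ∀ j > i, ¬ InBlock w j (w i.castSucc)

/-- The edge of the `i`-th step is used in no other step. -/
def OnlyUse (w : Fin (k + 1) → V) (i : Fin k) : Prop :=
  ∀ j ≠ i, stepEdge w j ≠ stepEdge w i

/-- The edge of the `i`-th step is used in no earlier step. -/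
def FirstUse (w : Fin (k + 1) → V) (i : Fin k) : Prop :=
  ∀ j < i, stepEdge w j ≠ stepEdge w i

/-- The edge of the `i`-th step is used in no later step. -/
def LastUse (w : Fin (k + 1) → V) (i : Fin k) : Prop :=
  ∀ j > i, stepEdge w j ≠ stepEdge w i

/-- The step labels Singleton, `F`, `S`, `R`, `H`. -/
inductive StepLabel
  | singleton
  | fresh
  | surprise
  | ret
  | highMul

/-- The label of the `i`-th step of a walk. -/
def stepLabel (w : Fin (k + 1) → V) (i : Fin k) : StepLabel :=
  if OnlyUse w i then .singleton
  else if FirstUse w i then (if DestFirst w i then .fresh else .surprise)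
  else if LastUse w i then .ret
  else .highMul

/-- The edge-value of the `i`-th step: `√(n / d) * (d / n) * exp (-d)` for a singleton step (the
last factor is the singleton decay), `√((1 - p) / p)` for an `H`-step, and `1` for an edge that is
used at least twice and is used for the first or for the last time. -/
def edgeval (n : ℕ) (d : ℝ) (w : Fin (k + 1) → V) (i : Fin k) : ℝ :=
  match stepLabel w i with
  | .singleton => √(n / d) * (d / n) * Real.exp (-d)
  | .fresh => 1
  | .surprise => 1
  | .ret => 1
  | .highMul => √((1 - (edgeProb n d : ℝ)) / (edgeProb n d : ℝ))

/-- The cost of identifying the destination of the `i`-th step: `√n` at its first appearance; if it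
has appeared before, then (with `k = 2 * q` the length of the walk) `k` for the destination and
`k ^ 2` for the two possible unforced returns when it is reached by a new edge, `K` when it is
reached by an `R`-step, and `K * √d` when it is reached by an `H`-step. -/
def destCost (n : ℕ) (K d : ℝ) (w : Fin (k + 1) → V) (i : Fin k) : ℝ :=
  if DestFirst w i then √n
  else match stepLabel w i with
    | .singleton => (k : ℝ) * (k : ℝ) ^ 2
    | .fresh => √n
    | .surprise => (k : ℝ) * (k : ℝ) ^ 2
    | .ret => K
    | .highMul => K * √d

/-- The vertex-cost of the `i`-th block-step: the factor `n` of each vertex is redistributed as `√n`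
to the step at which it first appears (as a destination) and `√n` to the step at which it last
appears (as a source); the starting point of the closed walk is paid for by the dimension. -/
def vtxcost (n : ℕ) (K d : ℝ) (w : Fin (k + 1) → V) (i : Fin k) : ℝ :=
  (if SourceLast w i then √n else 1) * destCost n K d w i

/-- `B n` is a valid block-value function, for walks of length `2 * q n` and the assignment scheme
above, of the pruned matrix of `G(n, d / n)` conditioned on the 2-cycle free radius being at least
`c * log_d n`. The factor `n` in front of the auxiliary cost is the dimension of the matrix. -/
def IsBlockValue (cTrunc K c d : ℝ) (q : ℕ → ℕ) (B : ℕ → ℝ) : Prop :=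
  ∃ auxcost : ℕ → ℝ,
    (∀ᶠ n : ℕ in atTop, 0 < auxcost n ∧ 0 ≤ B n ∧
      ∫ G, ((prunedMatrix n cTrunc d G * (prunedMatrix n cTrunc d G).transpose) ^ (q n)).trace
        ∂(condGnp n c d) ≤ n * auxcost n * B n ^ (2 * q n)) ∧
    (∀ ε > 0, ∀ᶠ n : ℕ in atTop,
      ((n : ℝ) * auxcost n) ^ ((1 : ℝ) / (2 * (q n : ℝ))) ≤ 1 + ε) ∧
    (∀ᶠ n : ℕ in atTop, ∀ w : Fin (2 * q n + 1) → Fin n, IsShapeWalk w →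
      ∀ i : Fin (2 * q n), vtxcost n K d w i * edgeval n d w i ≤ B n)

end SparseNorm

end

namespace SparseNorm

/-! The trace is not expanded into walks. The argument runs from the norm to the trace:
conditionally on the radius event, `‖M_G‖ ≤ quadConst * √n` fails with probability at most `(2n + 2)
exp(-n ^ a)` for some `a > 0` (`eventually_condGnp_tail`). On the good event the trace is at most `n
(C√n) ^ (2q)`; on the bad event the crude bound `‖M_G‖ ≤ n ^ 3` costs `n ^ (6q)`, which the tail
absorbs when `q ≤ n ^ (a / 2)`. So `B = C√n` works with auxiliary cost `2`, and the inequality for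
each block-step is a check of the labels (`vtxcost_mul_edgeval_le`).

The norm bound follows Kahn and Szemerédi. By rounding, it suffices to bound the quadratic form of
the centred adjacency matrix at integer vectors `z` with `∑ z u ^ 2 ≤ 16 n`. Pairs with `|z u * z v|
≤ √d` are light and are handled by an exponential moment and a union bound over the `exp(18 n)`
lattice points (`lightForm_tail`). Heavy pairs (`heavy_le`) are handled deterministically. If the
weights differ by a factor `√d`, the degree truncation suffices. If both weights exceed a constant
depending on `d`, the vertices involved form a small set, which is degenerate. The remaining pairs
are summed over dyadic levels with discrepancy estimates for edge counts.

Degeneracy of very small sets is where the radius enters: a set of minimum degree at least `4`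
contains `2 ^ r` paths of length `r` ending at one vertex, at most two from each start, so it has at
least `2 ^ (r - 1)` elements, a power of `n`. Larger sets are degenerate by discrepancy
(`exists_low_degree`).

Conditioning is harmless for two reasons. The radius event is decreasing and failures of discrepancy
are increasing, so Harris' inequality shows that conditioning only lowers their probability. Failure
of the light bound is not monotone, but has probability at most `2 exp(-54 n)`, while the radius
event has probability at least `exp(-n)`: by Harris again, short cycles are avoided with probability
at least `exp(-O(n ^ (2c) log n))`, and `2c < 1`. -/

/-! ### Finite sums over the binomial random graph -/

/-- The pairs `(u, v)` with `u < v`. -/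
def ltPairs (n : ℕ) : Finset (Fin n × Fin n) :=
  Finset.univ.filter fun x => x.1 < x.2

/-- The probability of `G` under the binomial random graph of parameter `p`. -/
noncomputable def graphWeight {n : ℕ} (p : ℝ) (G : SimpleGraph (Fin n)) : ℝ :=
  ∏ x ∈ ltPairs n, if G.Adj x.1 x.2 then p else 1 - p

instance measurableSingletonClass_simpleGraph (n : ℕ) :
    MeasurableSingletonClass (SimpleGraph (Fin n)) where
  measurableSet_singleton G := by
    have h : ({G} : Set (SimpleGraph (Fin n))) = SimpleGraph.edgeSet ⁻¹' {G.edgeSet} := by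
      ext H; simp
    rw [h]
    exact SimpleGraph.measurableEmbedding_edgeSet.measurable (measurableSet_singleton _)

lemma mem_ltPairs {n : ℕ} {x : Fin n × Fin n} : x ∈ ltPairs n ↔ x.1 < x.2 := by
  simp [ltPairs]

lemma mk_injOn_ltPairs {n : ℕ} :
    Set.InjOn (fun x : Fin n × Fin n => s(x.1, x.2)) (ltPairs n : Set (Fin n × Fin n)) := by
  rintro ⟨a, b⟩ h ⟨a', b'⟩ h' e
  simp only [Finset.mem_coe, mem_ltPairs] at h h'
  simp only [Sym2.eq_iff] at e
  rcases e with ⟨rfl, rfl⟩ | ⟨rfl, rfl⟩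
  · rfl
  · exact absurd h h'.asymm

lemma exists_ltPairs_of_not_isDiag {n : ℕ} (e : Sym2 (Fin n)) (he : ¬ e.IsDiag) :
    ∃ x ∈ ltPairs n, s(x.1, x.2) = e := by
  induction e with
  | h a b =>
    rw [Sym2.mk_isDiag_iff] at he
    rcases lt_or_gt_of_ne he with h | h
    · exact ⟨(a, b), mem_ltPairs.2 h, rfl⟩
    · exact ⟨(b, a), mem_ltPairs.2 h, Sym2.eq_swap⟩

lemma card_ltPairs (n : ℕ) : (ltPairs n).card = n.choose 2 := by
  have h := Sym2.card_diagSet_compl (α := Fin n)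
  rw [Fintype.card_fin] at h
  rw [← h, ← Set.toFinset_card]
  refine Finset.card_bij (fun x _ => s(x.1, x.2)) ?_ ?_ ?_
  · intro x hx
    simpa using (mem_ltPairs.1 hx).ne
  · intro x hx y hy e
    exact mk_injOn_ltPairs hx hy e
  · intro e he
    obtain ⟨x, hx, h⟩ := exists_ltPairs_of_not_isDiag e (by simpa using he)
    exact ⟨x, hx, h⟩

lemma card_filter_adj_ltPairs {n : ℕ} (G : SimpleGraph (Fin n)) :
    ((ltPairs n).filter fun x => G.Adj x.1 x.2).card = G.edgeSet.ncard := by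
  rw [Set.ncard_eq_toFinset_card']
  refine Finset.card_bij (fun x _ => s(x.1, x.2)) ?_ ?_ ?_
  · intro x hx
    simpa using (Finset.mem_filter.1 hx).2
  · intro x hx y hy e
    exact mk_injOn_ltPairs (Finset.mem_filter.1 hx).1 (Finset.mem_filter.1 hy).1 e
  · intro e he
    have he' : e ∈ G.edgeSet := by simpa using he
    obtain ⟨x, hx, rfl⟩ := exists_ltPairs_of_not_isDiag e (G.not_isDiag_of_mem_edgeSet he')
    exact ⟨x, Finset.mem_filter.2 ⟨hx, by simpa using he'⟩, rfl⟩

lemma binomialRandom_real_singleton {n : ℕ} (p : unitInterval) (G : SimpleGraph (Fin n)) :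
    (SimpleGraph.binomialRandom (Fin n) p).real {G} = graphWeight (p : ℝ) G := by
  rw [measureReal_def, SimpleGraph.binomialRandom_singleton, graphWeight, Finset.prod_ite]
  simp only [Finset.prod_const, card_filter_adj_ltPairs]
  have h : ((ltPairs n).filter fun x => ¬ G.Adj x.1 x.2).card =
      (Nat.card (Fin n)).choose 2 - G.edgeSet.ncard := by
    have := Finset.card_filter_add_card_filter_not (s := ltPairs n) (fun x => G.Adj x.1 x.2)
    rw [card_filter_adj_ltPairs, card_ltPairs] at this
    simp only [Nat.card_eq_fintype_card, Fintype.card_fin]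
    omega
  rw [h, ENNReal.toReal_mul, ENNReal.toReal_pow, ENNReal.toReal_pow]
  rfl

lemma binomialRandom_real_eq_sum {n : ℕ} (p : unitInterval) (S : Set (SimpleGraph (Fin n))) :
    (SimpleGraph.binomialRandom (Fin n) p).real S =
      ∑ G, if G ∈ S then graphWeight (p : ℝ) G else 0 := by
  rw [← Finset.sum_filter]
  have h : S = ((Finset.univ.filter fun G => G ∈ S : Finset (SimpleGraph (Fin n))) :
      Set (SimpleGraph (Fin n))) := by ext; simp
  conv_lhs => rw [h]
  rw [← sum_measureReal_singleton]
  exact Finset.sum_congr rfl fun G _ => binomialRandom_real_singleton p G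

/-- The graph whose edges are the given pairs. -/
def graphOfPairs {n : ℕ} (t : Finset (Fin n × Fin n)) : SimpleGraph (Fin n) :=
  SimpleGraph.fromRel fun u v => (u, v) ∈ t ∧ u < v

lemma graphOfPairs_adj {n : ℕ} (t : Finset (Fin n × Fin n)) {u v : Fin n} (h : u < v) :
    (graphOfPairs t).Adj u v ↔ (u, v) ∈ t := by
  simp [graphOfPairs, SimpleGraph.fromRel_adj, h, h.ne, h.asymm]

/-- Independence of the edges. -/
lemma sum_graph_prod {n : ℕ} (f g : Fin n × Fin n → ℝ) :
    ∑ G : SimpleGraph (Fin n), ∏ x ∈ ltPairs n, (if G.Adj x.1 x.2 then f x else g x) =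
      ∏ x ∈ ltPairs n, (f x + g x) := by
  rw [Finset.prod_add]
  symm
  refine Finset.sum_bij (fun t _ => graphOfPairs t) (fun _ _ => Finset.mem_univ _) ?_ ?_ ?_
  · intro t ht t' ht' e
    ext ⟨u, v⟩
    by_cases h : u < v
    · rw [← graphOfPairs_adj t h, ← graphOfPairs_adj t' h, e]
    · constructor
      · intro hm
        exact absurd (mem_ltPairs.1 (Finset.mem_powerset.1 ht hm)) h
      · intro hm
        exact absurd (mem_ltPairs.1 (Finset.mem_powerset.1 ht' hm)) h
  · intro G _
    refine ⟨(ltPairs n).filter fun x => G.Adj x.1 x.2,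
      Finset.mem_powerset.2 (Finset.filter_subset _ _), ?_⟩
    ext u v
    rcases lt_trichotomy u v with h | rfl | h
    · simp [graphOfPairs_adj _ h, mem_ltPairs, h]
    · simp
    · rw [SimpleGraph.adj_comm, graphOfPairs_adj _ h, G.adj_comm]
      simp [mem_ltPairs, h]
  · intro t ht
    rw [Finset.mem_powerset] at ht
    rw [← Finset.prod_sdiff ht, mul_comm]
    congr 1
    · refine Finset.prod_congr rfl fun x hx => ?_
      have h := mem_ltPairs.1 (Finset.mem_sdiff.1 hx).1
      rw [if_neg]
      rw [graphOfPairs_adj _ h]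
      exact (Finset.mem_sdiff.1 hx).2
    · refine Finset.prod_congr rfl fun x hx => ?_
      rw [if_pos]
      rw [graphOfPairs_adj _ (mem_ltPairs.1 (ht hx))]
      exact hx

lemma sum_graphWeight {n : ℕ} (p : ℝ) :
    ∑ G : SimpleGraph (Fin n), graphWeight p G = 1 := by
  have h := sum_graph_prod (n := n) (fun _ => p) (fun _ => 1 - p)
  simpa [graphWeight] using h

lemma graphWeight_nonneg {n : ℕ} {p : ℝ} (h0 : 0 ≤ p) (h1 : p ≤ 1) (G : SimpleGraph (Fin n)) :
    0 ≤ graphWeight p G := by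
  refine Finset.prod_nonneg fun x _ => ?_
  split_ifs <;> linarith

/-- The lattice condition of the FKG inequality. It holds with equality because the weight is a
product over pairs, and at each pair `G ⊓ H`, `G ⊔ H` take the same two values as `G`, `H`. -/
lemma graphWeight_mul_le {n : ℕ} (p : ℝ) (G H : SimpleGraph (Fin n)) :
    graphWeight p G * graphWeight p H ≤ graphWeight p (G ⊓ H) * graphWeight p (G ⊔ H) := by
  apply le_of_eq
  simp only [graphWeight, ← Finset.prod_mul_distrib]
  refine Finset.prod_congr rfl fun x _ => ?_
  by_cases h1 : G.Adj x.1 x.2 <;> by_cases h2 : H.Adj x.1 x.2 <;> simp [h1, h2, mul_comm]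

/-! ### Correlation and exponential-moment inequalities -/

/-- The **Harris inequality** for two decreasing events. -/
lemma harris_lower_lower {n : ℕ} (p : unitInterval) {A B : Set (SimpleGraph (Fin n))}
    (hA : IsUpperSet A) (hB : IsUpperSet B) :
    (SimpleGraph.binomialRandom (Fin n) p).real Aᶜ *
        (SimpleGraph.binomialRandom (Fin n) p).real Bᶜ ≤
      (SimpleGraph.binomialRandom (Fin n) p).real (Aᶜ ∩ Bᶜ) ∧
    (SimpleGraph.binomialRandom (Fin n) p).real (A ∩ Bᶜ) ≤
      (SimpleGraph.binomialRandom (Fin n) p).real A *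
        (SimpleGraph.binomialRandom (Fin n) p).real Bᶜ := by
  set μ := SimpleGraph.binomialRandom (Fin n) p
  have hmono : ∀ S : Set (SimpleGraph (Fin n)), IsUpperSet S →
      Monotone fun G => if G ∈ S then (1 : ℝ) else 0 := by
    intro S hS G H hGH
    by_cases h : G ∈ S
    · simp [h, hS hGH h]
    · simp only [h, if_false]
      split_ifs <;> norm_num
  have hnn : ∀ S : Set (SimpleGraph (Fin n)), (0 : SimpleGraph (Fin n) → ℝ) ≤
      fun G => if G ∈ S then (1 : ℝ) else 0 := by
    intro S G
    simp only [Pi.zero_apply]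
    split_ifs <;> norm_num
  have h := fkg (fun G => if G ∈ A then (1 : ℝ) else 0) (fun G => if G ∈ B then (1 : ℝ) else 0)
    (graphWeight (p : ℝ)) (fun G => graphWeight_nonneg p.2.1 p.2.2 G) (hnn A) (hnn B) (hmono A hA)
    (hmono B hB) (graphWeight_mul_le _)
  -- FKG gives positive correlation of the increasing events; both conclusions follow by taking
  -- complements.
  have key : μ.real A * μ.real B ≤ μ.real (A ∩ B) := by
    rw [sum_graphWeight, one_mul] at h
    rw [binomialRandom_real_eq_sum, binomialRandom_real_eq_sum, binomialRandom_real_eq_sum]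
    calc _ = _ := by simp only [mul_ite, mul_one, mul_zero]
      _ ≤ _ := h
      _ = _ := Finset.sum_congr rfl fun G _ => by
        by_cases h1 : G ∈ A <;> by_cases h2 : G ∈ B <;> simp [h1, h2]
  have e1 : μ.real (A ∩ Bᶜ) = μ.real A - μ.real (A ∩ B) := by
    have := measureReal_inter_add_sdiff (μ := μ) (s := A) (Set.toFinite B).measurableSet
    rw [Set.sdiff_eq] at this
    linarith
  have e2 : μ.real (Bᶜ) = 1 - μ.real B := probReal_compl_eq_one_sub (Set.toFinite B).measurableSet
  have e3 : μ.real (Aᶜ) = 1 - μ.real A := probReal_compl_eq_one_sub (Set.toFinite A).measurableSet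
  have e4 : μ.real (Aᶜ ∩ Bᶜ) = μ.real Bᶜ - μ.real (A ∩ Bᶜ) := by
    have := measureReal_inter_add_sdiff (μ := μ) (s := Bᶜ) (Set.toFinite A).measurableSet
    rw [Set.sdiff_eq, Set.inter_comm, Set.inter_comm Bᶜ] at this
    linarith
  constructor
  · rw [e4, e1, e2, e3]
    nlinarith
  · rw [e1, e2]
    nlinarith

/-- The adjacency indicator as a real number. -/
noncomputable def adjInd {n : ℕ} (G : SimpleGraph (Fin n)) (u v : Fin n) : ℝ :=
  if G.Adj u v then 1 else 0

lemma sum_offDiag_eq_sum_ltPairs {n : ℕ} (f : Fin n → Fin n → ℝ) (hf : ∀ u, f u u = 0) :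
    ∑ u, ∑ v, f u v = ∑ x ∈ ltPairs n, (f x.1 x.2 + f x.2 x.1) := by
  rw [Finset.sum_add_distrib]
  have h2 : ∑ x ∈ ltPairs n, f x.2 x.1 =
      ∑ x ∈ Finset.univ.filter (fun x : Fin n × Fin n => x.2 < x.1), f x.1 x.2 :=
    Finset.sum_bij (fun x _ => x.swap) (by simp [ltPairs]) (by simp)
      (fun y hy => ⟨y.swap, by simpa [ltPairs] using hy, by simp⟩) (by simp)
  rw [h2, ltPairs, Finset.sum_filter, Finset.sum_filter, ← Finset.sum_add_distrib,
    ← Finset.univ_product_univ, Finset.sum_product]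
  refine Finset.sum_congr rfl fun u _ => Finset.sum_congr rfl fun v _ => ?_
  rcases lt_trichotomy u v with h | rfl | h
  · simp [h, h.asymm]
  · simp [hf]
  · simp [h, h.asymm]

/-- The exponential-moment bound for linear statistics of the edges. -/
lemma chernoff {n : ℕ} (p : unitInterval) (b : Fin n → Fin n → ℝ) (m : ℝ) :
    (SimpleGraph.binomialRandom (Fin n) p).real {G | m ≤ ∑ u, ∑ v, b u v * adjInd G u v} ≤
      Real.exp (-m + (p : ℝ) / 2 *
        ∑ u, ∑ v, if u = v then 0 else (Real.exp (2 * b u v) - 1)) := by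
  rw [binomialRandom_real_eq_sum]
  have hw : ∀ G : SimpleGraph (Fin n), 0 ≤ graphWeight (p : ℝ) G :=
    graphWeight_nonneg p.2.1 p.2.2
  have hsum : ∀ G : SimpleGraph (Fin n), ∑ u, ∑ v, b u v * adjInd G u v =
      ∑ x ∈ ltPairs n, (b x.1 x.2 + b x.2 x.1) * adjInd G x.1 x.2 := by
    intro G
    rw [sum_offDiag_eq_sum_ltPairs _ (fun u => by simp [adjInd])]
    refine Finset.sum_congr rfl fun x _ => ?_
    simp only [adjInd, G.adj_comm x.2 x.1]
    ring
  calc ∑ G, (if G ∈ {G | m ≤ ∑ u, ∑ v, b u v * adjInd G u v} then graphWeight (p : ℝ) G else 0)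
      ≤ ∑ G : SimpleGraph (Fin n), Real.exp (-m) * (∏ x ∈ ltPairs n, if G.Adj x.1 x.2 then
          (p : ℝ) * Real.exp (b x.1 x.2 + b x.2 x.1) else 1 - p) := by
        refine Finset.sum_le_sum fun G _ => ?_
        have e : (∏ x ∈ ltPairs n, if G.Adj x.1 x.2 then
            (p : ℝ) * Real.exp (b x.1 x.2 + b x.2 x.1) else 1 - p) =
            graphWeight (p : ℝ) G * Real.exp (∑ u, ∑ v, b u v * adjInd G u v) := by
          rw [hsum, Real.exp_sum, graphWeight, ← Finset.prod_mul_distrib]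
          refine Finset.prod_congr rfl fun x _ => ?_
          simp only [adjInd]
          split_ifs <;> simp
        rw [e]
        split_ifs with h
        · rw [mul_left_comm, ← Real.exp_add]
          refine le_mul_of_one_le_right (hw G) (Real.one_le_exp ?_)
          simp only [Set.mem_ofPred_eq] at h
          linarith
        · exact mul_nonneg (Real.exp_nonneg _) (mul_nonneg (hw G) (Real.exp_nonneg _))
    _ = Real.exp (-m) * ∏ x ∈ ltPairs n,
          ((p : ℝ) * Real.exp (b x.1 x.2 + b x.2 x.1) + (1 - p)) := by
        rw [← Finset.mul_sum, sum_graph_prod]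
    _ ≤ Real.exp (-m) * ∏ x ∈ ltPairs n, Real.exp ((p : ℝ) / 2 *
          ((Real.exp (2 * b x.1 x.2) - 1) + (Real.exp (2 * b x.2 x.1) - 1))) := by
        refine mul_le_mul_of_nonneg_left ?_ (Real.exp_nonneg _)
        refine Finset.prod_le_prod (fun x _ => ?_) fun x _ => ?_
        · have := Real.exp_nonneg (b x.1 x.2 + b x.2 x.1)
          have := p.2.1
          have := p.2.2
          nlinarith
        · refine le_trans ?_ (Real.add_one_le_exp _)
          -- An unordered pair carries both weights `b u v` and `b v u`. AM-GM separates them, at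
          -- the price of the factor `2` in the exponent and with a compensating `1 / 2` in front.
          have h1 : Real.exp (b x.1 x.2 + b x.2 x.1) ≤
              (Real.exp (2 * b x.1 x.2) + Real.exp (2 * b x.2 x.1)) / 2 := by
            rw [Real.exp_add, two_mul, two_mul, Real.exp_add, Real.exp_add]
            nlinarith [sq_nonneg (Real.exp (b x.1 x.2) - Real.exp (b x.2 x.1))]
          have := p.2.1
          nlinarith
    _ = _ := by
        rw [← Real.exp_sum, ← Real.exp_add, ← Finset.mul_sum,
          sum_offDiag_eq_sum_ltPairs _ (fun u => by simp)]
        congr 3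
        refine Finset.sum_congr rfl fun x hx => ?_
        have := mem_ltPairs.1 hx
        simp [this.ne, this.ne']

/-- The probability that all edges of a set are present. -/
lemma binomialRandom_real_subset_le {n : ℕ} (p : unitInterval) (F : Finset (Sym2 (Fin n)))
    (hF : ∀ e ∈ F, ¬ e.IsDiag) :
    (SimpleGraph.binomialRandom (Fin n) p).real {G | ∀ e ∈ F, e ∈ G.edgeSet} ≤
      (p : ℝ) ^ F.card := by
  rw [binomialRandom_real_eq_sum]
  have hcard : ((ltPairs n).filter fun x => s(x.1, x.2) ∈ F).card = F.card := by
    refine Finset.card_bij (fun x _ => s(x.1, x.2)) ?_ ?_ ?_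
    · intro x hx
      exact (Finset.mem_filter.1 hx).2
    · intro x hx y hy e
      exact mk_injOn_ltPairs (Finset.mem_filter.1 hx).1 (Finset.mem_filter.1 hy).1 e
    · intro e he
      obtain ⟨x, hx, rfl⟩ := exists_ltPairs_of_not_isDiag e (hF e he)
      exact ⟨x, Finset.mem_filter.2 ⟨hx, he⟩, rfl⟩
  have h0 := p.2.1
  have h1 := p.2.2
  -- A missing edge of `F` gets factor `0`, so the event is encoded in the product and the sum over
  -- graphs factorizes.
  calc _ ≤ ∑ G : SimpleGraph (Fin n), ∏ x ∈ ltPairs n, (if G.Adj x.1 x.2 then (p : ℝ)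
          else if s(x.1, x.2) ∈ F then 0 else 1 - (p : ℝ)) := by
        refine Finset.sum_le_sum fun G _ => ?_
        split_ifs with h
        · refine le_of_eq (Finset.prod_congr rfl fun x _ => ?_)
          by_cases ha : G.Adj x.1 x.2
          · simp [ha]
          · have : s(x.1, x.2) ∉ F := fun hm => ha (by simpa using h _ hm)
            simp [ha, this]
        · refine Finset.prod_nonneg fun x _ => ?_
          split_ifs <;> linarith
    _ = ∏ x ∈ ltPairs n, ((p : ℝ) + if s(x.1, x.2) ∈ F then 0 else 1 - (p : ℝ)) := sum_graph_prod _ _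
    _ = ∏ x ∈ ltPairs n, (if s(x.1, x.2) ∈ F then (p : ℝ) else 1) := by
        refine Finset.prod_congr rfl fun x _ => ?_
        split_ifs <;> ring
    _ ≤ _ := by
        rw [Finset.prod_ite]
        simp [hcard]

/-! ### Spectral norms and quadratic forms -/

/-- Rounding towards zero: the rounded vector must not leave the ball. -/
lemma exists_int_abs_le (r : ℝ) : ∃ k : ℤ, |(k : ℝ)| ≤ |r| ∧ |r - k| ≤ 1 := by
  rcases le_total 0 r with h | h
  · refine ⟨⌊r⌋, ?_, ?_⟩
    · rw [abs_of_nonneg h, abs_of_nonneg (by exact_mod_cast Int.floor_nonneg.2 h)]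
      exact Int.floor_le r
    · rw [abs_of_nonneg (by linarith [Int.floor_le r])]
      linarith [Int.lt_floor_add_one r]
  · refine ⟨⌈r⌉, ?_, ?_⟩
    · rw [abs_of_nonpos h, abs_of_nonpos (by exact_mod_cast Int.ceil_nonpos.2 h)]
      linarith [Int.le_ceil r]
    · rw [abs_of_nonpos (by linarith [Int.le_ceil r])]
      linarith [Int.ceil_lt_add_one r]

lemma inner_toEuclideanCLM {n : ℕ} (N : Matrix (Fin n) (Fin n) ℝ) (x : EuclideanSpace ℝ (Fin n)) :
    inner ℝ (Matrix.toEuclideanCLM (n := Fin n) (𝕜 := ℝ) N x) x =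
      ∑ u, ∑ v, N u v * x u * x v := by
  rw [PiLp.inner_apply]
  refine Finset.sum_congr rfl fun u _ => ?_
  have h : (Matrix.toEuclideanCLM (n := Fin n) (𝕜 := ℝ) N x) u = ∑ v, N u v * x v := by
    rw [Matrix.ofLp_toEuclideanCLM]
    rfl
  rw [h]
  simp only [RCLike.inner_apply, conj_trivial, Finset.mul_sum]
  exact Finset.sum_congr rfl fun v _ => by ring

/-- The spectral norm of a symmetric matrix is controlled by its quadratic form on the integer
points of a ball. -/
lemma specNorm_le_of_lattice {n : ℕ} (N : Matrix (Fin n) (Fin n) ℝ) (hN : N.IsSymm) {β : ℝ}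
    (hβ : 0 ≤ β)
    (h : ∀ z : Fin n → ℤ, ∑ u, (z u : ℝ) ^ 2 ≤ 16 * n →
      |∑ u, ∑ v, N u v * z u * z v| ≤ β * (16 * n)) :
    specNorm N ≤ 2 * β := by
  set T := Matrix.toEuclideanCLM (n := Fin n) (𝕜 := ℝ) N with hT
  have hsa : IsSelfAdjoint T := by
    rw [IsSelfAdjoint, hT, ← map_star, Matrix.star_eq_conjTranspose,
      Matrix.conjTranspose_eq_transpose_of_trivial, hN.eq]
  have hsymm : (T : EuclideanSpace ℝ (Fin n) →ₗ[ℝ] EuclideanSpace ℝ (Fin n)).IsSymmetric :=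
    ContinuousLinearMap.isSelfAdjoint_iff_isSymmetric.1 hsa
  have key : ∀ x : EuclideanSpace ℝ (Fin n), ‖x‖ = 1 → |inner ℝ (T x) x| ≤ β + ‖T‖ / 2 := by
    intro x hx
    have hn : (0 : ℝ) < n := by
      rcases Nat.eq_zero_or_pos n with rfl | hn
      · have : x = 0 := Subsingleton.elim _ _
        simp [this] at hx
      · exact_mod_cast hn
    -- At scale `L` the rounded point has squared norm at most `L ^ 2 = 16 n`, and the error after
    -- rescaling is at most `√n / L = 1 / 4`. The two cross terms then cost `‖T‖ / 4` each.
    set L : ℝ := 4 * √n with hL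
    have hLpos : 0 < L := by positivity
    have hL2 : L ^ 2 = 16 * n := by
      rw [hL, mul_pow, Real.sq_sqrt hn.le]; norm_num
    choose z hz1 hz2 using fun u => exists_int_abs_le (L * x u)
    have hxs : ∑ u, x u ^ 2 = 1 := by
      have := EuclideanSpace.real_norm_sq_eq x
      rw [hx] at this
      linarith
    have hzs : ∑ u, (z u : ℝ) ^ 2 ≤ 16 * n := by
      calc ∑ u, (z u : ℝ) ^ 2 ≤ ∑ u, (L * x u) ^ 2 :=
            Finset.sum_le_sum fun u _ => sq_le_sq.2 (hz1 u)
        _ = 16 * n := by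
            simp only [mul_pow]
            rw [← Finset.mul_sum, hxs, hL2, mul_one]
    set y : EuclideanSpace ℝ (Fin n) := WithLp.toLp 2 fun u => (z u : ℝ) / L with hy
    have hyu : ∀ u, y u = (z u : ℝ) / L := fun u => rfl
    have hyn : ‖y‖ ≤ 1 := by
      have : ‖y‖ ^ 2 ≤ 1 := by
        rw [EuclideanSpace.real_norm_sq_eq]
        simp only [hyu, div_pow]
        rw [← Finset.sum_div, hL2, div_le_one (by positivity)]
        exact hzs
      nlinarith [norm_nonneg y]
    have hxy : ‖x - y‖ ≤ 1 / 4 := by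
      have : ‖x - y‖ ^ 2 ≤ 1 / 16 := by
        rw [EuclideanSpace.real_norm_sq_eq]
        calc ∑ u, (x - y) u ^ 2 ≤ ∑ _u : Fin n, 1 / L ^ 2 := by
              refine Finset.sum_le_sum fun u _ => ?_
              have e : (x - y) u = (L * x u - z u) / L := by
                rw [PiLp.sub_apply, hyu]
                field_simp
              rw [e, div_pow]
              refine div_le_div_of_nonneg_right ?_ (by positivity)
              exact (sq_le_one_iff_abs_le_one _).2 (hz2 u)
          _ = 1 / 16 := by
              simp only [Finset.sum_const, Finset.card_univ, Fintype.card_fin, nsmul_eq_mul]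
              rw [hL2]
              field_simp
      nlinarith [norm_nonneg (x - y)]
    have hQy : |inner ℝ (T y) y| ≤ β := by
      rw [hT, inner_toEuclideanCLM]
      have e : ∑ u, ∑ v, N u v * y u * y v = (∑ u, ∑ v, N u v * z u * z v) / (16 * n) := by
        rw [← hL2, Finset.sum_div]
        refine Finset.sum_congr rfl fun u _ => ?_
        rw [Finset.sum_div]
        refine Finset.sum_congr rfl fun v _ => ?_
        rw [hyu, hyu]
        field_simp
      rw [e, abs_div, abs_of_pos (by positivity : (0 : ℝ) < 16 * n), div_le_iff₀ (by positivity)]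
      exact h z hzs
    have e : inner ℝ (T x) x = inner ℝ (T y) y + (inner ℝ (T (x - y)) x + inner ℝ (T y) (x - y)) := by
      rw [map_sub, inner_sub_left, inner_sub_right]
      ring
    have b1 : |inner ℝ (T (x - y)) x| ≤ ‖T‖ * (1 / 4) := by
      calc _ ≤ ‖T (x - y)‖ * ‖x‖ := abs_real_inner_le_norm _ _
        _ ≤ ‖T‖ * ‖x - y‖ * 1 := by rw [hx]; gcongr; exact T.le_opNorm _
        _ ≤ _ := by rw [mul_one]; gcongr
    have b2 : |inner ℝ (T y) (x - y)| ≤ ‖T‖ * (1 / 4) := by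
      calc _ ≤ ‖T y‖ * ‖x - y‖ := abs_real_inner_le_norm _ _
        _ ≤ (‖T‖ * ‖y‖) * (1 / 4) := by gcongr; exact T.le_opNorm _
        _ ≤ (‖T‖ * 1) * (1 / 4) := by gcongr
        _ = _ := by ring
    rw [e]
    calc _ ≤ |inner ℝ (T y) y| + (|inner ℝ (T (x - y)) x| + |inner ℝ (T y) (x - y)|) :=
          (abs_add_le _ _).trans (add_le_add le_rfl (abs_add_le _ _))
      _ ≤ _ := by linarith
  -- For a self-adjoint operator the norm is the supremum of the Rayleigh quotients, so the rounding
  -- loss `‖T‖ / 2` can be absorbed on the left.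
  have hle : ‖T‖ ≤ β + ‖T‖ / 2 := by
    conv_lhs => rw [ContinuousLinearMap.norm_eq_iSup_rayleighQuotient T hsymm]
    refine ciSup_le fun x => ?_
    by_cases hx : x = 0
    · rw [hx, ContinuousLinearMap.rayleighQuotient_apply_zero, abs_zero]
      positivity
    · have hx' : ‖x‖ ≠ 0 := norm_ne_zero_iff.2 hx
      have h1 := key (‖x‖⁻¹ • x) (by rw [norm_smul, norm_inv, norm_norm, inv_mul_cancel₀ hx'])
      have e : T.rayleighQuotient x = inner ℝ (T (‖x‖⁻¹ • x)) (‖x‖⁻¹ • x) := by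
        rw [ContinuousLinearMap.rayleighQuotient, ContinuousLinearMap.reApplyInnerSelf_apply,
          map_smul, inner_smul_left, inner_smul_right]
        simp only [RCLike.re_to_real, conj_trivial]
        field_simp
      rw [e]
      exact h1
  have : specNorm N = ‖T‖ := rfl
  linarith

/-! ### Quadratic forms of degenerate graphs -/

lemma adjInd_nonneg {n : ℕ} (G : SimpleGraph (Fin n)) (u v : Fin n) : 0 ≤ adjInd G u v := by
  unfold adjInd; split_ifs <;> norm_num

lemma adjInd_comm {n : ℕ} (G : SimpleGraph (Fin n)) (u v : Fin n) :
    adjInd G u v = adjInd G v u := by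
  simp [adjInd, G.adj_comm]

lemma adjInd_self {n : ℕ} (G : SimpleGraph (Fin n)) (u : Fin n) : adjInd G u u = 0 := by
  simp [adjInd]

lemma sum_adjInd {n : ℕ} (G : SimpleGraph (Fin n)) (u : Fin n) :
    ∑ v, adjInd G u v = G.degree u := by
  simp only [adjInd, Finset.sum_boole]
  congr 1
  rw [← SimpleGraph.card_neighborFinset_eq_degree]
  congr 1
  ext v
  simp

/-- Remove a vertex `v` of degree at most `D` and split each of its edges by `2 w u * w v ≤ θ * w u
^ 2 + w v ^ 2 / θ`. The second term is charged to `v` at most `D` times; the first is charged to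
`u`, once for each edge at `u`. For `θ = 1 / √d` and degrees `O(d)` both charges are `O(√d)`. -/
lemma quadForm_le_of_degenerate {n : ℕ} (G : SimpleGraph (Fin n)) (D θ : ℝ) (hθ : 0 < θ)
    (w : Fin n → ℝ) (S : Finset (Fin n))
    (h : ∀ S' ⊆ S, S'.Nonempty → ∃ v ∈ S', ∑ u ∈ S', adjInd G v u ≤ D) :
    ∑ u ∈ S, ∑ v ∈ S, adjInd G u v * (w u * w v) ≤
      ∑ u ∈ S, w u ^ 2 * (D / θ + θ * ∑ v ∈ S, adjInd G u v) := by
  induction hk : S.card generalizing S with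
  | zero =>
    rw [Finset.card_eq_zero.1 hk]
    simp
  | succ k ih =>
    obtain ⟨v, hv, hD⟩ := h S subset_rfl (Finset.card_pos.1 (by omega))
    set S' := S.erase v with hS'
    have hvS' : v ∉ S' := Finset.notMem_erase v S
    have hS : S = insert v S' := (Finset.insert_erase hv).symm
    have hih := ih S' (fun T hT => h T (hT.trans (Finset.erase_subset v S)))
      (by rw [hS', Finset.card_erase_of_mem hv, hk]; rfl)
    have hd : ∑ u ∈ S', adjInd G v u ≤ D := by
      rw [hS, Finset.sum_insert hvS', adjInd_self, zero_add] at hD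
      exact hD
    have e1 : ∑ u ∈ S, ∑ u' ∈ S, adjInd G u u' * (w u * w u') =
        ∑ u ∈ S', ∑ u' ∈ S', adjInd G u u' * (w u * w u') +
          ∑ u ∈ S', adjInd G v u * (2 * (w u * w v)) := by
      rw [hS, Finset.sum_insert hvS']
      simp only [Finset.sum_insert hvS', adjInd_self, zero_mul, zero_add, Finset.sum_add_distrib]
      rw [← add_assoc, add_comm, ← Finset.sum_add_distrib]
      congr 1
      refine Finset.sum_congr rfl fun u _ => ?_
      rw [adjInd_comm G u v]
      ring
    have e2 : ∑ u ∈ S, w u ^ 2 * (D / θ + θ * ∑ u' ∈ S, adjInd G u u') =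
        ∑ u ∈ S', w u ^ 2 * (D / θ + θ * ∑ u' ∈ S', adjInd G u u') +
          (∑ u ∈ S', adjInd G v u * (θ * w u ^ 2) +
            w v ^ 2 * (D / θ + θ * ∑ u' ∈ S', adjInd G v u')) := by
      rw [hS, Finset.sum_insert hvS']
      simp only [Finset.sum_insert hvS', adjInd_self, zero_add]
      rw [← add_assoc, ← Finset.sum_add_distrib, add_comm]
      congr 1
      refine Finset.sum_congr rfl fun u _ => ?_
      rw [adjInd_comm G u v]
      ring
    have e3 : ∑ u ∈ S', adjInd G v u * (2 * (w u * w v)) ≤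
        ∑ u ∈ S', adjInd G v u * (θ * w u ^ 2) + w v ^ 2 / θ * ∑ u ∈ S', adjInd G v u := by
      rw [Finset.mul_sum, ← Finset.sum_add_distrib]
      refine Finset.sum_le_sum fun u _ => ?_
      rw [mul_comm (w v ^ 2 / θ), ← mul_add]
      refine mul_le_mul_of_nonneg_left ?_ (adjInd_nonneg G v u)
      have : θ * w u ^ 2 + w v ^ 2 / θ - 2 * (w u * w v) = (θ * w u - w v) ^ 2 / θ := by
        field_simp
        ring
      have : 0 ≤ (θ * w u - w v) ^ 2 / θ := by positivity
      linarith
    have e4 : w v ^ 2 / θ * ∑ u ∈ S', adjInd G v u ≤ w v ^ 2 * (D / θ) := by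
      calc _ ≤ w v ^ 2 / θ * D := by gcongr
        _ = _ := by ring
    have e5 : 0 ≤ w v ^ 2 * (θ * ∑ u' ∈ S', adjInd G v u') :=
      mul_nonneg (sq_nonneg _) (mul_nonneg hθ.le (Finset.sum_nonneg fun u _ => adjInd_nonneg G v u))
    rw [e1, e2]
    linarith

/-! ### Heavy pairs -/

/-- The number of ordered pairs in `A × B` which are edges. -/
noncomputable def edgeCount {n : ℕ} (G : SimpleGraph (Fin n)) (A B : Finset (Fin n)) : ℝ :=
  ∑ u ∈ A, ∑ v ∈ B, adjInd G u v

lemma sum_two_pow_lt_le (J : ℕ) {X : ℝ} (hX : 0 < X) :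
    ∑ j ∈ Finset.range J, (if (2 : ℝ) ^ j < X then (2 : ℝ) ^ j else 0) ≤ 2 * X := by
  -- The second bound makes the induction close: if the new term `2 ^ J` is below `X`, all earlier
  -- terms together are at most `2 ^ J`.
  suffices h : ∑ j ∈ Finset.range J, (if (2 : ℝ) ^ j < X then (2 : ℝ) ^ j else 0) ≤ 2 * X ∧
      ∑ j ∈ Finset.range J, (if (2 : ℝ) ^ j < X then (2 : ℝ) ^ j else 0) ≤ 2 ^ J from h.1
  induction J with
  | zero => simpa using hX.le
  | succ J ih =>
    rw [Finset.sum_range_succ, pow_succ]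
    split_ifs with h
    · constructor <;> linarith [ih.1, ih.2]
    · have : (0 : ℝ) < 2 ^ J := by positivity
      constructor <;> linarith [ih.1, ih.2]

/-- The series which bounds the contribution of the pairs of levels in which the edge count is
governed by the entropy of the larger level. -/
noncomputable def levelSeries : ℝ := ∑' i : ℕ, (96 * i + 6) * (√2 / 2) ^ i

lemma sqrt_two_div_two_lt_one : √2 / 2 < 1 := by
  have : √2 < 2 := by
    rw [Real.sqrt_lt' (by norm_num)]; norm_num
  linarith

lemma summable_levelSeries : Summable fun i : ℕ => (96 * (i : ℝ) + 6) * (√2 / 2) ^ i := by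
  have h0 : 0 ≤ √2 / 2 := by positivity
  have h1 : ‖√2 / 2‖ < 1 := by
    rw [Real.norm_of_nonneg h0]; exact sqrt_two_div_two_lt_one
  have h2 := summable_pow_mul_geometric_of_norm_lt_one 1 h1
  have h3 := summable_geometric_of_lt_one h0 sqrt_two_div_two_lt_one
  refine ((h2.mul_left 96).add (h3.mul_left 6)).congr fun i => ?_
  ring

lemma levelSeries_nonneg : 0 ≤ levelSeries := tsum_nonneg fun i => by positivity

/-! ### Dyadic levels of the weights -/

section Levels

variable {n : ℕ} (w : Fin n → ℕ)

/-- The vertices of weight in `[2 ^ i, 2 ^ (i + 1))`. -/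
def weightLevel (i : ℕ) : Finset (Fin n) :=
  Finset.univ.filter fun u => w u ≠ 0 ∧ Nat.log 2 (w u) = i

/-- The mass of a weight level. -/
noncomputable def levelMass (i : ℕ) : ℝ := ∑ u ∈ weightLevel w i, (w u : ℝ) ^ 2

lemma levelMass_nonneg (i : ℕ) : 0 ≤ levelMass w i :=
  Finset.sum_nonneg fun _ _ => sq_nonneg _

lemma mem_weightLevel {i : ℕ} {u : Fin n} :
    u ∈ weightLevel w i ↔ w u ≠ 0 ∧ Nat.log 2 (w u) = i := by
  simp [weightLevel]

lemma two_pow_le_of_mem_weightLevel {i : ℕ} {u : Fin n} (h : u ∈ weightLevel w i) :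
    (2 : ℝ) ^ i ≤ w u ∧ (w u : ℝ) < 2 * 2 ^ i := by
  obtain ⟨h0, rfl⟩ := (mem_weightLevel w).1 h
  constructor
  · exact_mod_cast Nat.pow_log_le_self 2 h0
  · have := Nat.lt_pow_succ_log_self (b := 2) (by norm_num) (w u)
    rw [pow_succ, mul_comm] at this
    exact_mod_cast this

lemma four_pow_mul_card_le (i : ℕ) :
    (4 : ℝ) ^ i * (weightLevel w i).card ≤ levelMass w i := by
  rw [levelMass, mul_comm, ← nsmul_eq_mul, ← Finset.sum_const]
  refine Finset.sum_le_sum fun u hu => ?_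
  have h := (two_pow_le_of_mem_weightLevel w hu).1
  calc (4 : ℝ) ^ i = (2 ^ i) ^ 2 := by rw [← pow_mul, mul_comm, pow_mul]; norm_num
    _ ≤ _ := by gcongr

lemma sum_levelMass_le (I : ℕ) :
    ∑ i ∈ Finset.range I, levelMass w i ≤ ∑ u, (w u : ℝ) ^ 2 := by
  simp only [levelMass, weightLevel, Finset.sum_filter]
  rw [Finset.sum_comm]
  refine Finset.sum_le_sum fun u _ => ?_
  by_cases h : w u = 0
  · simp [h]
  · simp only [ne_eq, h, not_false_eq_true, true_and, Finset.sum_ite_eq]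
    split_ifs
    · exact le_rfl
    · positivity

lemma levelMass_le (i : ℕ) : levelMass w i ≤ ∑ u, (w u : ℝ) ^ 2 :=
  Finset.sum_le_sum_of_subset_of_nonneg (Finset.subset_univ _) fun _ _ _ => sq_nonneg _

end Levels

/-- The bound for the number of edges between two weight levels. -/
lemma levelPair_le {n : ℕ} (G : SimpleGraph (Fin n)) {d : ℝ} (hd : 1 < d) (hn : 0 < n)
    (w : Fin n → ℕ) (hw : ∑ u, (w u : ℝ) ^ 2 ≤ 16 * n) (i j : ℕ)
    (hF : ∀ A B : Finset (Fin n), edgeCount G A B ≤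
      3 * (d / n) * (A.card * B.card) + 3 * i * (A.card + B.card) + 6 * n / 4 ^ i)
    (hD : ∀ A B : Finset (Fin n), A.card * d * 2 ^ i ≤ 16 * n →
      edgeCount G A B ≤ 60 * (A.card + B.card + n / 8 ^ i))
    (hij : i ≤ j) (hheavy : √d < 4 * 2 ^ (i + j)) :
    4 * 2 ^ (i + j) * edgeCount G (weightLevel w j) (weightLevel w i) ≤
      48 * √d / n * (levelMass w i * levelMass w j) +
        (if (2 : ℝ) ^ j < √d * √2 ^ i then 4 * (96 * (i : ℝ) + 6) * n / 2 ^ i * 2 ^ j else 0) +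
        240 * (2 ^ i / 2 ^ j * levelMass w j + 2 ^ j / 2 ^ i * levelMass w i +
          n * 2 ^ j / 4 ^ i) := by
  have hn' : (0 : ℝ) < n := by exact_mod_cast hn
  have hd0 : 0 < d := by linarith
  have hsd : 0 < √d := Real.sqrt_pos.2 hd0
  have hsd2 : √d * √d = d := Real.mul_self_sqrt hd0.le
  set a : ℝ := ((weightLevel w i).card : ℝ) with ha
  set b : ℝ := ((weightLevel w j).card : ℝ) with hb
  set α := levelMass w i with hα
  set γ := levelMass w j with hγ
  have ha0 : 0 ≤ a := Nat.cast_nonneg _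
  have hb0 : 0 ≤ b := Nat.cast_nonneg _
  have hα0 : 0 ≤ α := levelMass_nonneg w i
  have hγ0 : 0 ≤ γ := levelMass_nonneg w j
  have haα : 4 ^ i * a ≤ α := four_pow_mul_card_le w i
  have hbγ : 4 ^ j * b ≤ γ := four_pow_mul_card_le w j
  have hα16 : α ≤ 16 * n := (levelMass_le w i).trans hw
  have hγ16 : γ ≤ 16 * n := (levelMass_le w j).trans hw
  have h2i : (0 : ℝ) < 2 ^ i := by positivity
  have h2j : (0 : ℝ) < 2 ^ j := by positivity
  have h4i : (4 : ℝ) ^ i = 2 ^ i * 2 ^ i := by rw [← mul_pow]; norm_num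
  have h4j : (4 : ℝ) ^ j = 2 ^ j * 2 ^ j := by rw [← mul_pow]; norm_num
  have h8i : (8 : ℝ) ^ i = 2 ^ i * 2 ^ i * 2 ^ i := by rw [← mul_pow, ← mul_pow]; norm_num
  have h2ij : (2 : ℝ) ^ i ≤ 2 ^ j := pow_le_pow_right₀ (by norm_num) hij
  have hs2 : √2 ^ i * √2 ^ i = (2 : ℝ) ^ i := by
    rw [← mul_pow, Real.mul_self_sqrt (by norm_num)]
  have hs2' : 0 < √2 ^ i := by positivity
  rw [h4i] at haα
  rw [h4j] at hbγ
  rw [pow_add] at hheavy ⊢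
  have hp1 : 0 ≤ 48 * √d / n * (α * γ) := by positivity
  have hp3 : 0 ≤ 240 * (2 ^ i / 2 ^ j * γ + 2 ^ j / 2 ^ i * α + n * 2 ^ j / 4 ^ i) := by positivity
  -- The threshold compares `4 ^ j` with `d * 2 ^ i`. Below it the general discrepancy bound `hF` is
  -- used; above it level `j` is small enough for `hD`.
  split_ifs with hc
  · have h1 : 4 * (2 ^ i * 2 ^ j) * (3 * (d / n) * (b * a)) ≤ 48 * √d / n * (α * γ) := by
      have hba : (2 ^ i * 2 ^ i * a) * (2 ^ j * 2 ^ j * b) ≤ α * γ :=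
        mul_le_mul haα hbγ (by positivity) hα0
      -- Heaviness of the pair is spent here: it trades one `√d` of the mean edge count for the
      -- product of the weights.
      have hd4 : d ≤ √d * (4 * (2 ^ i * 2 ^ j)) := by
        have := mul_le_mul_of_nonneg_left hheavy.le hsd.le
        rwa [hsd2] at this
      calc 4 * (2 ^ i * 2 ^ j) * (3 * (d / n) * (b * a)) = d * (12 * (2 ^ i * 2 ^ j) * (b * a) / n) := by
            ring
        _ ≤ √d * (4 * (2 ^ i * 2 ^ j)) * (12 * (2 ^ i * 2 ^ j) * (b * a) / n) := by gcongr
        _ = 48 * √d / n * ((2 ^ i * 2 ^ i * a) * (2 ^ j * 2 ^ j * b)) := by ring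
        _ ≤ _ := by gcongr
    have h2 : 4 * (2 ^ i * 2 ^ j) * (3 * i * (b + a) + 6 * n / 4 ^ i) ≤
        4 * (96 * i + 6) * n / 2 ^ i * 2 ^ j := by
      -- Both levels have at most `16 n / 4 ^ i` vertices, the upper one because `i ≤ j`; hence `3 *
      -- i * 32 = 96 * i`.
      have hA : a ≤ 16 * n / (2 ^ i * 2 ^ i) := by
        rw [le_div_iff₀ (by positivity)]; linarith
      have hB : b ≤ 16 * n / (2 ^ i * 2 ^ i) := by
        rw [le_div_iff₀ (by positivity)]
        have : b * (2 ^ i * 2 ^ i) ≤ b * (2 ^ j * 2 ^ j) := by gcongr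
        linarith
      calc 4 * (2 ^ i * 2 ^ j) * (3 * i * (b + a) + 6 * n / 4 ^ i)
          ≤ 4 * (2 ^ i * 2 ^ j) * (3 * i * (16 * n / (2 ^ i * 2 ^ i) + 16 * n / (2 ^ i * 2 ^ i)) +
            6 * n / 4 ^ i) := by gcongr
        _ = _ := by rw [h4i]; field_simp; ring
    calc 4 * (2 ^ i * 2 ^ j) * edgeCount G (weightLevel w j) (weightLevel w i)
        ≤ 4 * (2 ^ i * 2 ^ j) * (3 * (d / n) * (b * a) + 3 * i * (b + a) + 6 * n / 4 ^ i) := by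
          gcongr
          exact hF _ _
      _ = 4 * (2 ^ i * 2 ^ j) * (3 * (d / n) * (b * a)) +
          4 * (2 ^ i * 2 ^ j) * (3 * i * (b + a) + 6 * n / 4 ^ i) := by ring
      _ ≤ _ := by linarith
  · have hc' : √d * √2 ^ i ≤ 2 ^ j := not_lt.1 hc
    have hd2 : d * 2 ^ i ≤ 2 ^ j * 2 ^ j := by
      calc d * 2 ^ i = (√d * √2 ^ i) * (√d * √2 ^ i) := by
            rw [← hs2]
            conv_lhs => rw [← hsd2]
            ring
        _ ≤ _ := by gcongr
    have hsize : b * d * 2 ^ i ≤ 16 * n := by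
      calc b * d * 2 ^ i = b * (d * 2 ^ i) := by ring
        _ ≤ b * (2 ^ j * 2 ^ j) := by gcongr
        _ ≤ _ := by linarith
    have h := hD (weightLevel w j) (weightLevel w i) hsize
    have h1 : 2 ^ i * 2 ^ j * b ≤ 2 ^ i / 2 ^ j * γ := by
      calc 2 ^ i * 2 ^ j * b = 2 ^ i / 2 ^ j * (2 ^ j * 2 ^ j * b) := by field_simp
        _ ≤ _ := by gcongr
    have h2 : 2 ^ i * 2 ^ j * a ≤ 2 ^ j / 2 ^ i * α := by
      calc 2 ^ i * 2 ^ j * a = 2 ^ j / 2 ^ i * (2 ^ i * 2 ^ i * a) := by field_simp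
        _ ≤ _ := by gcongr
    have h3 : 2 ^ i * 2 ^ j * (n / 8 ^ i) = n * 2 ^ j / (4 : ℝ) ^ i := by
      rw [h8i, h4i]; field_simp
    calc 4 * (2 ^ i * 2 ^ j) * edgeCount G (weightLevel w j) (weightLevel w i)
        ≤ 4 * (2 ^ i * 2 ^ j) * (60 * (b + a + n / 8 ^ i)) := by gcongr
      _ = 240 * (2 ^ i * 2 ^ j * b + 2 ^ i * 2 ^ j * a + 2 ^ i * 2 ^ j * (n / 8 ^ i)) := by ring
      _ ≤ 240 * (2 ^ i / 2 ^ j * γ + 2 ^ j / 2 ^ i * α + n * 2 ^ j / 4 ^ i) := by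
          rw [h3]; gcongr
      _ ≤ _ := by linarith

/-- The sum over all admissible pairs of weight levels. -/
lemma sum_levelPair_le {n : ℕ} (G : SimpleGraph (Fin n)) {d : ℝ} (hd : 1 < d) (hn : 0 < n)
    (w : Fin n → ℕ) (hw : ∑ u, (w u : ℝ) ^ 2 ≤ 16 * n) (I J : ℕ)
    (hF : ∀ i < I, ∀ A B : Finset (Fin n), edgeCount G A B ≤
      3 * (d / n) * (A.card * B.card) + 3 * i * (A.card + B.card) + 6 * n / 4 ^ i)
    (hD : ∀ i < I, ∀ A B : Finset (Fin n), A.card * d * 2 ^ i ≤ 16 * n →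
      edgeCount G A B ≤ 60 * (A.card + B.card + n / 8 ^ i)) :
    ∑ i ∈ Finset.range I, ∑ j ∈ Finset.range J,
      (if i ≤ j ∧ (2 : ℝ) ^ j < 2 * √d * 2 ^ i ∧ √d < 4 * 2 ^ (i + j) then
        4 * 2 ^ (i + j) * edgeCount G (weightLevel w j) (weightLevel w i) else 0) ≤
      (48 * 256 + 8 * levelSeries + 240 * (64 + 64 + 8)) * (√d * n) := by
  have hn' : (0 : ℝ) < n := by exact_mod_cast hn
  have hd0 : 0 < d := by linarith
  have hsd : 1 ≤ √d := Real.one_le_sqrt.2 hd.le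
  set α := levelMass w with hα
  have hα0 : ∀ i, 0 ≤ α i := levelMass_nonneg w
  have hαs : ∀ I, ∑ i ∈ Finset.range I, α i ≤ 16 * n := fun I => (sum_levelMass_le w I).trans hw
  -- Each error term keeps only the constraint under which it sums geometrically: in `i` up to `2 *
  -- 2 ^ j`, or in `j` up to a multiple of `√d * √2 ^ i` or `√d * 2 ^ i`.
  have hterm : ∀ i ∈ Finset.range I, ∀ j ∈ Finset.range J,
      (if i ≤ j ∧ (2 : ℝ) ^ j < 2 * √d * 2 ^ i ∧ √d < 4 * 2 ^ (i + j) then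
        4 * 2 ^ (i + j) * edgeCount G (weightLevel w j) (weightLevel w i) else 0) ≤
      48 * √d / n * (α i * α j) +
        4 * (96 * i + 6) * n / 2 ^ i * (if (2 : ℝ) ^ j < √d * √2 ^ i then 2 ^ j else 0) +
        (240 * α j / 2 ^ j * (if (2 : ℝ) ^ i < 2 * 2 ^ j then 2 ^ i else 0) +
          240 * (α i / 2 ^ i + n / 4 ^ i) *
            (if (2 : ℝ) ^ j < 2 * √d * 2 ^ i then 2 ^ j else 0)) := by
    intro i hi j _
    have hi' := Finset.mem_range.1 hi
    have hαi := hα0 i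
    have hαj := hα0 j
    by_cases h : i ≤ j ∧ (2 : ℝ) ^ j < 2 * √d * 2 ^ i ∧ √d < 4 * 2 ^ (i + j)
    · have h2 : (2 : ℝ) ^ i < 2 * 2 ^ j := by
        have h3 : (2 : ℝ) ^ i ≤ 2 ^ j := pow_le_pow_right₀ (by norm_num) h.1
        have h4 : (0 : ℝ) < 2 ^ j := by positivity
        linarith
      have h5 := levelPair_le G hd hn w hw i j (hF i hi') (hD i hi') h.1 h.2.2
      rw [if_pos h, if_pos h2, if_pos h.2.1]
      refine h5.trans (le_of_eq ?_)
      rw [← hα]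
      split_ifs <;> ring
    · rw [if_neg h]
      have p1 : (0 : ℝ) ≤ if (2 : ℝ) ^ j < √d * √2 ^ i then 2 ^ j else 0 := by
        split_ifs <;> positivity
      have p2 : (0 : ℝ) ≤ if (2 : ℝ) ^ i < 2 * 2 ^ j then 2 ^ i else 0 := by
        split_ifs <;> positivity
      have p3 : (0 : ℝ) ≤ if (2 : ℝ) ^ j < 2 * √d * 2 ^ i then 2 ^ j else 0 := by
        split_ifs <;> positivity
      refine add_nonneg (add_nonneg ?_ (mul_nonneg ?_ p1))
        (add_nonneg (mul_nonneg ?_ p2) (mul_nonneg ?_ p3)) <;> positivity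
  refine (Finset.sum_le_sum fun i hi => Finset.sum_le_sum (hterm i hi)).trans ?_
  simp only [Finset.sum_add_distrib]
  have s1 : ∑ i ∈ Finset.range I, ∑ j ∈ Finset.range J, 48 * √d / n * (α i * α j) ≤
      48 * 256 * (√d * n) := by
    simp only [← Finset.mul_sum]
    rw [← Finset.sum_mul]
    calc _ ≤ 48 * √d / n * ((16 * n) * (16 * n)) := by
          gcongr
          · exact Finset.sum_nonneg fun i _ => hα0 i
          · exact hαs I
          · exact hαs J
      _ = _ := by field_simp; ring
  -- Summing over `2 ^ j < √d * √2 ^ i` leaves `(96 i + 6) (√2 / 2) ^ i`. The threshold with `√2 ^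
  -- i`, rather than `2 ^ i`, is what makes this series converge.
  have s2 : ∑ i ∈ Finset.range I, ∑ j ∈ Finset.range J, 4 * (96 * (i : ℝ) + 6) * n / 2 ^ i *
      (if (2 : ℝ) ^ j < √d * √2 ^ i then 2 ^ j else 0) ≤ 8 * levelSeries * (√d * n) := by
    simp only [← Finset.mul_sum]
    calc _ ≤ ∑ i ∈ Finset.range I, 4 * (96 * (i : ℝ) + 6) * n / 2 ^ i * (2 * (√d * √2 ^ i)) := by
          refine Finset.sum_le_sum fun i _ => ?_
          gcongr
          exact sum_two_pow_lt_le J (by positivity)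
      _ = 8 * (∑ i ∈ Finset.range I, (96 * (i : ℝ) + 6) * (√2 / 2) ^ i) * (√d * n) := by
          rw [Finset.mul_sum, Finset.sum_mul]
          refine Finset.sum_congr rfl fun i _ => ?_
          rw [div_pow]
          ring
      _ ≤ _ := by
          gcongr
          exact summable_levelSeries.sum_le_tsum _ fun i _ => by positivity
  have s3 : ∑ i ∈ Finset.range I, ∑ j ∈ Finset.range J, 240 * α j / 2 ^ j *
      (if (2 : ℝ) ^ i < 2 * 2 ^ j then 2 ^ i else 0) ≤ 240 * 64 * (√d * n) := by
    rw [Finset.sum_comm]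
    simp only [← Finset.mul_sum]
    calc _ ≤ ∑ j ∈ Finset.range J, 240 * α j / 2 ^ j * (2 * (2 * 2 ^ j)) := by
          refine Finset.sum_le_sum fun j _ => ?_
          have := hα0 j
          gcongr
          exact sum_two_pow_lt_le I (by positivity)
      _ = 960 * ∑ j ∈ Finset.range J, α j := by
          rw [Finset.mul_sum]
          refine Finset.sum_congr rfl fun i _ => ?_
          field_simp
          ring
      _ ≤ 960 * (16 * n) := by gcongr; exact hαs J
      _ ≤ _ := by nlinarith
  have s4 : ∑ i ∈ Finset.range I, ∑ j ∈ Finset.range J, 240 * (α i / 2 ^ i + n / 4 ^ i) *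
      (if (2 : ℝ) ^ j < 2 * √d * 2 ^ i then 2 ^ j else 0) ≤ 240 * (64 + 8) * (√d * n) := by
    simp only [← Finset.mul_sum]
    calc _ ≤ ∑ i ∈ Finset.range I, 240 * (α i / 2 ^ i + n / 4 ^ i) * (2 * (2 * √d * 2 ^ i)) := by
          refine Finset.sum_le_sum fun i _ => ?_
          have := hα0 i
          gcongr
          exact sum_two_pow_lt_le J (by positivity)
      _ = 960 * √d * (∑ i ∈ Finset.range I, α i + n * ∑ i ∈ Finset.range I, (1 / 2 : ℝ) ^ i) := by
          rw [Finset.mul_sum, ← Finset.sum_add_distrib, Finset.mul_sum]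
          refine Finset.sum_congr rfl fun i _ => ?_
          have h4i : (4 : ℝ) ^ i = 2 ^ i * 2 ^ i := by rw [← mul_pow]; norm_num
          rw [h4i, div_pow, one_pow]
          field_simp
          ring
      _ ≤ 960 * √d * (16 * n + n * 2) := by
          gcongr
          · exact hαs I
          · exact sum_geometric_two_le I
      _ = _ := by ring
  linarith

/-- The contribution of the heavy pairs to the quadratic form of the adjacency matrix. -/
lemma heavy_le {n : ℕ} (G : SimpleGraph (Fin n)) {d cT : ℝ} (hd : 1 < d) (hcT : 0 ≤ cT)
    (hn : 0 < n) (w : Fin n → ℕ) (hw : ∑ u, (w u : ℝ) ^ 2 ≤ 16 * n) (I : ℕ)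
    (hI : 128 * d ^ 2 ≤ 4 ^ I)
    (hdeg : ∀ u, w u ≠ 0 → (G.degree u : ℝ) ≤ cT * d)
    (hS : ∀ S : Finset (Fin n), S.Nonempty → 8 * d ^ 2 * S.card ≤ n →
      ∃ v ∈ S, ∑ u ∈ S, adjInd G v u ≤ 600)
    (hF : ∀ i < I, ∀ A B : Finset (Fin n), edgeCount G A B ≤
      3 * (d / n) * (A.card * B.card) + 3 * i * (A.card + B.card) + 6 * n / 4 ^ i)
    (hD : ∀ i < I, ∀ A B : Finset (Fin n), A.card * d * 2 ^ i ≤ 16 * n →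
      edgeCount G A B ≤ 60 * (A.card + B.card + n / 8 ^ i)) :
    ∑ u, ∑ v, (if √d < w u * w v then adjInd G u v * (w u * w v) else 0) ≤
      2 * (16 * cT + 16 * (600 + cT) +
        (48 * 256 + 8 * levelSeries + 240 * (64 + 64 + 8))) * (√d * n) := by
  have hn' : (0 : ℝ) < n := by exact_mod_cast hn
  have hd0 : 0 < d := by linarith
  have hsd : 1 ≤ √d := Real.one_le_sqrt.2 hd.le
  have hsd0 : 0 < √d := by linarith
  have hsd2 : √d * √d = d := Real.mul_self_sqrt hd0.le
  obtain ⟨J, hJ⟩ : ∃ J, ∀ u, Nat.log 2 (w u) < J :=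
    ⟨(Finset.univ.sup fun u => Nat.log 2 (w u)) + 1, fun u =>
      Nat.lt_succ_of_le (Finset.le_sup (f := fun u => Nat.log 2 (w u)) (Finset.mem_univ u))⟩
  set S : Finset (Fin n) := Finset.univ.filter fun u => 2 ^ I ≤ w u with hSdef
  -- A heavy pair with `w v ≤ w u` is dominated by one of three terms: `g1` if `w u ≥ √d * w v`,
  -- `g2` if both weights are at least `2 ^ I`, and `g3` otherwise, through the dyadic levels of the
  -- two weights.
  set g1 : Fin n → Fin n → ℝ := fun u v => adjInd G u v * ((w u : ℝ) ^ 2 / √d) with hg1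
  set g2 : Fin n → Fin n → ℝ := fun u v =>
    if u ∈ S ∧ v ∈ S then adjInd G u v * (w u * w v) else 0 with hg2
  set g3 : Fin n → Fin n → ℝ := fun u v =>
    ∑ i ∈ Finset.range I, ∑ j ∈ Finset.range J,
      (if i ≤ j ∧ (2 : ℝ) ^ j < 2 * √d * 2 ^ i ∧ √d < 4 * 2 ^ (i + j) then
        4 * 2 ^ (i + j) * (if u ∈ weightLevel w j ∧ v ∈ weightLevel w i then adjInd G u v else 0)
        else 0) with hg3
  have hg1n : ∀ u v, 0 ≤ g1 u v := fun u v => mul_nonneg (adjInd_nonneg G u v) (by positivity)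
  have hg2n : ∀ u v, 0 ≤ g2 u v := by
    intro u v
    have := adjInd_nonneg G u v
    simp only [hg2]
    split_ifs <;> positivity
  have hg3n' : ∀ u v i j, (0 : ℝ) ≤
      (if i ≤ j ∧ (2 : ℝ) ^ j < 2 * √d * 2 ^ i ∧ √d < 4 * 2 ^ (i + j) then
        4 * 2 ^ (i + j) * (if u ∈ weightLevel w j ∧ v ∈ weightLevel w i then adjInd G u v else 0)
        else 0) := by
    intro u v i j
    have := adjInd_nonneg G u v
    split_ifs <;> positivity
  have hg3n : ∀ u v, 0 ≤ g3 u v := fun u v =>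
    Finset.sum_nonneg fun i _ => Finset.sum_nonneg fun j _ => hg3n' u v i j
  have hpt : ∀ u v, w v ≤ w u → √d < w u * w v →
      adjInd G u v * (w u * w v) ≤ g1 u v + g2 u v + g3 u v := by
    intro u v hvu hh
    have ha := adjInd_nonneg G u v
    by_cases h1 : √d * w v ≤ w u
    · have : adjInd G u v * (w u * w v) ≤ g1 u v := by
        refine mul_le_mul_of_nonneg_left ?_ ha
        rw [le_div_iff₀ hsd0]
        nlinarith [(Nat.cast_nonneg (w u) : (0 : ℝ) ≤ w u)]
      linarith [hg2n u v, hg3n u v]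
    by_cases h2 : 2 ^ I ≤ w v
    · have : adjInd G u v * (w u * w v) ≤ g2 u v := by
        simp only [hg2]
        rw [if_pos]
        simp [hSdef, h2, h2.trans hvu]
      linarith [hg1n u v, hg3n u v]
    have hv0 : w v ≠ 0 := by
      rintro h
      rw [h] at hh
      simp at hh
      linarith
    have hu0 : w u ≠ 0 := by omega
    have hv := two_pow_le_of_mem_weightLevel w ((mem_weightLevel w).2 ⟨hv0, rfl⟩)
    have hu := two_pow_le_of_mem_weightLevel w ((mem_weightLevel w).2 ⟨hu0, rfl⟩)
    set i := Nat.log 2 (w v) with hi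
    set j := Nat.log 2 (w u) with hj
    have hadm : i ≤ j ∧ (2 : ℝ) ^ j < 2 * √d * 2 ^ i ∧ √d < 4 * 2 ^ (i + j) := by
      refine ⟨Nat.log_mono_right hvu, ?_, ?_⟩
      · push Not at h1
        nlinarith [hv.2]
      · refine hh.trans_le ?_
        rw [pow_add]
        calc (w u : ℝ) * w v ≤ (2 * 2 ^ j) * (2 * 2 ^ i) := by
              gcongr
              · exact hu.2.le
              · exact hv.2.le
          _ = _ := by ring
    have hiI : i < I := by
      rw [hi]
      exact Nat.log_lt_of_lt_pow hv0 (not_le.1 h2)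
    have : adjInd G u v * (w u * w v) ≤ g3 u v := by
      simp only [hg3]
      refine le_trans ?_ (Finset.single_le_sum
        (fun i _ => Finset.sum_nonneg fun j _ => hg3n' u v i j) (Finset.mem_range.2 hiI))
      refine le_trans ?_ (Finset.single_le_sum
        (fun j _ => hg3n' u v i j) (Finset.mem_range.2 (hJ u)))
      rw [if_pos hadm, if_pos ⟨(mem_weightLevel w).2 ⟨hu0, rfl⟩, (mem_weightLevel w).2 ⟨hv0, rfl⟩⟩,
        mul_comm]
      refine mul_le_mul_of_nonneg_right ?_ ha
      rw [pow_add]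
      calc (w u : ℝ) * w v ≤ (2 * 2 ^ j) * (2 * 2 ^ i) := by
            gcongr
            · exact hu.2.le
            · exact hv.2.le
        _ = _ := by ring
    linarith [hg1n u v, hg2n u v]
  have hdegw : ∀ u, (w u : ℝ) ^ 2 * G.degree u ≤ (w u : ℝ) ^ 2 * (cT * d) := by
    intro u
    by_cases h : w u = 0
    · simp [h]
    · exact mul_le_mul_of_nonneg_left (hdeg u h) (by positivity)
  have s1 : ∑ u, ∑ v, g1 u v ≤ 16 * cT * (√d * n) := by
    calc ∑ u, ∑ v, g1 u v = ∑ u, ((w u : ℝ) ^ 2 * G.degree u) / √d := by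
          refine Finset.sum_congr rfl fun u _ => ?_
          simp only [hg1]
          rw [← Finset.sum_mul, sum_adjInd]
          ring
      _ ≤ ∑ u, ((w u : ℝ) ^ 2 * (cT * d)) / √d := by
          refine Finset.sum_le_sum fun u _ => ?_
          exact div_le_div_of_nonneg_right (hdegw u) hsd0.le
      _ = (∑ u, (w u : ℝ) ^ 2) * (cT * √d) := by
          rw [Finset.sum_mul]
          refine Finset.sum_congr rfl fun u _ => ?_
          rw [div_eq_iff hsd0.ne', mul_assoc, mul_assoc, hsd2]
      _ ≤ 16 * n * (cT * √d) := by gcongr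
      _ = _ := by ring
  -- Chebyshev: `4 ^ I * |S'| ≤ 16 n`, and `4 ^ I ≥ 128 d ^ 2` was chosen for this.
  have hScard : ∀ S' ⊆ S, 8 * d ^ 2 * (S'.card : ℝ) ≤ n := by
    intro S' hS'
    have h1 : (4 : ℝ) ^ I * S'.card ≤ 16 * n := by
      refine le_trans ?_ hw
      calc (4 : ℝ) ^ I * S'.card = ∑ _u ∈ S', (4 : ℝ) ^ I := by simp [mul_comm]
        _ ≤ ∑ u ∈ S', (w u : ℝ) ^ 2 := by
            refine Finset.sum_le_sum fun u hu => ?_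
            have h2 : 2 ^ I ≤ w u := by simpa [hSdef] using hS' hu
            have h3 : (2 : ℝ) ^ I ≤ w u := by exact_mod_cast h2
            calc (4 : ℝ) ^ I = (2 ^ I) ^ 2 := by rw [← pow_mul, mul_comm, pow_mul]; norm_num
              _ ≤ _ := by gcongr
        _ ≤ _ := Finset.sum_le_sum_of_subset_of_nonneg (Finset.subset_univ _)
            fun _ _ _ => sq_nonneg _
    have h2 : 128 * d ^ 2 * (S'.card : ℝ) ≤ 4 ^ I * S'.card := by gcongr
    linarith
  have s2 : ∑ u, ∑ v, g2 u v ≤ 16 * (600 + cT) * (√d * n) := by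
    have e : ∑ u, ∑ v, g2 u v = ∑ u ∈ S, ∑ v ∈ S, adjInd G u v * ((w u : ℝ) * w v) := by
      simp only [hg2, ite_and]
      rw [← Finset.sum_filter_add_sum_filter_not Finset.univ (fun u => u ∈ S)]
      rw [Finset.filter_mem_eq_inter, Finset.univ_inter,
        Finset.sum_eq_zero (s := Finset.univ.filter fun u => u ∉ S), add_zero]
      · refine Finset.sum_congr rfl fun u hu => ?_
        simp only [hu, if_true]
        rw [← Finset.sum_filter, Finset.filter_mem_eq_inter, Finset.univ_inter]
      · intro u hu
        simp [(Finset.mem_filter.1 hu).2]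
    rw [e]
    refine (quadForm_le_of_degenerate G 600 (1 / √d) (by positivity) (fun u => (w u : ℝ)) S
      fun S' hS' hne => hS S' hne (hScard S' hS')).trans ?_
    calc _ ≤ ∑ u, (w u : ℝ) ^ 2 * ((600 + cT) * √d) := by
          refine (Finset.sum_le_sum fun u _ => ?_).trans
            (Finset.sum_le_sum_of_subset_of_nonneg (Finset.subset_univ S)
              fun u _ _ => by positivity)
          have h1 : ∑ v ∈ S, adjInd G u v ≤ G.degree u := by
            rw [← sum_adjInd]
            exact Finset.sum_le_sum_of_subset_of_nonneg (Finset.subset_univ _)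
              fun v _ _ => adjInd_nonneg G u v
          have h2 := hdegw u
          have h3 : (w u : ℝ) ^ 2 * (1 / √d * ∑ v ∈ S, adjInd G u v) ≤
              (w u : ℝ) ^ 2 * (cT * √d) := by
            calc (w u : ℝ) ^ 2 * (1 / √d * ∑ v ∈ S, adjInd G u v)
                ≤ (w u : ℝ) ^ 2 * (1 / √d * G.degree u) := by gcongr
              _ = ((w u : ℝ) ^ 2 * G.degree u) / √d := by ring
              _ ≤ ((w u : ℝ) ^ 2 * (cT * d)) / √d := div_le_div_of_nonneg_right h2 hsd0.le
              _ = _ := by rw [div_eq_iff hsd0.ne', mul_assoc, mul_assoc, hsd2]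
          rw [mul_add, div_div_eq_mul_div, div_one]
          linarith
      _ = (∑ u, (w u : ℝ) ^ 2) * ((600 + cT) * √d) := by rw [Finset.sum_mul]
      _ ≤ 16 * n * ((600 + cT) * √d) := by gcongr
      _ = _ := by ring
  have s3 : ∑ u, ∑ v, g3 u v ≤
      (48 * 256 + 8 * levelSeries + 240 * (64 + 64 + 8)) * (√d * n) := by
    refine le_trans (le_of_eq ?_) (sum_levelPair_le G hd hn w hw I J hF hD)
    simp only [hg3]
    rw [Finset.sum_congr rfl fun u _ => Finset.sum_comm, Finset.sum_comm]
    refine Finset.sum_congr rfl fun i _ => ?_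
    rw [Finset.sum_congr rfl fun u _ => Finset.sum_comm, Finset.sum_comm]
    refine Finset.sum_congr rfl fun j _ => ?_
    split_ifs with h
    · simp only [← Finset.mul_sum, edgeCount, ite_and]
      congr 1
      rw [← Finset.sum_filter_add_sum_filter_not Finset.univ (fun u => u ∈ weightLevel w j)]
      rw [Finset.filter_mem_eq_inter, Finset.univ_inter,
        Finset.sum_eq_zero (s := Finset.univ.filter fun u => u ∉ weightLevel w j), add_zero]
      · refine Finset.sum_congr rfl fun u hu => ?_
        simp only [hu, if_true]
        rw [← Finset.sum_filter, Finset.filter_mem_eq_inter, Finset.univ_inter]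
      · intro u hu
        simp [(Finset.mem_filter.1 hu).2]
    · simp
  -- The majorants were built for `w v ≤ w u`; symmetrizing them covers both orders and produces the
  -- factor `2`.
  have hsym : ∑ u, ∑ v, (if √d < w u * w v then adjInd G u v * ((w u : ℝ) * w v) else 0) ≤
      ∑ u, ∑ v, ((g1 u v + g2 u v + g3 u v) + (g1 v u + g2 v u + g3 v u)) := by
    refine Finset.sum_le_sum fun u _ => Finset.sum_le_sum fun v _ => ?_
    have k1 : 0 ≤ g1 u v + g2 u v + g3 u v := by linarith [hg1n u v, hg2n u v, hg3n u v]
    have k2 : 0 ≤ g1 v u + g2 v u + g3 v u := by linarith [hg1n v u, hg2n v u, hg3n v u]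
    split_ifs with hh
    · rcases le_total (w v) (w u) with h | h
      · linarith [hpt u v h hh]
      · have := hpt v u h (by rwa [mul_comm])
        rw [adjInd_comm, mul_comm (w v : ℝ)] at this
        linarith
    · linarith
  refine hsym.trans ?_
  have e : ∑ u, ∑ v, ((g1 u v + g2 u v + g3 u v) + (g1 v u + g2 v u + g3 v u)) =
      2 * (∑ u, ∑ v, g1 u v + ∑ u, ∑ v, g2 u v + ∑ u, ∑ v, g3 u v) := by
    simp only [Finset.sum_add_distrib]
    rw [Finset.sum_comm (f := fun u v => g1 v u), Finset.sum_comm (f := fun u v => g2 v u),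
      Finset.sum_comm (f := fun u v => g3 v u)]
    ring
  rw [e]
  linarith

/-! ### The spectral norm of the pruned matrix -/

/-- The constant in the bound for the quadratic form. -/
noncomputable def quadConst (cT : ℝ) : ℝ :=
  656 + 2 * (16 * cT + 16 * (600 + cT) +
    (48 * 256 + 8 * levelSeries + 240 * (64 + 64 + 8)))

lemma quadConst_pos {cT : ℝ} (hcT : 0 ≤ cT) : 0 < quadConst cT := by
  have := levelSeries_nonneg
  unfold quadConst
  positivity

lemma edgeProb_eq {n : ℕ} {d : ℝ} (hd : 0 ≤ d) (hn : d ≤ n) (hn0 : 0 < n) :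
    (edgeProb n d : ℝ) = d / n := by
  have hn' : (0 : ℝ) < n := by exact_mod_cast hn0
  rw [edgeProb, Set.coe_projIcc]
  rw [min_eq_right, max_eq_right]
  · positivity
  · rw [div_le_one hn']; exact hn

/-- The biased character is the standardized edge indicator, so the matrix is a rescaled, pruned,
centred adjacency matrix. -/
lemma chi_eq {n : ℕ} {p : ℝ} (hp0 : 0 < p) (hp1 : p < 1) (G : SimpleGraph (Fin n)) (u v : Fin n) :
    chi p G u v = (adjInd G u v - p) / √(p * (1 - p)) := by
  have h1 : 0 < 1 - p := by linarith
  have s1 : √p ≠ 0 := (Real.sqrt_pos.2 hp0).ne'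
  have s2 : √(1 - p) ≠ 0 := (Real.sqrt_pos.2 h1).ne'
  rw [chi, adjInd, Real.sqrt_mul hp0.le]
  split_ifs
  · rw [Real.sqrt_div h1.le, div_eq_div_iff s1 (mul_ne_zero s1 s2)]
    have := Real.mul_self_sqrt h1.le
    linear_combination √p * this
  · rw [Real.sqrt_div hp0.le, zero_sub, neg_div, neg_inj, div_eq_div_iff s2 (mul_ne_zero s1 s2)]
    have := Real.mul_self_sqrt hp0.le
    linear_combination √(1 - p) * this

/-- The light part of the centred quadratic form. -/
noncomputable def lightForm {n : ℕ} (d : ℝ) (G : SimpleGraph (Fin n)) (z : Fin n → ℤ) : ℝ :=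
  ∑ u, ∑ v, if u ≠ v ∧ |(z u : ℝ) * z v| ≤ √d then
    (adjInd G u v - d / n) * ((z u : ℝ) * z v) else 0

lemma prunedMatrix_isSymm (n : ℕ) (cT d : ℝ) (G : SimpleGraph (Fin n)) :
    (prunedMatrix n cT d G).IsSymm := by
  ext u v
  simp only [Matrix.transpose_apply, prunedMatrix, Matrix.of_apply, chi, G.adj_comm v u]
  congr 1
  rw [eq_iff_iff]
  constructor
  · rintro ⟨a, b, c⟩; exact ⟨a.symm, c, b⟩
  · rintro ⟨a, b, c⟩; exact ⟨a.symm, c, b⟩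

/-- Centring matters only for light pairs. On heavy pairs `|z u * z v| ≤ (z u * z v) ^ 2 / √d`, so
the mean part contributes at most `(d / n) (16 n) ^ 2 / √d = 256 √d n`; with the light `400` this
makes `656`. -/
lemma abs_quadForm_le {n : ℕ} (G : SimpleGraph (Fin n)) {d H : ℝ} (hd : 1 < d)
    (hn : 0 < n) (z : Fin n → ℤ) (hz : ∑ u, (z u : ℝ) ^ 2 ≤ 16 * n)
    (hlight : |lightForm d G z| ≤ 400 * (√d * n))
    (hheavy : ∑ u, ∑ v, (if √d < ((z u).natAbs : ℝ) * (z v).natAbs then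
      adjInd G u v * (((z u).natAbs : ℝ) * (z v).natAbs) else 0) ≤ H * (√d * n)) :
    |∑ u, ∑ v, if u ≠ v then (adjInd G u v - d / n) * ((z u : ℝ) * z v) else 0| ≤
      (656 + H) * (√d * n) := by
  have hn' : (0 : ℝ) < n := by exact_mod_cast hn
  have hd0 : 0 < d := by linarith
  have hsd0 : 0 < √d := Real.sqrt_pos.2 hd0
  have hsd2 : √d * √d = d := Real.mul_self_sqrt hd0.le
  have habs : ∀ u v, ((z u).natAbs : ℝ) * (z v).natAbs = |(z u : ℝ) * z v| := by
    intro u v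
    rw [abs_mul, Nat.cast_natAbs, Nat.cast_natAbs]
    push_cast
    rfl
  simp only [habs] at hheavy
  have e : ∑ u, ∑ v, (if u ≠ v then (adjInd G u v - d / n) * ((z u : ℝ) * z v) else 0) =
      lightForm d G z + ∑ u, ∑ v, (if u ≠ v ∧ √d < |(z u : ℝ) * z v| then
        (adjInd G u v - d / n) * ((z u : ℝ) * z v) else 0) := by
    rw [lightForm, ← Finset.sum_add_distrib]
    refine Finset.sum_congr rfl fun u _ => ?_
    rw [← Finset.sum_add_distrib]
    refine Finset.sum_congr rfl fun v _ => ?_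
    by_cases h : u = v
    · simp [h]
    · by_cases h' : |(z u : ℝ) * z v| ≤ √d
      · rw [if_pos h, if_pos ⟨h, h'⟩, if_neg fun hc => hc.2.not_ge h', add_zero]
      · rw [if_pos h, if_neg fun hc => h' hc.2, if_pos ⟨h, not_le.1 h'⟩, zero_add]
  have hrest : |∑ u, ∑ v, (if u ≠ v ∧ √d < |(z u : ℝ) * z v| then
        (adjInd G u v - d / n) * ((z u : ℝ) * z v) else 0)| ≤
      H * (√d * n) + 256 * (√d * n) := by
    calc _ ≤ ∑ u, ∑ v, ((if √d < |(z u : ℝ) * z v| then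
          adjInd G u v * |(z u : ℝ) * z v| else 0) +
            d / n * ((z u : ℝ) ^ 2 * (z v : ℝ) ^ 2 / √d)) := by
          refine (Finset.abs_sum_le_sum_abs _ _).trans (Finset.sum_le_sum fun u _ => ?_)
          refine (Finset.abs_sum_le_sum_abs _ _).trans (Finset.sum_le_sum fun v _ => ?_)
          have ha := adjInd_nonneg G u v
          by_cases h : u ≠ v ∧ √d < |(z u : ℝ) * z v|
          · rw [if_pos h, if_pos h.2, abs_mul]
            have h1 : |adjInd G u v - d / n| ≤ adjInd G u v + d / n := by
              rw [abs_le]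
              have : 0 ≤ d / n := by positivity
              constructor <;> linarith
            have h2 : |(z u : ℝ) * z v| ≤ (z u : ℝ) ^ 2 * (z v : ℝ) ^ 2 / √d := by
              rw [le_div_iff₀ hsd0, ← mul_pow, ← sq_abs ((z u : ℝ) * z v), sq]
              exact mul_le_mul_of_nonneg_left h.2.le (abs_nonneg _)
            calc _ ≤ (adjInd G u v + d / n) * |(z u : ℝ) * z v| := by gcongr
              _ = adjInd G u v * |(z u : ℝ) * z v| + d / n * |(z u : ℝ) * z v| := by ring
              _ ≤ _ := by gcongr
          · rw [if_neg h, abs_zero]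
            refine add_nonneg ?_ (by positivity)
            split_ifs <;> positivity
      _ = ∑ u, ∑ v, (if √d < |(z u : ℝ) * z v| then adjInd G u v * |(z u : ℝ) * z v| else 0) +
          d / n / √d * ((∑ u, (z u : ℝ) ^ 2) * ∑ v, (z v : ℝ) ^ 2) := by
          rw [Finset.sum_mul_sum, Finset.mul_sum, ← Finset.sum_add_distrib]
          refine Finset.sum_congr rfl fun u _ => ?_
          rw [Finset.mul_sum, ← Finset.sum_add_distrib]
          refine Finset.sum_congr rfl fun v _ => ?_
          ring
      _ ≤ H * (√d * n) + d / n / √d * ((16 * n) * (16 * n)) := by gcongr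
      _ = _ := by
          congr 1
          field_simp
          linear_combination (-256) * hsd2
  rw [e]
  calc _ ≤ _ := abs_add_le _ _
    _ ≤ 400 * (√d * n) + (H * (√d * n) + 256 * (√d * n)) := add_le_add hlight hrest
    _ = _ := by ring

lemma specNorm_prunedMatrix_le {n : ℕ} (G : SimpleGraph (Fin n)) {d cT : ℝ} (hd : 1 < d)
    (hcT : 0 ≤ cT) (hn : 2 * d ≤ n) (I : ℕ) (hI : 128 * d ^ 2 ≤ 4 ^ I)
    (hlight : ∀ z : Fin n → ℤ, ∑ u, (z u : ℝ) ^ 2 ≤ 16 * n →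
      |lightForm d G z| ≤ 400 * (√d * n))
    (hS : ∀ S : Finset (Fin n), S.Nonempty → 8 * d ^ 2 * S.card ≤ n →
      ∃ v ∈ S, ∑ u ∈ S, adjInd G v u ≤ 600)
    (hF : ∀ i < I, ∀ A B : Finset (Fin n), edgeCount G A B ≤
      3 * (d / n) * (A.card * B.card) + 3 * i * (A.card + B.card) + 6 * n / 4 ^ i)
    (hD : ∀ i < I, ∀ A B : Finset (Fin n), A.card * d * 2 ^ i ≤ 16 * n →
      edgeCount G A B ≤ 60 * (A.card + B.card + n / 8 ^ i)) :
    specNorm (prunedMatrix n cT d G) ≤ quadConst cT * √n := by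
  have hd0 : 0 < d := by linarith
  have hn' : (0 : ℝ) < n := by linarith
  have hn0 : 0 < n := by exact_mod_cast hn'
  have hsn : 0 < √(n : ℝ) := Real.sqrt_pos.2 hn'
  set p : ℝ := d / n with hp
  have hpe : (edgeProb n d : ℝ) = p := edgeProb_eq hd0.le (by linarith) hn0
  have hp0 : 0 < p := by positivity
  have hp2 : p ≤ 1 / 2 := by rw [hp, div_le_iff₀ hn']; linarith
  have hK := quadConst_pos hcT
  -- From `p ≤ 1 / 2`: standardizing costs at most a factor `2` compared with dividing by `√p`.
  have hsp : √d / √n ≤ 2 * √(p * (1 - p)) := by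
    rw [← Real.sqrt_div hd0.le, ← hp]
    have : √p ≤ √(4 * (p * (1 - p))) := Real.sqrt_le_sqrt (by nlinarith)
    rw [Real.sqrt_mul (by norm_num)] at this
    have h4 : √(4 : ℝ) = 2 := by
      rw [show (4 : ℝ) = 2 ^ 2 by norm_num, Real.sqrt_sq (by norm_num)]
    rwa [h4] at this
  have hspp : 0 < √(p * (1 - p)) := Real.sqrt_pos.2 (mul_pos hp0 (by linarith))
  have hmain := specNorm_le_of_lattice (prunedMatrix n cT d G) (prunedMatrix_isSymm n cT d G)
    (β := quadConst cT * √n / 8) (by positivity) (by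
    intro z hz
    -- Pruning is moved from the matrix to the test vector. The light bound is uniform in the
    -- vector, so the dependence of `z'` on `G` is harmless.
    set z' : Fin n → ℤ := fun u => if (G.degree u : ℝ) ≤ cT * d then z u else 0 with hz'
    have hzz : ∑ u, (z' u : ℝ) ^ 2 ≤ 16 * n := by
      refine le_trans (Finset.sum_le_sum fun u _ => ?_) hz
      simp only [hz']
      split_ifs
      · exact le_rfl
      · simpa using sq_nonneg (z u : ℝ)
    have hw : ∑ u, (((z' u).natAbs : ℕ) : ℝ) ^ 2 ≤ 16 * n := by
      refine le_trans (le_of_eq (Finset.sum_congr rfl fun u _ => ?_)) hzz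
      rw [Nat.cast_natAbs, Int.cast_abs, sq_abs]
    have hheavy := heavy_le G hd hcT hn0 (fun u => (z' u).natAbs) hw I hI
      (by
        intro u hu
        by_contra hcon
        exact hu (by simp [hz', hcon])) hS hF hD
    have h := abs_quadForm_le G hd hn0 z' hzz (hlight z' hzz) hheavy
    have e : ∑ u, ∑ v, prunedMatrix n cT d G u v * z u * z v =
        (∑ u, ∑ v, if u ≠ v then (adjInd G u v - d / n) * ((z' u : ℝ) * z' v) else 0) /
          √(p * (1 - p)) := by
      rw [Finset.sum_div]
      refine Finset.sum_congr rfl fun u _ => ?_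
      rw [Finset.sum_div]
      refine Finset.sum_congr rfl fun v _ => ?_
      rw [prunedMatrix, Matrix.of_apply, hpe, chi_eq hp0 (by linarith), ← hp]
      by_cases h0 : u = v
      · simp [h0]
      · by_cases h1 : (G.degree u : ℝ) ≤ cT * d <;> by_cases h2 : (G.degree v : ℝ) ≤ cT * d <;>
          simp [h0, h1, h2, hz']
        ring
    rw [e, abs_div, abs_of_pos hspp, div_le_iff₀ hspp]
    refine h.trans ?_
    change quadConst cT * (√d * n) ≤ _
    have h3 : √d ≤ √n * (2 * √(p * (1 - p))) := by
      rw [mul_comm]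
      exact (div_le_iff₀ hsn).1 hsp
    calc quadConst cT * (√d * n) ≤ quadConst cT * ((√n * (2 * √(p * (1 - p)))) * n) := by gcongr
      _ = _ := by ring)
  refine hmain.trans ?_
  have : 0 ≤ quadConst cT * √n := by positivity
  linarith

/-- Sets of sublinear size are degenerate if small sets are and if the discrepancy bounds hold. -/
lemma exists_low_degree {n : ℕ} (G : SimpleGraph (Fin n)) {d m : ℝ} (hd : 1 < d)
    (hsmall : ∀ S : Finset (Fin n), S.Nonempty → (S.card : ℝ) < m →
      ∃ v ∈ S, ∑ u ∈ S, adjInd G v u ≤ 3)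
    (hD : ∀ i : ℕ, 8 ^ i * m ≤ n → ∀ A B : Finset (Fin n), A.card * d * 2 ^ i ≤ 16 * n →
      edgeCount G A B ≤ 60 * (A.card + B.card + n / 8 ^ i))
    (S : Finset (Fin n)) (hS : S.Nonempty) (hcard : 8 * d ^ 2 * S.card ≤ n) :
    ∃ v ∈ S, ∑ u ∈ S, adjInd G v u ≤ 600 := by
  rcases lt_or_ge (S.card : ℝ) m with h | h
  · obtain ⟨v, hv, h3⟩ := hsmall S hS h
    exact ⟨v, hv, h3.trans (by norm_num)⟩
  have hs0 : 0 < S.card := hS.card_pos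
  have hs : (0 : ℝ) < S.card := by exact_mod_cast hs0
  -- With this scale `n / 8 ^ i < 8 |S|`, so discrepancy for `A = B = S` gives at most `60 (1 + 1 +
  -- 8) |S| = 600 |S|` ordered edges, that is, average degree at most `600`.
  set i := Nat.log 8 (n / S.card) with hi
  have hle : S.card ≤ n := by
    have := Finset.card_le_univ S
    simpa using this
  have hq : n / S.card ≠ 0 := (Nat.div_pos hle hs0).ne'
  have h1 : (8 : ℝ) ^ i * S.card ≤ n := by
    have h1 : 8 ^ i ≤ n / S.card := Nat.pow_log_le_self 8 hq
    have h2 : 8 ^ i * S.card ≤ n := (Nat.le_div_iff_mul_le hs0).1 h1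
    exact_mod_cast h2
  have h2 : (n : ℝ) < 8 * 8 ^ i * S.card := by
    have h1 : n / S.card < 8 ^ (i + 1) := Nat.lt_pow_succ_log_self (by norm_num) _
    have h2 : n < 8 ^ (i + 1) * S.card := (Nat.div_lt_iff_lt_mul hs0).1 h1
    rw [pow_succ, mul_comm (8 ^ i)] at h2
    exact_mod_cast h2
  have h8 : (0 : ℝ) < 8 ^ i := by positivity
  have hd8 : d ^ 2 ≤ 8 ^ i := by
    by_contra hcon
    push Not at hcon
    have : 8 * 8 ^ i * (S.card : ℝ) ≤ 8 * d ^ 2 * S.card := by gcongr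
    linarith
  -- Since `d ^ 2 ≤ 8 ^ i ≤ 16 ^ i`. Then `|S| * d * 2 ^ i ≤ |S| * 8 ^ i ≤ n`, which is the size
  -- condition of the discrepancy bound.
  have hd4 : d ≤ 4 ^ i := by
    have : d ^ 2 ≤ (4 ^ i) ^ 2 := by
      refine hd8.trans ?_
      rw [← pow_mul, mul_comm i 2, pow_mul]
      gcongr
      norm_num
    exact (sq_le_sq₀ (by linarith) (by positivity)).1 this
  have hsize : S.card * d * 2 ^ i ≤ 16 * (n : ℝ) := by
    have e8 : (8 : ℝ) ^ i = 4 ^ i * 2 ^ i := by rw [← mul_pow]; norm_num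
    calc S.card * d * 2 ^ i ≤ S.card * 4 ^ i * 2 ^ i := by gcongr
      _ = 8 ^ i * S.card := by rw [e8]; ring
      _ ≤ n := h1
      _ ≤ 16 * n := by linarith [(Nat.cast_nonneg n : (0 : ℝ) ≤ n)]
  have h3 := hD i (le_trans (mul_le_mul_of_nonneg_left h h8.le) h1) S S hsize
  have h4 : (n : ℝ) / 8 ^ i ≤ 8 * S.card := by
    rw [div_le_iff₀ h8]
    linarith
  refine Finset.exists_le_of_sum_le hS (f := fun v => ∑ u ∈ S, adjInd G v u) (g := fun _ => 600) ?_
  rw [Finset.sum_const, nsmul_eq_mul]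
  change edgeCount G S S ≤ _
  linarith

/-! ### Tail bounds -/

lemma edgeCount_eq_sum {n : ℕ} (G : SimpleGraph (Fin n)) (A B : Finset (Fin n)) :
    edgeCount G A B = ∑ u, ∑ v, (if u ∈ A ∧ v ∈ B then adjInd G u v else 0) := by
  simp only [edgeCount, ite_and]
  rw [← Finset.sum_filter_add_sum_filter_not Finset.univ (fun u => u ∈ A)]
  rw [Finset.filter_mem_eq_inter, Finset.univ_inter,
    Finset.sum_eq_zero (s := Finset.univ.filter fun u => u ∉ A), add_zero]
  · refine Finset.sum_congr rfl fun u hu => ?_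
    simp only [hu, if_true]
    rw [← Finset.sum_filter, Finset.filter_mem_eq_inter, Finset.univ_inter]
  · intro u hu
    simp [(Finset.mem_filter.1 hu).2]

lemma edgeCount_mono {n : ℕ} {G H : SimpleGraph (Fin n)} (h : G ≤ H) (A B : Finset (Fin n)) :
    edgeCount G A B ≤ edgeCount H A B := by
  refine Finset.sum_le_sum fun u _ => Finset.sum_le_sum fun v _ => ?_
  unfold adjInd
  split_ifs with h1 h2
  · exact le_rfl
  · exact absurd (h h1) h2
  · norm_num
  · exact le_rfl

lemma edgeCount_tail {n : ℕ} (p : unitInterval) (A B : Finset (Fin n)) {θ : ℝ} (hθ : 0 ≤ θ)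
    (m : ℝ) :
    (SimpleGraph.binomialRandom (Fin n) p).real {G | m < edgeCount G A B} ≤
      Real.exp (-(θ * m) + (p : ℝ) / 2 * (A.card * B.card * Real.exp (2 * θ))) := by
  have h := chernoff p (fun u v => if u ∈ A ∧ v ∈ B then θ else 0) (θ * m)
  refine le_trans (measureReal_mono ?_) (h.trans (Real.exp_le_exp.2 ?_))
  · intro G hG
    simp only [Set.mem_ofPred_eq] at hG ⊢
    have e : ∑ u, ∑ v, (if u ∈ A ∧ v ∈ B then θ else 0) * adjInd G u v = θ * edgeCount G A B := by
      rw [edgeCount_eq_sum, Finset.mul_sum]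
      refine Finset.sum_congr rfl fun u _ => ?_
      rw [Finset.mul_sum]
      refine Finset.sum_congr rfl fun v _ => ?_
      split_ifs <;> simp
    rw [e]
    gcongr
  · have hp := p.2.1
    gcongr
    calc _ ≤ ∑ u, ∑ v, (if u ∈ A ∧ v ∈ B then Real.exp (2 * θ) else 0) := by
          refine Finset.sum_le_sum fun u _ => Finset.sum_le_sum fun v _ => ?_
          have := Real.exp_pos (2 * θ)
          by_cases h : u ∈ A ∧ v ∈ B
          · simp only [h, and_self, if_true]
            split_ifs <;> linarith
          · simp [h]
      _ = _ := by
          simp only [ite_and, Finset.sum_ite_irrel, Finset.sum_const_zero, Finset.sum_ite_mem,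
            Finset.univ_inter, Finset.sum_const, nsmul_eq_mul]
          ring

/-- The sum is `(1 + τ) ^ n`. In the union bound, tails proportional to `τ ^ |A|` reduce the entropy
of a choice of `A` to `τ n`. -/
lemma sum_pow_card_le {n : ℕ} {τ : ℝ} (hτ : 0 ≤ τ) :
    ∑ A : Finset (Fin n), τ ^ A.card ≤ Real.exp (τ * n) := by
  have h := Finset.prod_one_add (f := fun _ : Fin n => τ) (Finset.univ : Finset (Fin n))
  simp only [Finset.prod_const, Finset.card_univ, Fintype.card_fin, Finset.powerset_univ] at h
  rw [← h, mul_comm, Real.exp_nat_mul]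
  gcongr
  linarith [Real.add_one_le_exp τ]

/-- The union bound over all pairs of vertex sets. -/
lemma edgeCount_union_bound {n : ℕ} (p : unitInterval) (Q : Finset (Fin n) → Prop)
    (m : Finset (Fin n) → Finset (Fin n) → ℝ) {τ x : ℝ} (hτ : 0 ≤ τ) (hx : 0 ≤ x)
    (h : ∀ A B, Q A → (SimpleGraph.binomialRandom (Fin n) p).real {G | m A B < edgeCount G A B} ≤
      τ ^ A.card * τ ^ B.card * x) :
    (SimpleGraph.binomialRandom (Fin n) p).real
      {G | ∀ A B, Q A → edgeCount G A B ≤ m A B}ᶜ ≤ Real.exp (2 * (τ * n)) * x := by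
  calc _ ≤ (SimpleGraph.binomialRandom (Fin n) p).real
          (⋃ A ∈ (Finset.univ : Finset (Finset (Fin n))),
            ⋃ B ∈ (Finset.univ : Finset (Finset (Fin n))),
              {G | Q A ∧ m A B < edgeCount G A B}) := by
        refine measureReal_mono ?_ (measure_ne_top _ _)
        intro G hG
        simp only [Set.mem_compl_iff, Set.mem_ofPred_eq, not_forall, not_le] at hG
        obtain ⟨A, B, hQ, hm⟩ := hG
        simp only [Finset.mem_univ, Set.iUnion_true, Set.mem_iUnion, Set.mem_ofPred_eq]
        exact ⟨A, B, hQ, hm⟩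
    _ ≤ ∑ A, ∑ B, (SimpleGraph.binomialRandom (Fin n) p).real
          {G | Q A ∧ m A B < edgeCount G A B} :=
        (measureReal_biUnion_finset_le _ _).trans
          (Finset.sum_le_sum fun A _ => measureReal_biUnion_finset_le _ _)
    _ ≤ ∑ A : Finset (Fin n), ∑ B : Finset (Fin n), τ ^ A.card * τ ^ B.card * x := by
        refine Finset.sum_le_sum fun A _ => Finset.sum_le_sum fun B _ => ?_
        by_cases hQ : Q A
        · simpa [hQ] using h A B hQ
        · simp only [hQ, false_and]
          have : {G : SimpleGraph (Fin n) | False} = ∅ := by ext; simp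
          rw [this, measureReal_empty]
          positivity
    _ = (∑ A : Finset (Fin n), τ ^ A.card) * (∑ A : Finset (Fin n), τ ^ A.card) * x := by
        rw [Finset.sum_mul_sum, Finset.sum_mul]
        simp only [Finset.sum_mul]
    _ ≤ Real.exp (τ * n) * Real.exp (τ * n) * x := by
        gcongr <;> exact sum_pow_card_le hτ
    _ = _ := by rw [← Real.exp_add, two_mul]

lemma log_two_bounds : (0.69 : ℝ) < Real.log 2 ∧ Real.log 2 < 0.7 :=
  ⟨by linarith [Real.log_two_gt_d9], by linarith [Real.log_two_lt_d9]⟩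

lemma exp_neg_mul_log_two (j : ℕ) : Real.exp (-(j * Real.log 2)) = (1 / 2 : ℝ) ^ j := by
  rw [Real.exp_neg, Real.exp_nat_mul, Real.exp_log (by norm_num), one_div, inv_pow]

/-- The tilt `θ` satisfies `exp(2θ) = 2 ^ (i + 2)`, as large as the size condition on `A` allows:
the mean term stays below `32 |B|`, while the gain grows like `i (|A| + |B|)` and pays for the
entropy weight `τ = 8 ^ (-i)`. The total entropy `2 n / 8 ^ i` is covered by `x = exp(-3 n / 8 ^
i)`. -/
lemma discrepancy_top_tail {n : ℕ} {d : ℝ} (p : unitInterval) (hn : 0 < n)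
    (hp : (p : ℝ) = d / n) (i : ℕ) :
    (SimpleGraph.binomialRandom (Fin n) p).real
      {G | ∀ A B : Finset (Fin n), A.card * d * 2 ^ i ≤ 16 * n →
        edgeCount G A B ≤ 60 * (A.card + B.card + n / 8 ^ i)}ᶜ ≤ Real.exp (-(n / 8 ^ i)) := by
  have hn' : (0 : ℝ) < n := by exact_mod_cast hn
  obtain ⟨hl1, hl2⟩ := log_two_bounds
  have h8 : (0 : ℝ) < n / 8 ^ i := by positivity
  have h := edgeCount_union_bound (n := n) p (fun A => A.card * d * 2 ^ i ≤ 16 * n)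
    (fun A B => 60 * (A.card + B.card + n / 8 ^ i)) (τ := (1 / 2) ^ (3 * i))
    (x := Real.exp (-(3 * (n / 8 ^ i)))) (by positivity) (Real.exp_nonneg _) (by
    intro A B hA
    have h := edgeCount_tail p A B (θ := (i + 2 : ℕ) * Real.log 2 / 2) (by positivity)
      (60 * (A.card + B.card + n / 8 ^ i))
    refine h.trans ?_
    rw [← pow_mul, ← pow_mul, ← exp_neg_mul_log_two, ← exp_neg_mul_log_two, ← Real.exp_add,
      ← Real.exp_add, Real.exp_le_exp, mul_div_cancel₀ _ (by norm_num : (2 : ℝ) ≠ 0),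
      Real.exp_nat_mul, Real.exp_log (by norm_num), hp]
    set a : ℝ := (A.card : ℝ) with ha
    set b : ℝ := (B.card : ℝ) with hb
    have ha0 : 0 ≤ a := Nat.cast_nonneg _
    have hb0 : 0 ≤ b := Nat.cast_nonneg _
    have hmean : d / n / 2 * (a * b * 2 ^ (i + 2)) ≤ 32 * b := by
      calc d / n / 2 * (a * b * 2 ^ (i + 2)) = 2 * b * (a * d * 2 ^ i / n) := by ring
        _ ≤ 2 * b * 16 := by
            gcongr
            rw [div_le_iff₀ hn']
            exact hA
        _ = _ := by ring
    have hlog : 0.69 * (i + 2 : ℝ) ≤ (i + 2) * Real.log 2 := by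
      rw [mul_comm]; gcongr
    have hlog2 : (i : ℝ) * Real.log 2 ≤ 0.7 * i := by rw [mul_comm]; gcongr
    have hi : (0 : ℝ) ≤ i := Nat.cast_nonneg _
    have k1 : (i + 2 : ℝ) * Real.log 2 / 2 * (60 * (a + b + n / 8 ^ i)) ≥
        (30 * (0.69 * (i + 2 : ℝ))) * (a + b + n / 8 ^ i) := by
      have : (0 : ℝ) ≤ a + b + n / 8 ^ i := by positivity
      nlinarith
    have k2 : (a + b) * (3 * (i * Real.log 2)) ≤ (a + b) * (3 * (0.7 * i)) := by gcongr
    have k3 : 0 ≤ (i : ℝ) * (a + b) := by positivity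
    have k4 : 0 ≤ (i : ℝ) * (n / 8 ^ i) := by positivity
    push_cast
    nlinarith)
  refine h.trans ?_
  rw [← Real.exp_add, Real.exp_le_exp, pow_mul]
  have : ((1 / 2 : ℝ) ^ 3) ^ i * n = n / 8 ^ i := by
    rw [show (1 / 2 : ℝ) ^ 3 = 1 / 8 by norm_num, div_pow, one_pow]
    ring
  rw [this]
  linarith

/-- A constant tilt suffices: for `θ = 1 / 2` the mean term is at most `(3 / 2) p |A| |B|` because
`e ≤ 3`, and the first term of the threshold cancels it. The other two terms pay for the weight `τ =
4 ^ (-i)` and for the final `3 n / 4 ^ i`. -/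
lemma discrepancy_tail {n : ℕ} {d : ℝ} (p : unitInterval)
    (hp : (p : ℝ) = d / n) (i : ℕ) :
    (SimpleGraph.binomialRandom (Fin n) p).real
      {G | ∀ A B : Finset (Fin n), edgeCount G A B ≤
        3 * (d / n) * (A.card * B.card) + 3 * i * (A.card + B.card) + 6 * n / 4 ^ i}ᶜ ≤
      Real.exp (-(n / 4 ^ i)) := by
  obtain ⟨hl1, hl2⟩ := log_two_bounds
  have h4 : (0 : ℝ) ≤ n / 4 ^ i := by positivity
  have h := edgeCount_union_bound (n := n) p (fun _ => True)
    (fun A B => 3 * (d / n) * (A.card * B.card) + 3 * i * (A.card + B.card) + 6 * n / 4 ^ i)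
    (τ := (1 / 2) ^ (2 * i))
    (x := Real.exp (-(3 * (n / 4 ^ i)))) (by positivity) (Real.exp_nonneg _) (by
    intro A B _
    have h := edgeCount_tail p A B (θ := 1 / 2) (by norm_num)
      (3 * (d / n) * (A.card * B.card) + 3 * i * (A.card + B.card) + 6 * n / 4 ^ i)
    refine h.trans ?_
    rw [← pow_mul, ← pow_mul, ← exp_neg_mul_log_two, ← exp_neg_mul_log_two, ← Real.exp_add,
      ← Real.exp_add, Real.exp_le_exp, ← hp]
    set a : ℝ := (A.card : ℝ) with ha
    set b : ℝ := (B.card : ℝ) with hb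
    have ha0 : 0 ≤ a := Nat.cast_nonneg _
    have hb0 : 0 ≤ b := Nat.cast_nonneg _
    have hp0 := p.2.1
    have he : Real.exp (2 * (1 / 2)) ≤ 3 := by
      norm_num
      linarith [Real.exp_one_lt_d9]
    have hlog2 : (i : ℝ) * Real.log 2 ≤ 0.7 * i := by rw [mul_comm]; gcongr
    have k1 : (p : ℝ) / 2 * (a * b * Real.exp (2 * (1 / 2))) ≤ p / 2 * (a * b * 3) := by gcongr
    have k2 : (a + b) * (2 * (i * Real.log 2)) ≤ (a + b) * (2 * (0.7 * i)) := by gcongr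
    have k3 : 0 ≤ (i : ℝ) * (a + b) := by positivity
    have e : 6 * (n : ℝ) / 4 ^ i = 6 * (n / 4 ^ i) := by ring
    push_cast
    rw [e]
    nlinarith)
  have e : {G : SimpleGraph (Fin n) | ∀ A B : Finset (Fin n), True → edgeCount G A B ≤
      3 * (d / n) * (A.card * B.card) + 3 * i * (A.card + B.card) + 6 * n / 4 ^ i} =
      {G | ∀ A B : Finset (Fin n), edgeCount G A B ≤
        3 * (d / n) * (A.card * B.card) + 3 * i * (A.card + B.card) + 6 * n / 4 ^ i} := by
    simp only [true_imp_iff]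
  rw [e] at h
  refine h.trans ?_
  rw [← Real.exp_add, Real.exp_le_exp, pow_mul]
  have : ((1 / 2 : ℝ) ^ 2) ^ i * n = n / 4 ^ i := by
    rw [show (1 / 2 : ℝ) ^ 2 = 1 / 4 by norm_num, div_pow, one_pow]
    ring
  rw [this]
  linarith

/-! ### The light part -/

/-- The integer points of the ball of squared radius `16 n`. -/
noncomputable def latticeBall (n : ℕ) : Finset (Fin n → ℤ) :=
  (Fintype.piFinset fun _ => Finset.Icc (-(16 * n : ℤ)) (16 * n)).filter
    fun z => ∑ u, (z u : ℝ) ^ 2 ≤ 16 * n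

lemma mem_latticeBall {n : ℕ} {z : Fin n → ℤ} (hz : ∑ u, (z u : ℝ) ^ 2 ≤ 16 * n) :
    z ∈ latticeBall n := by
  refine Finset.mem_filter.2 ⟨Fintype.mem_piFinset.2 fun u => ?_, hz⟩
  have h1 : (z u : ℝ) ^ 2 ≤ 16 * n :=
    (Finset.single_le_sum (f := fun u => (z u : ℝ) ^ 2) (fun _ _ => sq_nonneg _)
      (Finset.mem_univ u)).trans hz
  have h2 : z u ^ 2 ≤ 16 * n := by exact_mod_cast h1
  rw [Finset.mem_Icc]
  constructor <;> nlinarith [Int.le_self_sq (z u), Int.le_self_sq (-z u)]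

lemma hasSum_half_pow_natAbs : HasSum (fun k : ℤ => (1 / 2 : ℝ) ^ k.natAbs) (2 + 1) := by
  refine HasSum.of_nat_of_neg_add_one ?_ ?_
  · simpa using hasSum_geometric_two
  · have h : ∀ m : ℕ, (-((m : ℤ) + 1)).natAbs = m + 1 := fun m => by omega
    simp only [h, pow_succ]
    have := hasSum_geometric_two.mul_right (1 / 2 : ℝ)
    norm_num at this ⊢
    exact this

/-- Gaussian weighting: on the ball `1 ≤ exp(16 n) ∏ exp(-z u ^ 2)`, the sum over `z` factorizes,
and each factor is at most `∑ 2 ^ (-|k|) = 3 ≤ e ^ 2`. -/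
lemma card_latticeBall_le (n : ℕ) : ((latticeBall n).card : ℝ) ≤ Real.exp (18 * n) := by
  have hone : ∀ k : ℤ, Real.exp (-(k : ℝ) ^ 2) ≤ (1 / 2 : ℝ) ^ k.natAbs := by
    intro k
    have hk : (k : ℝ) ^ 2 = (k.natAbs : ℝ) ^ 2 := by
      rw [Nat.cast_natAbs, Int.cast_abs, sq_abs]
    rw [← exp_neg_mul_log_two, Real.exp_le_exp, neg_le_neg_iff, hk]
    obtain ⟨_, hl2⟩ := log_two_bounds
    have h1 : ((k.natAbs : ℕ) : ℝ) ≤ (k.natAbs : ℝ) ^ 2 := by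
      exact_mod_cast Nat.le_self_pow two_ne_zero _
    have h0 : (0 : ℝ) ≤ k.natAbs := Nat.cast_nonneg _
    nlinarith
  calc ((latticeBall n).card : ℝ) = ∑ _z ∈ latticeBall n, (1 : ℝ) := by simp
    _ ≤ ∑ z ∈ latticeBall n, Real.exp (16 * n) * ∏ u, Real.exp (-(z u : ℝ) ^ 2) := by
        refine Finset.sum_le_sum fun z hz => ?_
        rw [← Real.exp_sum, ← Real.exp_add]
        refine Real.one_le_exp ?_
        rw [Finset.sum_neg_distrib]
        linarith [(Finset.mem_filter.1 hz).2]
    _ ≤ ∑ z ∈ Fintype.piFinset fun _ : Fin n => Finset.Icc (-(16 * n : ℤ)) (16 * n),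
          Real.exp (16 * n) * ∏ u, Real.exp (-(z u : ℝ) ^ 2) :=
        Finset.sum_le_sum_of_subset_of_nonneg (Finset.filter_subset _ _)
          fun _ _ _ => by positivity
    _ = Real.exp (16 * n) * (∑ k ∈ Finset.Icc (-(16 * n : ℤ)) (16 * n),
          Real.exp (-(k : ℝ) ^ 2)) ^ n := by
        rw [← Finset.mul_sum, ← Finset.prod_univ_sum
          (fun _ : Fin n => Finset.Icc (-(16 * n : ℤ)) (16 * n)) (fun _ k => Real.exp (-(k : ℝ) ^ 2))]
        simp
    _ ≤ Real.exp (16 * n) * Real.exp 2 ^ n := by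
        gcongr
        calc _ ≤ ∑ k ∈ Finset.Icc (-(16 * n : ℤ)) (16 * n), (1 / 2 : ℝ) ^ k.natAbs :=
              Finset.sum_le_sum fun k _ => hone k
          _ ≤ 2 + 1 := sum_le_hasSum _ (fun k _ => by positivity) hasSum_half_pow_natAbs
          _ ≤ Real.exp 2 := Real.add_one_le_exp 2
    _ = Real.exp (18 * n) := by
        rw [← Real.exp_nat_mul, ← Real.exp_add]
        congr 1
        ring

/-- Tilting by `b u v = s * z u * z v / (2√d)` keeps `|2b| ≤ 1` exactly because the pairs are light,
so `exp x ≤ 1 + x + x ^ 2` applies. The linear terms cancel against the centring, the quadratic ones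
add up to at most `128 n`, and the threshold gives `-200 n`. -/
lemma lightForm_tail_aux {n : ℕ} {d : ℝ} (hd : 0 < d) (p : unitInterval) (hn : 0 < n)
    (hp : (p : ℝ) = d / n) (z : Fin n → ℤ) (hz : ∑ u, (z u : ℝ) ^ 2 ≤ 16 * n) {s : ℝ}
    (hs : |s| = 1) :
    (SimpleGraph.binomialRandom (Fin n) p).real {G | 400 * (√d * n) < s * lightForm d G z} ≤
      Real.exp (-(72 * n)) := by
  have hn' : (0 : ℝ) < n := by exact_mod_cast hn
  have hsd0 : 0 < √d := Real.sqrt_pos.2 hd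
  have hsd2 : √d * √d = d := Real.mul_self_sqrt hd.le
  have hp0 := p.2.1
  set b : Fin n → Fin n → ℝ := fun u v => if u ≠ v ∧ |(z u : ℝ) * z v| ≤ √d then
    s * ((z u : ℝ) * z v) / (2 * √d) else 0 with hb
  have h := chernoff p b (200 * n + p * ∑ u, ∑ v, b u v)
  refine le_trans (measureReal_mono ?_) (h.trans (Real.exp_le_exp.2 ?_))
  · intro G hG
    simp only [Set.mem_ofPred_eq] at hG ⊢
    have e : ∑ u, ∑ v, b u v * adjInd G u v - p * ∑ u, ∑ v, b u v =
        s * lightForm d G z / (2 * √d) := by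
      rw [lightForm, Finset.mul_sum, Finset.mul_sum, ← Finset.sum_sub_distrib, Finset.sum_div]
      refine Finset.sum_congr rfl fun u _ => ?_
      rw [Finset.mul_sum, Finset.mul_sum, ← Finset.sum_sub_distrib, Finset.sum_div]
      refine Finset.sum_congr rfl fun v _ => ?_
      simp only [hb]
      split_ifs
      · rw [hp]; ring
      · simp
    have : 200 * n ≤ s * lightForm d G z / (2 * √d) := by
      rw [le_div_iff₀ (by positivity)]
      linarith
    linarith
  · have hb1 : ∀ u v, |2 * b u v| ≤ 1 := by
      intro u v
      simp only [hb]
      split_ifs with hc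
      · rw [abs_mul, abs_div, abs_mul, hs, abs_two, abs_of_pos (by positivity : 0 < 2 * √d), one_mul,
          mul_div_assoc', div_le_one (by positivity)]
        linarith [hc.2]
      · simp
    have hb2 : ∀ u v, b u v ^ 2 ≤ (z u : ℝ) ^ 2 * (z v : ℝ) ^ 2 / (4 * d) := by
      intro u v
      simp only [hb]
      split_ifs with hc
      · apply le_of_eq
        rw [div_pow, mul_pow s, ← sq_abs s, hs, mul_pow, mul_pow, sq (√d), hsd2]
        ring
      · rw [zero_pow two_ne_zero]; positivity
    have hexp : ∀ u v, (if u = v then 0 else Real.exp (2 * b u v) - 1) ≤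
        2 * b u v + 4 * ((z u : ℝ) ^ 2 * (z v : ℝ) ^ 2 / (4 * d)) := by
      intro u v
      have h1 := Real.abs_exp_sub_one_sub_id_le (hb1 u v)
      have h2 := (abs_le.1 h1).2
      have h3 := hb2 u v
      split_ifs with hc
      · have : b u v = 0 := by simp [hb, hc]
        have h4 : 0 ≤ (z u : ℝ) ^ 2 * (z v : ℝ) ^ 2 / (4 * d) := by positivity
        linarith
      · nlinarith
    have hsum : ∑ u, ∑ v, (if u = v then 0 else Real.exp (2 * b u v) - 1) ≤
        2 * ∑ u, ∑ v, b u v + 256 * n ^ 2 / d := by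
      calc _ ≤ ∑ u, ∑ v, (2 * b u v + 4 * ((z u : ℝ) ^ 2 * (z v : ℝ) ^ 2 / (4 * d))) :=
            Finset.sum_le_sum fun u _ => Finset.sum_le_sum fun v _ => hexp u v
        _ = 2 * ∑ u, ∑ v, b u v + ((∑ u, (z u : ℝ) ^ 2) * ∑ v, (z v : ℝ) ^ 2) / d := by
            rw [Finset.sum_mul_sum, Finset.mul_sum, Finset.sum_div, ← Finset.sum_add_distrib]
            refine Finset.sum_congr rfl fun u _ => ?_
            rw [Finset.mul_sum, Finset.sum_div, ← Finset.sum_add_distrib]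
            refine Finset.sum_congr rfl fun v _ => ?_
            field_simp
        _ ≤ 2 * ∑ u, ∑ v, b u v + ((16 * n) * (16 * n)) / d := by gcongr
        _ = _ := by ring
    have hfin : (p : ℝ) / 2 * (256 * n ^ 2 / d) = 128 * n := by
      rw [hp]
      field_simp
      ring
    have := mul_le_mul_of_nonneg_left hsum (by positivity : 0 ≤ (p : ℝ) / 2)
    rw [mul_add, hfin] at this
    linarith

/-- Union bound over two signs and `exp(18 n)` lattice points: `72 - 18 = 54`. -/
lemma lightForm_tail {n : ℕ} {d : ℝ} (hd : 0 < d) (p : unitInterval) (hn : 0 < n)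
    (hp : (p : ℝ) = d / n) :
    (SimpleGraph.binomialRandom (Fin n) p).real
      {G | ∀ z : Fin n → ℤ, ∑ u, (z u : ℝ) ^ 2 ≤ 16 * n →
        |lightForm d G z| ≤ 400 * (√d * n)}ᶜ ≤ 2 * Real.exp (-(54 * n)) := by
  calc _ ≤ (SimpleGraph.binomialRandom (Fin n) p).real
        (⋃ z ∈ latticeBall n, ({G | 400 * (√d * n) < 1 * lightForm d G z} ∪
          {G | 400 * (√d * n) < (-1) * lightForm d G z})) := by
        refine measureReal_mono ?_ (measure_ne_top _ _)
        intro G hG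
        simp only [Set.mem_compl_iff, Set.mem_ofPred_eq, not_forall, not_le] at hG
        obtain ⟨z, hz, hm⟩ := hG
        simp only [Set.mem_iUnion, Set.mem_union, Set.mem_ofPred_eq]
        refine ⟨z, mem_latticeBall hz, ?_⟩
        rw [one_mul, neg_one_mul]
        exact lt_abs.1 hm
    _ ≤ ∑ z ∈ latticeBall n, (Real.exp (-(72 * n)) + Real.exp (-(72 * n))) := by
        refine (measureReal_biUnion_finset_le _ _).trans (Finset.sum_le_sum fun z hz => ?_)
        have hz' := (Finset.mem_filter.1 hz).2
        exact (measureReal_union_le _ _).trans (add_le_add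
          (lightForm_tail_aux hd p hn hp z hz' (by simp))
          (lightForm_tail_aux hd p hn hp z hz' (by simp)))
    _ = (latticeBall n).card * (2 * Real.exp (-(72 * n))) := by
        rw [Finset.sum_const, nsmul_eq_mul, two_mul]
    _ ≤ Real.exp (18 * n) * (2 * Real.exp (-(72 * n))) := by
        gcongr
        exact card_latticeBall_le n
    _ = _ := by
        rw [mul_left_comm, ← Real.exp_add]
        congr 2
        ring

/-! ### Consequences of a large 2-cycle free radius -/

section Paths

variable {V : Type*} {G : SimpleGraph V}

/-- A path of length at most `r` ending at `v` stays in the ball around `v`, hence is a path of the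
induced graph. Recording paths by their supports lets walks with different starts be kept in one
finset later. -/
lemma card_path_supports_le {r : ℕ} (hG : TwoCycleFreeWithin G r) (u v : V)
    (L : Finset (List V))
    (hL : ∀ l ∈ L, ∃ p : G.Walk u v, p.IsPath ∧ p.length ≤ r ∧ p.support = l) :
    L.card ≤ 2 := by
  rcases L.eq_empty_or_nonempty with rfl | hne
  · simp
  have : Nonempty (G.Walk u v) := ⟨(hL _ hne.choose_spec).choose⟩
  choose! P hP using hL
  have hball : ∀ l ∈ L, ∀ x ∈ (P l).support, x ∈ {w | G.edist v w ≤ r} := by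
    intro l hl x hx
    have h1 : G.edist x v ≤ ((P l).dropUntil x hx).length := SimpleGraph.Walk.edist_le _
    have h2 : ((P l).dropUntil x hx).length ≤ r :=
      (SimpleGraph.Walk.length_dropUntil_le_length _ _).trans (hP l hl).2.1
    rw [Set.mem_ofPred_eq, SimpleGraph.edist_comm]
    exact h1.trans (by exact_mod_cast h2)
  obtain ⟨l₀, hl₀⟩ := hne
  have hu := hball l₀ hl₀ u (SimpleGraph.Walk.start_mem_support _)
  have hv := hball l₀ hl₀ v (SimpleGraph.Walk.end_mem_support _)
  let f : L → (G.induce {w | G.edist v w ≤ r}).Path ⟨u, hu⟩ ⟨v, hv⟩ := fun l =>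
    ⟨(P l).induce _ (hball l l.2), by
      have h := (hP l l.2).1
      rw [← SimpleGraph.Walk.map_induce (P l) (hball l l.2)] at h
      exact SimpleGraph.Walk.IsPath.of_map h⟩
  have hf : Function.Injective f := by
    intro l l' h
    have h1 : (P l).induce _ (hball l l.2) = (P l').induce _ (hball l' l'.2) :=
      congrArg Subtype.val h
    have h2 := congrArg (fun w => (w.map (SimpleGraph.Embedding.induce _).toHom).support) h1
    simp only [SimpleGraph.Walk.map_induce] at h2
    apply Subtype.ext
    rw [← (hP l l.2).2.2, ← (hP l' l'.2).2.2]
    exact h2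
  have h1 := (ENat.card_le_card_of_injective hf).trans (hG v ⟨u, hu⟩ ⟨v, hv⟩)
  rw [ENat.card_eq_coe_fintype_card, Fintype.card_coe] at h1
  exact_mod_cast h1

/-- A path has at most two chords at its starting point (one of them being its first edge). -/
lemma card_neighbors_on_path_le {r : ℕ} (hG : TwoCycleFreeWithin G r) {u v : V}
    (p : G.Walk u v) (hp : p.IsPath) (hr : p.length ≤ r) (N : Finset V)
    (hN : ∀ a ∈ N, G.Adj u a ∧ a ∈ p.support) : N.card ≤ 2 := by
  -- Each neighbour `a` of `u` on the path gives a shortcut: jump from `u` to `a`, then follow the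
  -- path to `v`. Different `a` give different second vertices, so there are at most two.
  have key : ∀ a ∈ N, ∃ q : G.Walk a v, (q.IsPath ∧ q.length + 1 ≤ r) ∧ u ∉ q.support := by
    intro a ha
    obtain ⟨hadj, hmem⟩ := hN a ha
    refine ⟨p.dropUntil a hmem, ⟨hp.dropUntil hmem, ?_⟩, ?_⟩
    · exact (SimpleGraph.Walk.length_dropUntil_lt_length hmem hadj.ne').trans_le hr
    · intro hcon
      have hp' := hp
      rw [← p.take_spec hmem] at hp'
      exact SimpleGraph.Walk.IsPath.ne_of_mem_support_of_append hp' hadj.ne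
        (SimpleGraph.Walk.start_mem_support _) hcon rfl
  choose q hq1 hq2 using key
  have h := card_path_supports_le hG u v
    (N.attach.image fun a : {x // x ∈ N} => u :: (q a.1 a.2).support) (by
    intro l hl
    obtain ⟨⟨a, ha⟩, _, rfl⟩ := Finset.mem_image.1 hl
    refine ⟨SimpleGraph.Walk.cons (hN a ha).1 (q a ha), ?_, ?_, ?_⟩
    · exact (SimpleGraph.Walk.cons_isPath_iff _ _).2 ⟨(hq1 a ha).1, hq2 a ha⟩
    · rw [SimpleGraph.Walk.length_cons]; exact (hq1 a ha).2
    · rw [SimpleGraph.Walk.support_cons])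
  rw [Finset.card_image_of_injective, Finset.card_attach] at h
  · exact h
  · intro a b hab
    have h1 : (q a.1 a.2).support = (q b.1 b.2).support := (List.cons.inj hab).2
    rw [← SimpleGraph.Walk.cons_tail_support, ← SimpleGraph.Walk.cons_tail_support (q b.1 b.2)] at h1
    exact Subtype.ext (List.cons.inj h1).1

/-- Exponentially many paths in a set of minimum degree at least `4`. -/
lemma exists_many_paths {r : ℕ} (hG : TwoCycleFreeWithin G r) (S : Finset V)
    (hdeg : ∀ v ∈ S, 4 ≤ (S.filter fun u => G.Adj v u).card) (v : V) (hv : v ∈ S) (i : ℕ)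
    (hi : i ≤ r) :
    ∃ L : Finset (List V), L.card = 2 ^ i ∧ ∀ l ∈ L, ∃ u ∈ S, ∃ p : G.Walk u v,
      p.IsPath ∧ p.length = i ∧ p.support = l := by
  induction i with
  | zero =>
    refine ⟨{[v]}, by simp, fun l hl => ⟨v, hv, SimpleGraph.Walk.nil, by simp, rfl, ?_⟩⟩
    rw [Finset.mem_singleton.1 hl]
    rfl
  | succ i ih =>
    obtain ⟨L, hcard, hL⟩ := ih (by omega)
    choose u huS p hp using hL
    have hext : ∀ (l : List V) (hl : l ∈ L), ∃ e : Bool → V, Function.Injective e ∧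
        ∀ b, e b ∈ S ∧ G.Adj (u l hl) (e b) ∧ e b ∉ (p l hl).support := by
      intro l hl
      have h1 := hdeg (u l hl) (huS l hl)
      have h2 := card_neighbors_on_path_le hG (p l hl) (hp l hl).1 (by rw [(hp l hl).2.1]; omega)
        ((S.filter fun x => G.Adj (u l hl) x).filter fun x => x ∈ (p l hl).support) (by
          intro a ha
          simp only [Finset.mem_filter] at ha
          exact ⟨ha.1.2, ha.2⟩)
      have h3 := Finset.card_filter_add_card_filter_not
        (s := S.filter fun x => G.Adj (u l hl) x) (fun x => x ∈ (p l hl).support)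
      -- Of at least four neighbours in `S`, at most two lie on the path, so it can be prolonged at
      -- its start in two ways.
      obtain ⟨a, ha, b, hb, hab⟩ := Finset.one_lt_card.1
        (show 1 < ((S.filter fun x => G.Adj (u l hl) x).filter fun x => x ∉ (p l hl).support).card by
          omega)
      simp only [Finset.mem_filter] at ha hb
      refine ⟨fun c => if c then a else b, ?_, ?_⟩
      · intro c c' h
        cases c <;> cases c' <;> simp_all
      · intro c
        cases c
        · simpa using ⟨hb.1.1, hb.1.2, hb.2⟩
        · simpa using ⟨ha.1.1, ha.1.2, ha.2⟩
    have : Nonempty V := ⟨v⟩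
    choose! e he1 he2 using hext
    refine ⟨(L ×ˢ (Finset.univ : Finset Bool)).image fun x => e x.1 x.2 :: x.1, ?_, ?_⟩
    · rw [Finset.card_image_of_injOn, Finset.card_product, hcard, pow_succ]
      · simp
      · rintro ⟨l, b⟩ hx ⟨l', b'⟩ hx' h
        obtain ⟨h1, rfl⟩ := List.cons.inj h
        have hl : l ∈ L := (Finset.mem_product.1 hx).1
        have hb : b = b' := he1 l hl h1
        rw [hb]
    · intro l' hl'
      obtain ⟨⟨l, b⟩, hx, rfl⟩ := Finset.mem_image.1 hl'
      have hl : l ∈ L := (Finset.mem_product.1 hx).1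
      obtain ⟨k1, k2, k3⟩ := he2 l hl b
      refine ⟨e l b, k1, SimpleGraph.Walk.cons k2.symm (p l hl), ?_, ?_, ?_⟩
      · exact (SimpleGraph.Walk.cons_isPath_iff _ _).2 ⟨(hp l hl).1, k3⟩
      · rw [SimpleGraph.Walk.length_cons, (hp l hl).2.1]
      · rw [SimpleGraph.Walk.support_cons, (hp l hl).2.2]

/-- Sets of minimum degree at least `4` are exponentially large in the 2-cycle free radius. -/
lemma two_pow_le_of_min_degree {r : ℕ} (hG : TwoCycleFreeWithin G r) (S : Finset V)
    (hS : S.Nonempty) (hdeg : ∀ v ∈ S, 4 ≤ (S.filter fun u => G.Adj v u).card) :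
    2 ^ r ≤ 2 * S.card := by
  obtain ⟨v, hv⟩ := hS
  obtain ⟨L, hcard, hL⟩ := exists_many_paths hG S hdeg v hv r le_rfl
  have : Nonempty V := ⟨v⟩
  choose! u huS hp using hL
  rw [← hcard]
  -- Group the `2 ^ r` paths by their starting vertex in `S`; each group has at most two elements.
  refine (Finset.card_le_mul_card_image (f := u) L 2 ?_).trans
    (Nat.mul_le_mul_left 2 (Finset.card_le_card (Finset.image_subset_iff.2 huS)))
  intro x _
  refine card_path_supports_le hG x v _ fun l hl => ?_
  obtain ⟨hlL, rfl⟩ := Finset.mem_filter.1 hl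
  obtain ⟨p, h1, h2, h3⟩ := hp l hlL
  exact ⟨p, h1, h2.le, h3⟩

/-- A graph without short cycles has large 2-cycle free radius. -/
lemma twoCycleFreeWithin_of_no_short_cycle {r : ℕ}
    (h : ∀ (x : V) (c : G.Walk x x), c.IsCycle → 2 * r + 2 < c.length) :
    TwoCycleFreeWithin G r := by
  intro v
  have hac : (G.induce {w | G.edist v w ≤ r}).IsAcyclic := by
    intro x c hc
    -- Take the vertex `u` of the cycle farthest from `v`. Geodesics to its two neighbours on the
    -- cycle avoid `u` by maximality; prolonged to `u` they are two distinct paths of length at most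
    -- `r + 1`, which close up to a cycle of length at most `2r + 2`.
    obtain ⟨u, hu, hmax⟩ := Finset.exists_max_image c.support.toFinset
      (fun w => G.dist v w) ⟨x, by simp⟩
    rw [List.mem_toFinset] at hu
    have hmax' : ∀ w ∈ c.support, G.dist v w ≤ G.dist v u := fun w hw =>
      hmax w (List.mem_toFinset.2 hw)
    set c' := c.rotate u hu with hc'
    have hcyc : c'.IsCycle := hc.rotate hu
    have hnil : ¬ c'.Nil := hcyc.not_nil
    have hsupp : ∀ w ∈ c'.support, w ∈ c.support := fun w hw =>
      (SimpleGraph.Walk.mem_support_rotate_iff c u hu).1 hw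
    have hreach : ∀ w : {w | G.edist v w ≤ r}, G.Reachable v w := by
      intro w
      rw [← SimpleGraph.edist_ne_top_iff_reachable]
      exact ne_top_of_le_ne_top (ENat.natCast_ne_top r) w.2
    have hdist : G.dist v u ≤ r := by
      have h1 : (G.dist v u : ℕ∞) = G.edist v u := (hreach u).coe_dist_eq_edist
      have h2 : G.edist v u ≤ r := u.2
      rw [← h1] at h2
      exact_mod_cast h2
    have hgeo : ∀ a : {w | G.edist v w ≤ r}, a ∈ c'.support →
        (G.induce {w | G.edist v w ≤ r}).Adj a u →
        ∃ p : G.Walk v u, p.IsPath ∧ p.length ≤ r + 1 ∧ p.penultimate = a := by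
      intro a ha hadj
      have hadj' : G.Adj a u := hadj
      obtain ⟨p, hp, hlen⟩ := (hreach a).exists_path_of_dist
      have hle : p.length ≤ G.dist v u := by rw [hlen]; exact hmax' a (hsupp a ha)
      have hup : (u : V) ∉ p.support := by
        intro hmem
        have h1 := SimpleGraph.Walk.length_takeUntil_lt_length hmem hadj'.ne'
        have h2 : G.dist v u ≤ (p.takeUntil u hmem).length := SimpleGraph.dist_le _
        omega
      refine ⟨p.concat hadj', hp.concat hup hadj', ?_, ?_⟩
      · rw [SimpleGraph.Walk.length_concat]; omega
      · simp
    obtain ⟨p, hp, hpl, hpp⟩ := hgeo c'.snd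
      (List.mem_of_mem_tail (SimpleGraph.Walk.snd_mem_tail_support hnil))
      (SimpleGraph.Walk.adj_snd hnil).symm
    obtain ⟨q, hq, hql, hqp⟩ := hgeo c'.penultimate
      (List.mem_of_mem_dropLast (SimpleGraph.Walk.penultimate_mem_dropLast_support hnil))
      (SimpleGraph.Walk.adj_penultimate hnil)
    have hne : p ≠ q := by
      rintro rfl
      exact hcyc.snd_ne_penultimate (Subtype.ext (hpp.symm.trans hqp))
    obtain ⟨w, _, _, k, hk, hkl⟩ := hp.exists_isCycle_length_le_add_of_ne hq hne
    have := h w k hk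
    omega
  intro x y
  have hs := SimpleGraph.isAcyclic_iff_subsingleton_path.1 hac x y
  exact (ENat.card_le_one_iff_subsingleton _ |>.2 hs).trans (by norm_num)

lemma TwoCycleFreeWithin.anti {H : SimpleGraph V} (hHG : H ≤ G) {r : ℕ}
    (hG : TwoCycleFreeWithin G r) : TwoCycleFreeWithin H r := by
  intro v x y
  have hsub : ∀ w : {w | H.edist v w ≤ r}, (w : V) ∈ {w | G.edist v w ≤ r} := fun w =>
    (SimpleGraph.edist_anti hHG).trans w.2
  let f : H.induce {w | H.edist v w ≤ r} →g G.induce {w | G.edist v w ≤ r} :=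
    { toFun := fun w => ⟨w, hsub w⟩
      map_rel' := fun {a b} hab => hHG hab }
  have hf : Function.Injective f := fun a b hab =>
    Subtype.ext (congrArg (Subtype.val (p := fun w => G.edist v w ≤ r)) hab)
  exact (ENat.card_le_card_of_injective (SimpleGraph.Path.map_injective hf x y)).trans
    (hG v (f x) (f y))

end Paths

/-- This monotonicity is what makes Harris' inequality applicable to the conditioning. -/
lemma isLowerSet_radiusEvent (n : ℕ) (c d : ℝ) : IsLowerSet (radiusEvent n c d) := by
  intro G H hHG hG
  refine le_trans (b := twoCycleFreeRadius G) hG (sSup_le_sSup (Set.image_mono fun r hr => ?_))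
  exact TwoCycleFreeWithin.anti hHG hr

lemma mem_radiusEvent_of_twoCycleFreeWithin {n : ℕ} {c d : ℝ} {G : SimpleGraph (Fin n)}
    (h : TwoCycleFreeWithin G ⌈c * Real.logb d n⌉₊) : G ∈ radiusEvent n c d := by
  change ((⌈c * Real.logb d n⌉₊ : ℕ) : ℕ∞) ≤ twoCycleFreeRadius G
  exact le_sSup ⟨_, h, rfl⟩

/-- If all admissible radii were below the threshold, their supremum would be at most the threshold
minus one, a contradiction since the threshold is positive. -/
lemma exists_twoCycleFreeWithin_of_mem_radiusEvent {n : ℕ} {c d : ℝ} {G : SimpleGraph (Fin n)}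
    (hG : G ∈ radiusEvent n c d) (h0 : 0 < ⌈c * Real.logb d n⌉₊) :
    ∃ r : ℕ, ⌈c * Real.logb d n⌉₊ ≤ r ∧ TwoCycleFreeWithin G r := by
  by_contra! hcon
  have h1 : twoCycleFreeRadius G ≤ ((⌈c * Real.logb d n⌉₊ - 1 : ℕ) : ℕ∞) := by
    refine sSup_le ?_
    rintro _ ⟨r, hr, rfl⟩
    have : r < ⌈c * Real.logb d n⌉₊ := by
      by_contra hlt
      exact hcon r (not_lt.1 hlt) hr
    exact Nat.cast_le.2 (by omega : r ≤ ⌈c * Real.logb d n⌉₊ - 1)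
  have h2 : ((⌈c * Real.logb d n⌉₊ : ℕ) : ℕ∞) ≤ ((⌈c * Real.logb d n⌉₊ - 1 : ℕ) : ℕ∞) :=
    le_trans hG h1
  have h3 : ⌈c * Real.logb d n⌉₊ ≤ ⌈c * Real.logb d n⌉₊ - 1 := by exact_mod_cast h2
  omega

/-- On the radius event, small sets have a vertex of degree at most `3`. -/
lemma exists_degree_le_three {n : ℕ} {c d : ℝ} {G : SimpleGraph (Fin n)}
    (hG : G ∈ radiusEvent n c d) (h0 : 0 < ⌈c * Real.logb d n⌉₊) (S : Finset (Fin n))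
    (hS : S.Nonempty) (hcard : 2 * S.card < 2 ^ ⌈c * Real.logb d n⌉₊) :
    ∃ v ∈ S, ∑ u ∈ S, adjInd G v u ≤ 3 := by
  obtain ⟨r, hr, hfree⟩ := exists_twoCycleFreeWithin_of_mem_radiusEvent hG h0
  by_contra! hcon
  have h1 := two_pow_le_of_min_degree hfree S hS (by
    intro v hv
    have h := hcon v hv
    simp only [adjInd, Finset.sum_boole] at h
    have : 3 < (S.filter fun u => G.Adj v u).card := by exact_mod_cast h
    omega)
  have h2 : 2 ^ ⌈c * Real.logb d n⌉₊ ≤ 2 ^ r := Nat.pow_le_pow_right (by norm_num) hr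
  omega

/-! ### The probability of the radius event -/

/-- Containing a given edge set is an increasing event, so avoiding the sets one by one is
positively correlated and the probabilities multiply to a lower bound. -/
lemma harris_finset {n : ℕ} (p : unitInterval) {ι : Type*} (s : Finset ι)
    (F : ι → Finset (Sym2 (Fin n))) (hF : ∀ i ∈ s, ∀ e ∈ F i, ¬ e.IsDiag) :
    ∏ i ∈ s, (1 - (p : ℝ) ^ (F i).card) ≤
      (SimpleGraph.binomialRandom (Fin n) p).real
        {G | ∃ i ∈ s, ∀ e ∈ F i, e ∈ G.edgeSet}ᶜ := by
  have hup : ∀ s : Finset ι, IsUpperSet {G : SimpleGraph (Fin n) |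
      ∃ i ∈ s, ∀ e ∈ F i, e ∈ G.edgeSet} := by
    rintro s G H hGH ⟨i, hi, h⟩
    exact ⟨i, hi, fun e he => SimpleGraph.edgeSet_mono hGH (h e he)⟩
  have hup1 : ∀ i, IsUpperSet {G : SimpleGraph (Fin n) | ∀ e ∈ F i, e ∈ G.edgeSet} := by
    intro i G H hGH h e he
    exact SimpleGraph.edgeSet_mono hGH (h e he)
  induction s using Finset.induction_on with
  | empty => simp
  | insert i s hi ih =>
    rw [Finset.prod_insert hi]
    have h1 := (harris_lower_lower p (hup1 i) (hup s)).1
    have h2 : (1 : ℝ) - (p : ℝ) ^ (F i).card ≤ (SimpleGraph.binomialRandom (Fin n) p).real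
        {G : SimpleGraph (Fin n) | ∀ e ∈ F i, e ∈ G.edgeSet}ᶜ := by
      rw [probReal_compl_eq_one_sub (Set.toFinite _).measurableSet]
      linarith [binomialRandom_real_subset_le p (F i) (hF i (Finset.mem_insert_self i s))]
    have h3 : ({G : SimpleGraph (Fin n) | ∃ j ∈ insert i s, ∀ e ∈ F j, e ∈ G.edgeSet}ᶜ) =
        {G : SimpleGraph (Fin n) | ∀ e ∈ F i, e ∈ G.edgeSet}ᶜ ∩
          {G | ∃ i ∈ s, ∀ e ∈ F i, e ∈ G.edgeSet}ᶜ := by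
      rw [← Set.compl_union]
      congr 1
      ext G
      simp only [Finset.exists_mem_insert, Set.mem_union, Set.mem_ofPred_eq]
    rw [h3]
    refine le_trans ?_ h1
    refine mul_le_mul h2 (ih fun j hj => hF j (Finset.mem_insert_of_mem hj)) ?_
      measureReal_nonneg
    exact Finset.prod_nonneg fun j _ => sub_nonneg.2 (pow_le_one₀ p.2.1 p.2.2)

lemma exp_neg_two_mul_le_one_sub {x : ℝ} (h1 : x ≤ 1 / 2) (h0 : 0 ≤ x) :
    Real.exp (-(2 * x)) ≤ 1 - x := by
  have hpos : 0 < 1 - x := by linarith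
  rw [← Real.le_log_iff_exp_le hpos]
  refine le_trans ?_ (Real.one_sub_inv_le_log_of_pos hpos)
  have : (1 - x)⁻¹ ≤ 1 + 2 * x := by
    rw [inv_le_iff_one_le_mul₀ hpos]
    nlinarith
  linarith

/-! ### Avoiding all short cycles -/

/-- The closed walks of the complete graph which are cycles of length at most `L`. -/
noncomputable def shortCycles (n L : ℕ) :
    Finset (Σ _ : ℕ, Σ u : Fin n, (⊤ : SimpleGraph (Fin n)).Walk u u) :=
  (Finset.range (L + 1)).sigma fun m => Finset.univ.sigma fun u =>
    ((⊤ : SimpleGraph (Fin n)).finsetWalkLength m u u).filter fun w => w.IsCycle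

lemma mem_shortCycles {n L : ℕ} {x : Σ _ : ℕ, Σ u : Fin n, (⊤ : SimpleGraph (Fin n)).Walk u u} :
    x ∈ shortCycles n L ↔ x.1 ≤ L ∧ x.2.2.length = x.1 ∧ x.2.2.IsCycle := by
  simp [shortCycles, SimpleGraph.mem_finsetWalkLength_iff]

lemma card_finsetWalkLength_le (n m : ℕ) (u v : Fin n) :
    ((⊤ : SimpleGraph (Fin n)).finsetWalkLength (m + 1) u v).card ≤ n ^ m := by
  induction m generalizing u with
  | zero =>
    rw [zero_add, pow_zero, Finset.card_le_one]
    intro a ha b hb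
    rw [SimpleGraph.mem_finsetWalkLength_iff] at ha hb
    cases a with
    | nil => simp at ha
    | cons h p =>
      cases b with
      | nil => simp at hb
      | cons h' p' =>
        cases p with
        | nil =>
          cases p' with
          | nil => rfl
          | cons _ _ => simp at hb
        | cons _ _ => simp at ha
  | succ m ih =>
    rw [SimpleGraph.finsetWalkLength]
    refine Finset.card_biUnion_le.trans ?_
    refine (Finset.sum_le_card_nsmul _ _ (n ^ m) ?_).trans ?_
    · intro w _
      rw [Finset.card_map]
      exact ih w
    · rw [smul_eq_mul, pow_succ, mul_comm]
      refine Nat.mul_le_mul_left _ ?_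
      rw [Finset.card_univ]
      exact (Fintype.card_subtype_le _).trans (by simp)

lemma card_edges_of_mem_shortCycles {n L : ℕ}
    {x : Σ _ : ℕ, Σ u : Fin n, (⊤ : SimpleGraph (Fin n)).Walk u u} (hx : x ∈ shortCycles n L) :
    x.2.2.edges.toFinset.card = x.1 := by
  obtain ⟨_, h2, h3⟩ := mem_shortCycles.1 hx
  rw [List.toFinset_card_of_nodup h3.edges_nodup, SimpleGraph.Walk.length_edges, h2]

/-- First moment: there are at most `n ^ m` rooted cycles of length `m`, each present with
probability `(d / n) ^ m`. -/
lemma sum_shortCycles_le {n L : ℕ} {d : ℝ} (hd : 1 ≤ d) (hn : 0 < n) :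
    ∑ x ∈ shortCycles n L, (d / n) ^ x.2.2.edges.toFinset.card ≤ (L + 1) * d ^ L := by
  have hn' : (0 : ℝ) < n := by exact_mod_cast hn
  calc _ = ∑ x ∈ shortCycles n L, (d / n) ^ x.1 :=
        Finset.sum_congr rfl fun x hx => by rw [card_edges_of_mem_shortCycles hx]
    _ ≤ ∑ _m ∈ Finset.range (L + 1), d ^ L := by
        rw [shortCycles, Finset.sum_sigma]
        refine Finset.sum_le_sum fun m hm => ?_
        change ∑ _s ∈ _, (d / n) ^ m ≤ _
        rw [Finset.sum_const, nsmul_eq_mul, Finset.card_sigma]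
        cases m with
        | zero =>
          rw [Finset.sum_eq_zero]
          · simp only [Nat.cast_zero, zero_mul]
            positivity
          · intro u _
            rw [Finset.card_eq_zero, Finset.filter_eq_empty_iff]
            intro w hw hc
            have h3 := hc.three_le_length
            rw [SimpleGraph.mem_finsetWalkLength_iff] at hw
            omega
        | succ m =>
          have h1 : ∑ u : Fin n, (((⊤ : SimpleGraph (Fin n)).finsetWalkLength (m + 1) u u).filter
              fun w => w.IsCycle).card ≤ n ^ (m + 1) := by
            refine (Finset.sum_le_card_nsmul _ _ (n ^ m) fun u _ =>
              (Finset.card_filter_le _ _).trans (card_finsetWalkLength_le n m u u)).trans ?_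
            simp [pow_succ, mul_comm]
          calc _ ≤ ((n ^ (m + 1) : ℕ) : ℝ) * (d / n) ^ (m + 1) := by
                gcongr
            _ = d ^ (m + 1) := by
                push_cast
                rw [div_pow]
                field_simp
            _ ≤ d ^ L := pow_le_pow_right₀ hd (by
                have := Finset.mem_range.1 hm
                omega)
    _ = _ := by simp

/-- It suffices to avoid all cycles of length at most `2R + 2`. Harris gives a product of factors `1
- x ≥ exp(-2x)`, and the first moment bounds the sum of the exponents. -/
lemma le_real_radiusEvent {n : ℕ} {c d : ℝ} (hd : 1 ≤ d) (hn : 2 * d ≤ n) :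
    Real.exp (-(2 * ((2 * ⌈c * Real.logb d n⌉₊ + 2 + 1 : ℕ) *
      d ^ (2 * ⌈c * Real.logb d n⌉₊ + 2)))) ≤ (gnp n d).real (radiusEvent n c d) := by
  set R := ⌈c * Real.logb d n⌉₊ with hR
  set L := 2 * R + 2 with hL
  have hn' : (0 : ℝ) < n := by linarith
  have hn0 : 0 < n := by exact_mod_cast hn'
  have hp : (edgeProb n d : ℝ) = d / n := edgeProb_eq (by linarith) (by linarith) hn0
  have hp0 : 0 ≤ d / n := by positivity
  have hp2 : d / n ≤ 1 / 2 := by rw [div_le_iff₀ hn']; linarith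
  have h := harris_finset (edgeProb n d) (shortCycles n L) (fun x => x.2.2.edges.toFinset) (by
    intro x _ e he
    exact SimpleGraph.not_isDiag_of_mem_edgeSet _
      (SimpleGraph.Walk.edges_subset_edgeSet _ (List.mem_toFinset.1 he)))
  refine le_trans ?_ (h.trans (measureReal_mono ?_ (measure_ne_top _ _)))
  · rw [hp]
    calc _ ≤ ∏ x ∈ shortCycles n L, Real.exp (-(2 * (d / n) ^ x.2.2.edges.toFinset.card)) := by
          rw [← Real.exp_sum, Real.exp_le_exp, Finset.sum_neg_distrib, ← Finset.mul_sum,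
            neg_le_neg_iff]
          have := sum_shortCycles_le (n := n) (L := L) hd hn0
          push_cast at this ⊢
          linarith
      _ ≤ _ := by
          refine Finset.prod_le_prod (fun x _ => Real.exp_nonneg _) fun x hx => ?_
          refine exp_neg_two_mul_le_one_sub ?_ (by positivity)
          rw [card_edges_of_mem_shortCycles hx]
          obtain ⟨_, h2, h3⟩ := mem_shortCycles.1 hx
          have := h3.three_le_length
          calc (d / n) ^ x.1 ≤ (d / n) ^ 1 :=
                pow_le_pow_of_le_one hp0 (by linarith) (by omega)
            _ ≤ 1 / 2 := by rw [pow_one]; exact hp2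
  · intro G hG
    refine mem_radiusEvent_of_twoCycleFreeWithin (twoCycleFreeWithin_of_no_short_cycle ?_)
    intro x w hw
    by_contra hlen
    refine hG ⟨⟨w.length, x, w.mapLe le_top⟩, mem_shortCycles.2 ⟨?_, ?_, ?_⟩, ?_⟩
    · exact not_lt.1 hlen
    · simp
    · exact (SimpleGraph.Walk.isCycle_mapLe _).2 hw
    · intro e he
      rw [List.mem_toFinset] at he
      rw [SimpleGraph.Walk.edges_mapLe_eq_edges] at he
      exact SimpleGraph.Walk.edges_subset_edgeSet _ he

/-- The radius is at most `c * log_d n + 1`. -/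
lemma pow_radius_le {n : ℕ} {c d : ℝ} (hd : 1 < d) (hn : 0 < n) (hc : 0 < c) :
    d ^ (2 * ⌈c * Real.logb d n⌉₊ + 2) ≤ d ^ 4 * (n : ℝ) ^ (2 * c) := by
  have hn1 : (1 : ℝ) ≤ n := by exact_mod_cast hn
  have hn' : (0 : ℝ) < n := by linarith
  have hlog : 0 ≤ c * Real.logb d n := mul_nonneg hc.le (Real.logb_nonneg hd hn1)
  have hR := (Nat.ceil_lt_add_one hlog).le
  have e : (n : ℝ) ^ (2 * c) = d ^ (2 * (c * Real.logb d n)) := by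
    conv_lhs => rw [← Real.rpow_logb (by linarith : 0 < d) hd.ne' hn']
    rw [← Real.rpow_mul (by linarith)]
    congr 1
    ring
  rw [e, ← Real.rpow_natCast, ← Real.rpow_natCast, ← Real.rpow_add (by linarith)]
  refine Real.rpow_le_rpow_of_exponent_le hd.le ?_
  push_cast
  linarith

/-- The exponent is `O(n ^ (2c) log n) = o(n)`. This is the place where `c < 1 / 2` is needed. -/
lemma eventually_exp_neg_le_real_radiusEvent {c d : ℝ} (hd : 1 < d) (hc : 0 < c)
    (hc2 : c < 1 / 2) :
    ∀ᶠ n : ℕ in atTop, Real.exp (-n) ≤ (gnp n d).real (radiusEvent n c d) := by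
  have hlogd : 0 < Real.log d := Real.log_pos hd
  set ε : ℝ := 1 - 2 * c with hε
  have hε0 : 0 < ε := by rw [hε]; linarith
  have h1 : Tendsto (fun n : ℕ => 2 * ((2 * (c * (Real.log n / Real.log d) + 1) + 3) * d ^ 4) /
      (n : ℝ) ^ ε) atTop (𝓝 0) := by
    have t1 : Tendsto (fun n : ℕ => Real.log n / (n : ℝ) ^ ε) atTop (𝓝 0) :=
      ((isLittleO_log_rpow_atTop hε0).tendsto_div_nhds_zero).comp tendsto_natCast_atTop_atTop
    have t2 : Tendsto (fun n : ℕ => ((n : ℝ) ^ ε)⁻¹) atTop (𝓝 0) :=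
      ((tendsto_rpow_atTop hε0).comp tendsto_natCast_atTop_atTop).inv_tendsto_atTop
    have t3 := (t1.const_mul (4 * c / Real.log d * d ^ 4)).add (t2.const_mul (10 * d ^ 4))
    simp only [mul_zero, add_zero] at t3
    refine t3.congr fun n => ?_
    field_simp
    ring
  have h2 : ∀ᶠ n : ℕ in atTop, 2 * d ≤ n :=
    tendsto_natCast_atTop_atTop.eventually_ge_atTop (2 * d)
  filter_upwards [h1.eventually_le_const one_pos, h2, eventually_gt_atTop 0] with n hn1 hn2 hn0
  refine le_trans ?_ (le_real_radiusEvent (c := c) hd.le hn2)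
  rw [Real.exp_le_exp, neg_le_neg_iff]
  have hn' : (0 : ℝ) < n := by exact_mod_cast hn0
  have hn1' : (1 : ℝ) ≤ n := by exact_mod_cast hn0
  have hlog : 0 ≤ c * Real.logb d n := mul_nonneg hc.le (Real.logb_nonneg hd hn1')
  have hR := (Nat.ceil_lt_add_one hlog).le
  have hpow := pow_radius_le hd hn0 hc
  rw [div_le_one (by positivity)] at hn1
  calc _ ≤ 2 * ((2 * (c * (Real.log n / Real.log d) + 1) + 3) * (d ^ 4 * (n : ℝ) ^ (2 * c))) := by
        gcongr
        push_cast
        rw [Real.logb] at hR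
        rw [Real.logb]
        linarith
    _ = (2 * ((2 * (c * (Real.log n / Real.log d) + 1) + 3) * d ^ 4)) * (n : ℝ) ^ (2 * c) := by ring
    _ ≤ (n : ℝ) ^ ε * (n : ℝ) ^ (2 * c) := by gcongr
    _ = n := by
        rw [← Real.rpow_add hn', hε, sub_add_cancel, Real.rpow_one]

/-! ### Conditioning on the radius event -/

instance (n : ℕ) (d : ℝ) : IsProbabilityMeasure (gnp n d) := by
  unfold gnp; infer_instance

lemma condGnp_real (n : ℕ) (c d : ℝ) (S : Set (SimpleGraph (Fin n))) :
    (condGnp n c d).real S =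
      (gnp n d).real (radiusEvent n c d ∩ S) / (gnp n d).real (radiusEvent n c d) := by
  rw [measureReal_def, condGnp, cond_apply (Set.toFinite _).measurableSet, ENNReal.toReal_mul,
    ENNReal.toReal_inv, measureReal_def, measureReal_def, div_eq_inv_mul]

/-- Used for discrepancy, whose failure probability `exp(-n / 8 ^ i)` may be far larger than the
lower bound `exp(-n)` for the radius event, so that dividing would be useless. -/
lemma condGnp_real_le_of_isUpperSet {n : ℕ} {c d : ℝ}
    (h : 0 < (gnp n d).real (radiusEvent n c d)) {S : Set (SimpleGraph (Fin n))}
    (hS : IsUpperSet S) : (condGnp n c d).real S ≤ (gnp n d).real S := by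
  rw [condGnp_real, div_le_iff₀ h, Set.inter_comm]
  have := (harris_lower_lower (edgeProb n d) hS (isLowerSet_radiusEvent n c d).compl).2
  rwa [compl_compl] at this

lemma condGnp_real_le_div {n : ℕ} {c d x : ℝ} (hx : 0 < x)
    (h : x ≤ (gnp n d).real (radiusEvent n c d)) (S : Set (SimpleGraph (Fin n))) :
    (condGnp n c d).real S ≤ (gnp n d).real S / x := by
  rw [condGnp_real]
  exact div_le_div₀ measureReal_nonneg (measureReal_mono Set.inter_subset_right) hx h

lemma isProbabilityMeasure_condGnp {n : ℕ} {c d : ℝ}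
    (h : 0 < (gnp n d).real (radiusEvent n c d)) : IsProbabilityMeasure (condGnp n c d) := by
  refine cond_isProbabilityMeasure ?_
  intro h0
  rw [measureReal_def, h0] at h
  simp at h

/-! ### The conditional tail bound -/

lemma condGnp_real_mono {n : ℕ} {c d : ℝ} {S T : Set (SimpleGraph (Fin n))}
    (h : radiusEvent n c d ∩ S ⊆ T) : (condGnp n c d).real S ≤ (condGnp n c d).real T := by
  rw [condGnp_real, condGnp_real]
  refine div_le_div_of_nonneg_right (measureReal_mono ?_) measureReal_nonneg
  exact fun G hG => ⟨hG.1, h hG⟩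

lemma isUpperSet_compl_edgeCount_le {n : ℕ} (Q : Finset (Fin n) → Prop)
    (m : Finset (Fin n) → Finset (Fin n) → ℝ) :
    IsUpperSet {G : SimpleGraph (Fin n) | ∀ A B, Q A → edgeCount G A B ≤ m A B}ᶜ := by
  intro G H hGH hG hH
  exact hG fun A B hQ => (edgeCount_mono hGH A B).trans (hH A B hQ)

/-- The graphs for which the light part of the quadratic form is small. -/
def lightGood (n : ℕ) (d : ℝ) : Set (SimpleGraph (Fin n)) :=
  {G | ∀ z : Fin n → ℤ, ∑ u, (z u : ℝ) ^ 2 ≤ 16 * n → |lightForm d G z| ≤ 400 * (√d * n)}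

/-- The graphs with the discrepancy property for pairs of sets, one of which is small. -/
def topGood (n : ℕ) (d : ℝ) (i : ℕ) : Set (SimpleGraph (Fin n)) :=
  {G | ∀ A B : Finset (Fin n), A.card * d * 2 ^ i ≤ 16 * n →
    edgeCount G A B ≤ 60 * (A.card + B.card + n / 8 ^ i)}

/-- The graphs with the discrepancy property for all pairs of sets. -/
def discGood (n : ℕ) (d : ℝ) (i : ℕ) : Set (SimpleGraph (Fin n)) :=
  {G | ∀ A B : Finset (Fin n), edgeCount G A B ≤
    3 * (d / n) * (A.card * B.card) + 3 * i * (A.card + B.card) + 6 * n / 4 ^ i}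

lemma isUpperSet_compl_topGood (n : ℕ) (d : ℝ) (i : ℕ) : IsUpperSet (topGood n d i)ᶜ :=
  isUpperSet_compl_edgeCount_le _ _

lemma isUpperSet_compl_discGood (n : ℕ) (d : ℝ) (i : ℕ) : IsUpperSet (discGood n d i)ᶜ := by
  intro G H hGH hG hH
  exact hG fun A B => (edgeCount_mono hGH A B).trans (hH A B)

lemma two_rpow_le_two_pow_radius {n : ℕ} {c d : ℝ} (hn : 0 < n) :
    (n : ℝ) ^ (c * Real.log 2 / Real.log d) ≤ 2 ^ ⌈c * Real.logb d n⌉₊ := by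
  have hn' : (0 : ℝ) < n := by exact_mod_cast hn
  have e : (n : ℝ) ^ (c * Real.log 2 / Real.log d) = (2 : ℝ) ^ (c * Real.logb d n) := by
    rw [Real.rpow_def_of_pos hn', Real.rpow_def_of_pos (by norm_num : (0 : ℝ) < 2), Real.logb]
    congr 1
    ring
  rw [e, ← Real.rpow_natCast]
  exact Real.rpow_le_rpow_of_exponent_le (by norm_num) (Nat.le_ceil _)

lemma specNorm_le_of_good {n I : ℕ} {c d cT a : ℝ} {G : SimpleGraph (Fin n)} (hd : 1 < d)
    (hcT : 0 ≤ cT) (hn : 2 * d ≤ n) (hI : 128 * d ^ 2 ≤ 4 ^ I) (hIn : 8 ^ I * (n : ℝ) ^ a ≤ n)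
    (hR : 0 < ⌈c * Real.logb d n⌉₊) (ha : 2 * (n : ℝ) ^ a ≤ 2 ^ ⌈c * Real.logb d n⌉₊)
    (hE : G ∈ radiusEvent n c d) (hL : G ∈ lightGood n d)
    (hD : ∀ i : ℕ, 8 ^ i * (n : ℝ) ^ a ≤ n → G ∈ topGood n d i)
    (hF : ∀ i < I, G ∈ discGood n d i) :
    specNorm (prunedMatrix n cT d G) ≤ quadConst cT * √n := by
  have hD' : ∀ i < I, G ∈ topGood n d i := by
    intro i hi
    refine hD i (le_trans ?_ hIn)
    have : (0 : ℝ) ≤ (n : ℝ) ^ a := by positivity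
    gcongr
    norm_num
  refine specNorm_prunedMatrix_le G hd hcT hn I hI hL ?_ hF hD'
  refine exists_low_degree G hd ?_ hD
  intro S hS hcard
  refine exists_degree_le_three hE hR S hS ?_
  have : 2 * (S.card : ℝ) < 2 ^ ⌈c * Real.logb d n⌉₊ := by linarith
  exact_mod_cast this

/-- The exponent `a` separates the two sources of degeneracy: sets smaller than `n ^ a` rely on the
radius event, with no exceptional probability, and larger ones on discrepancy at scales with `n / 8
^ i ≥ n ^ a`. A stretched-exponential tail is essential, since it must later beat `n ^ (6q)`. -/
lemma eventually_condGnp_tail {c d cT : ℝ} (hd : 1 < d) (hcT : 0 ≤ cT) (hc : 0 < c)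
    (hc2 : c < 1 / 2) :
    ∃ a : ℝ, 0 < a ∧ ∀ᶠ n : ℕ in atTop, 0 < (gnp n d).real (radiusEvent n c d) ∧
      (condGnp n c d).real
        {G | specNorm (prunedMatrix n cT d G) ≤ quadConst cT * √n}ᶜ ≤
          (2 * n + 2) * Real.exp (-(n : ℝ) ^ a) := by
  have hlogd : 0 < Real.log d := Real.log_pos hd
  have hlog2 : 0 < Real.log 2 := Real.log_pos (by norm_num)
  -- The radius gives `2 ^ R ≥ n ^ (c log 2 / log d) ≥ n ^ (2a)`; halving leaves room for the factor
  -- `2` in `2 n ^ a ≤ 2 ^ R`, and `a ≤ 1 / 2` leaves room for the constant `8 ^ I`.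
  set a : ℝ := min (c * Real.log 2 / Real.log d) 1 / 2 with ha
  have ha0 : 0 < a := by
    have : 0 < min (c * Real.log 2 / Real.log d) 1 := lt_min (by positivity) one_pos
    linarith
  have ha1 : a ≤ 1 / 2 := by
    have := min_le_right (c * Real.log 2 / Real.log d) 1
    linarith
  have ha2 : 2 * a ≤ c * Real.log 2 / Real.log d := by
    have := min_le_left (c * Real.log 2 / Real.log d) 1
    linarith
  obtain ⟨I, hI⟩ : ∃ I : ℕ, 128 * d ^ 2 ≤ (4 : ℝ) ^ I :=
    (pow_unbounded_of_one_lt (128 * d ^ 2) (by norm_num : (1 : ℝ) < 4)).imp fun _ h => h.le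
  refine ⟨a, ha0, ?_⟩
  have e1 : ∀ᶠ n : ℕ in atTop, 2 * d ≤ n :=
    tendsto_natCast_atTop_atTop.eventually_ge_atTop (2 * d)
  have e2 : ∀ᶠ n : ℕ in atTop, (8 : ℝ) ^ I ≤ (n : ℝ) ^ (1 - a) :=
    ((tendsto_rpow_atTop (by linarith : 0 < 1 - a)).comp
      tendsto_natCast_atTop_atTop).eventually_ge_atTop _
  have e3 : ∀ᶠ n : ℕ in atTop, (2 : ℝ) ≤ (n : ℝ) ^ a :=
    ((tendsto_rpow_atTop ha0).comp tendsto_natCast_atTop_atTop).eventually_ge_atTop _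
  filter_upwards [e1, e2, e3, eventually_exp_neg_le_real_radiusEvent hd hc hc2,
    eventually_ge_atTop 2, eventually_ge_atTop I] with n h1 h2 h3 h4 h5 h6
  have hn0 : 0 < n := by omega
  have hn' : (0 : ℝ) < n := by exact_mod_cast hn0
  have hn1 : (1 : ℝ) < n := by exact_mod_cast h5
  have hna0 : (0 : ℝ) < (n : ℝ) ^ a := by positivity
  have hnn : (n : ℝ) ^ a ≤ n := by
    calc (n : ℝ) ^ a ≤ (n : ℝ) ^ (1 : ℝ) := Real.rpow_le_rpow_of_exponent_le hn1.le (by linarith)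
      _ = n := Real.rpow_one _
  have hIn : 8 ^ I * (n : ℝ) ^ a ≤ n := by
    calc 8 ^ I * (n : ℝ) ^ a ≤ (n : ℝ) ^ (1 - a) * (n : ℝ) ^ a := by gcongr
      _ = n := by rw [← Real.rpow_add hn', sub_add_cancel, Real.rpow_one]
  have hR : 0 < ⌈c * Real.logb d n⌉₊ := Nat.ceil_pos.2 (mul_pos hc (Real.logb_pos hd hn1))
  have hRa : 2 * (n : ℝ) ^ a ≤ 2 ^ ⌈c * Real.logb d n⌉₊ := by
    calc 2 * (n : ℝ) ^ a ≤ (n : ℝ) ^ a * (n : ℝ) ^ a := by gcongr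
      _ = (n : ℝ) ^ (2 * a) := by rw [← Real.rpow_add hn', two_mul]
      _ ≤ (n : ℝ) ^ (c * Real.log 2 / Real.log d) :=
          Real.rpow_le_rpow_of_exponent_le hn1.le ha2
      _ ≤ _ := two_rpow_le_two_pow_radius hn0
  have hpos : 0 < (gnp n d).real (radiusEvent n c d) := (Real.exp_pos _).trans_le h4
  refine ⟨hpos, ?_⟩
  have hp : (edgeProb n d : ℝ) = d / n := edgeProb_eq (by linarith) (by linarith) hn0
  set topIdx : Finset ℕ := (Finset.range n).filter fun i => 8 ^ i * (n : ℝ) ^ a ≤ n with hidx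
  have hmono := condGnp_real_mono (n := n) (c := c) (d := d)
    (S := {G | specNorm (prunedMatrix n cT d G) ≤ quadConst cT * √n}ᶜ)
    (T := (lightGood n d)ᶜ ∪ ((⋃ i ∈ topIdx, (topGood n d i)ᶜ) ∪
      ⋃ i ∈ Finset.range I, (discGood n d i)ᶜ)) (by
    rintro G ⟨hE, hG⟩
    by_contra hcon
    simp only [Set.mem_union, Set.mem_compl_iff, Set.mem_iUnion, not_or, not_not, not_exists] at hcon
    refine hG (specNorm_le_of_good hd hcT h1 hI hIn hR hRa hE hcon.1 ?_ ?_)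
    · intro i hi
      refine hcon.2.1 i (Finset.mem_filter.2 ⟨Finset.mem_range.2 ?_, hi⟩)
      have k1 : (8 : ℝ) ^ i ≤ n := by
        refine le_trans ?_ hi
        refine le_mul_of_one_le_right (by positivity) (by linarith)
      have k2 : 8 ^ i ≤ n := by exact_mod_cast k1
      exact (Nat.lt_pow_self (by norm_num)).trans_le k2
    · intro i hi
      exact hcon.2.2 i (Finset.mem_range.2 hi))
  have t1 : (condGnp n c d).real (lightGood n d)ᶜ ≤ 2 * Real.exp (-(n : ℝ) ^ a) := by
    refine (condGnp_real_le_div (Real.exp_pos _) h4 _).trans ?_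
    rw [div_le_iff₀ (Real.exp_pos _), mul_assoc, ← Real.exp_add]
    refine (lightForm_tail (by linarith) (edgeProb n d) hn0 hp).trans ?_
    gcongr
    linarith
  have t2 : ∀ i ∈ topIdx, (condGnp n c d).real (topGood n d i)ᶜ ≤ Real.exp (-(n : ℝ) ^ a) := by
    intro i hi
    refine (condGnp_real_le_of_isUpperSet hpos (isUpperSet_compl_topGood n d i)).trans ?_
    refine (discrepancy_top_tail (edgeProb n d) hn0 hp i).trans ?_
    rw [Real.exp_le_exp, neg_le_neg_iff, le_div_iff₀ (by positivity), mul_comm]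
    exact (Finset.mem_filter.1 hi).2
  have t3 : ∀ i ∈ Finset.range I, (condGnp n c d).real (discGood n d i)ᶜ ≤
      Real.exp (-(n : ℝ) ^ a) := by
    intro i hi
    refine (condGnp_real_le_of_isUpperSet hpos (isUpperSet_compl_discGood n d i)).trans ?_
    refine (discrepancy_tail (edgeProb n d) hp i).trans ?_
    rw [Real.exp_le_exp, neg_le_neg_iff, le_div_iff₀ (by positivity), mul_comm]
    refine le_trans ?_ hIn
    gcongr
    calc (4 : ℝ) ^ i ≤ 4 ^ I := pow_le_pow_right₀ (by norm_num) (Finset.mem_range.1 hi).le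
      _ ≤ 8 ^ I := by gcongr; norm_num
  have hcard1 : (topIdx.card : ℝ) ≤ n := by
    have : topIdx.card ≤ n := (Finset.card_filter_le _ _).trans (by simp)
    exact_mod_cast this
  have hcard2 : (I : ℝ) ≤ n := by exact_mod_cast h6
  have := isProbabilityMeasure_condGnp hpos
  calc _ ≤ _ := hmono
    _ ≤ (condGnp n c d).real (lightGood n d)ᶜ + ((condGnp n c d).real
          (⋃ i ∈ topIdx, (topGood n d i)ᶜ) + (condGnp n c d).real
            (⋃ i ∈ Finset.range I, (discGood n d i)ᶜ)) :=
        (measureReal_union_le _ _).trans (add_le_add le_rfl (measureReal_union_le _ _))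
    _ ≤ 2 * Real.exp (-(n : ℝ) ^ a) + (topIdx.card * Real.exp (-(n : ℝ) ^ a) +
          I * Real.exp (-(n : ℝ) ^ a)) := by
        refine add_le_add t1 (add_le_add ?_ ?_)
        · refine (measureReal_biUnion_finset_le _ _).trans ((Finset.sum_le_sum t2).trans ?_)
          rw [Finset.sum_const, nsmul_eq_mul]
        · refine (measureReal_biUnion_finset_le _ _).trans ((Finset.sum_le_sum t3).trans ?_)
          rw [Finset.sum_const, nsmul_eq_mul, Finset.card_range]
    _ ≤ 2 * Real.exp (-(n : ℝ) ^ a) + (n * Real.exp (-(n : ℝ) ^ a) +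
          n * Real.exp (-(n : ℝ) ^ a)) := by gcongr
    _ = _ := by ring

/-! ### Traces -/

lemma specNorm_nonneg {n : ℕ} (M : Matrix (Fin n) (Fin n) ℝ) : 0 ≤ specNorm M := norm_nonneg _

lemma apply_self_le_specNorm {n : ℕ} (P : Matrix (Fin n) (Fin n) ℝ) (i : Fin n) :
    P i i ≤ specNorm P := by
  set x : EuclideanSpace ℝ (Fin n) := EuclideanSpace.single i 1 with hx
  have hxn : ‖x‖ = 1 := by simp [hx]
  have h : inner ℝ (Matrix.toEuclideanCLM (n := Fin n) (𝕜 := ℝ) P x) x = P i i := by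
    rw [inner_toEuclideanCLM, Finset.sum_eq_single i, Finset.sum_eq_single i]
    · simp [hx]
    · intro v _ hv
      simp [hx, hv]
    · simp
    · intro u _ hu
      simp [hx, hu]
    · simp
  rw [← h]
  calc _ ≤ ‖Matrix.toEuclideanCLM (n := Fin n) (𝕜 := ℝ) P x‖ * ‖x‖ := real_inner_le_norm _ _
    _ ≤ (specNorm P * ‖x‖) * ‖x‖ := by
        gcongr
        exact ContinuousLinearMap.le_opNorm _ _
    _ = _ := by rw [hxn]; ring

lemma trace_pow_le {n : ℕ} (M : Matrix (Fin n) (Fin n) ℝ) (q : ℕ) :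
    ((M * M.transpose) ^ q).trace ≤ n * specNorm M ^ (2 * q) := by
  rcases Nat.eq_zero_or_pos q with rfl | hq
  · simp
  have hP : specNorm ((M * M.transpose) ^ q) ≤ specNorm M ^ (2 * q) := by
    unfold specNorm
    rw [map_pow, map_mul, ← Matrix.conjTranspose_eq_transpose_of_trivial,
      ← Matrix.star_eq_conjTranspose, map_star, pow_mul, sq]
    refine (norm_pow_le' _ hq).trans ?_
    gcongr
    exact (norm_mul_le _ _).trans
      (by rw [ContinuousLinearMap.star_eq_adjoint, LinearIsometryEquiv.norm_map])
  calc ((M * M.transpose) ^ q).trace ≤ ∑ _i : Fin n, specNorm M ^ (2 * q) :=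
        Finset.sum_le_sum fun i _ => (apply_self_le_specNorm _ i).trans hP
    _ = _ := by simp

lemma specNorm_le_of_entries {n : ℕ} (N : Matrix (Fin n) (Fin n) ℝ) (hN : N.IsSymm) {b : ℝ}
    (hb : 0 ≤ b) (h : ∀ u v, |N u v| ≤ b) : specNorm N ≤ 2 * (b * n) := by
  refine specNorm_le_of_lattice N hN (by positivity) fun z hz => ?_
  calc |∑ u, ∑ v, N u v * z u * z v|
      ≤ ∑ u, ∑ v, b * (((z u : ℝ) ^ 2 + (z v : ℝ) ^ 2) / 2) := by
        refine (Finset.abs_sum_le_sum_abs _ _).trans (Finset.sum_le_sum fun u _ => ?_)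
        refine (Finset.abs_sum_le_sum_abs _ _).trans (Finset.sum_le_sum fun v _ => ?_)
        rw [mul_assoc, abs_mul]
        refine mul_le_mul (h u v) ?_ (abs_nonneg _) hb
        rw [abs_le]
        constructor <;> nlinarith [sq_nonneg ((z u : ℝ) - z v), sq_nonneg ((z u : ℝ) + z v)]
    _ = b * n * ∑ u, (z u : ℝ) ^ 2 := by
        simp only [← Finset.mul_sum, add_div, Finset.sum_add_distrib, Finset.sum_const,
          Finset.card_univ, Fintype.card_fin, nsmul_eq_mul, ← Finset.sum_div]
        ring
    _ ≤ _ := by gcongr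

/-- A deterministic bound for the bad event; any fixed power of `n` would do. -/
lemma specNorm_prunedMatrix_le_cube {n : ℕ} {d : ℝ} (hd : 1 < d) (hn : 2 * d ≤ n) (cT : ℝ)
    (G : SimpleGraph (Fin n)) : specNorm (prunedMatrix n cT d G) ≤ (n : ℝ) ^ 3 := by
  have hn' : (0 : ℝ) < n := by linarith
  have hn0 : 0 < n := by exact_mod_cast hn'
  have hp : (edgeProb n d : ℝ) = d / n := edgeProb_eq (by linarith) (by linarith) hn0
  have hp0 : 0 < d / n := by positivity
  have hp2 : d / n ≤ 1 / 2 := by rw [div_le_iff₀ hn']; linarith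
  refine (specNorm_le_of_entries _ (prunedMatrix_isSymm n cT d G) hn'.le fun u v => ?_).trans ?_
  · rw [prunedMatrix, Matrix.of_apply]
    split_ifs with h
    · rw [chi, hp]
      split_ifs
      · rw [abs_of_nonneg (Real.sqrt_nonneg _)]
        refine Real.sqrt_le_iff.2 ⟨hn'.le, ?_⟩
        rw [div_le_iff₀ hp0]
        have : (n : ℝ) ^ 2 * (d / n) = n * d := by field_simp
        rw [this]
        nlinarith
      · rw [abs_neg, abs_of_nonneg (Real.sqrt_nonneg _)]
        refine Real.sqrt_le_iff.2 ⟨hn'.le, ?_⟩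
        rw [div_le_iff₀ (by linarith)]
        nlinarith
    · rw [abs_zero]; exact hn'.le
  · nlinarith [mul_pos hn' hn']

/-! ### Block costs -/

section BlockCost

variable {V : Type*} {k : ℕ} {w : Fin (k + 1) → V} {i : Fin k}

lemma inBlock_of_stepEdge_eq {j : Fin k} (h : stepEdge w j = stepEdge w i) :
    InBlock w j (w i.castSucc) ∧ InBlock w j (w i.succ) := by
  simp only [stepEdge, Sym2.eq_iff] at h
  rcases h with ⟨h1, h2⟩ | ⟨h1, h2⟩
  · exact ⟨Or.inl h1.symm, Or.inr h2.symm⟩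
  · exact ⟨Or.inr h2.symm, Or.inl h1.symm⟩

lemma FirstUse.of_destFirst (h : DestFirst w i) : FirstUse w i := fun j hj e =>
  h j hj (inBlock_of_stepEdge_eq e).2

lemma LastUse.of_sourceLast (h : SourceLast w i) : LastUse w i := fun j hj e =>
  h j hj (inBlock_of_stepEdge_eq e).1

lemma OnlyUse.of_firstUse_of_lastUse (h1 : FirstUse w i) (h2 : LastUse w i) : OnlyUse w i := by
  intro j hj
  rcases lt_or_gt_of_ne hj with h | h
  · exact h1 j h
  · exact h2 j h

end BlockCost

lemma sqrt_div_mul_div {n d : ℝ} (hn : 0 < n) (hd : 0 < d) :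
    √(n / d) * (d / n) * n = √n * √d := by
  rw [Real.sqrt_div hn.le, mul_assoc, div_mul_cancel₀ _ hn.ne', div_mul_eq_mul_div,
    div_eq_iff (Real.sqrt_pos.2 hd).ne', mul_assoc, Real.mul_self_sqrt hd.le]

/-- Only a Singleton step can pay `√n` at both ends, and its value `√(d / n) exp(-d)` compensates
since `√d exp(-d) ≤ 1`. A first but not only use has a source that reappears, and a later use has a
destination already seen, so `F`, `S`, `R` pay at most one `√n`. An `H`-step pays none, and `K√d *
√(n / d) = K√n`. -/
lemma vtxcost_mul_edgeval_le {V : Type*} {n k : ℕ} {K d : ℝ} (hK : 1 ≤ K) (hd : 1 < d)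
    (hn : 2 * d ≤ n) (hk : (k : ℝ) * (k : ℝ) ^ 2 ≤ √n) (w : Fin (k + 1) → V) (i : Fin k) :
    vtxcost n K d w i * edgeval n d w i ≤ K * √n := by
  have hn' : (0 : ℝ) < n := by linarith
  have hd0 : 0 < d := by linarith
  have hn0 : 0 < n := by exact_mod_cast hn'
  have hp : (edgeProb n d : ℝ) = d / n := edgeProb_eq (by linarith) (by linarith) hn0
  have hs1 : 1 ≤ √(n : ℝ) := Real.one_le_sqrt.2 (by linarith)
  have hs2 : √(n : ℝ) * √n = n := Real.mul_self_sqrt hn'.le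
  have hKs : √(n : ℝ) ≤ K * √n := le_mul_of_one_le_left (by linarith) hK
  by_cases hO : OnlyUse w i
  · have hlab : stepLabel w i = .singleton := if_pos hO
    have hdest : destCost n K d w i ≤ √n := by
      unfold destCost
      split_ifs
      · exact le_rfl
      · rw [hlab]; exact hk
    have hv : vtxcost n K d w i ≤ √n * √n := by
      unfold vtxcost
      have h0 : 0 ≤ (if SourceLast w i then √(n : ℝ) else 1) := by split_ifs <;> positivity
      have h1 : (if SourceLast w i then √(n : ℝ) else 1) ≤ √n := by
        split_ifs
        · exact le_rfl
        · exact hs1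
      calc _ ≤ (if SourceLast w i then √(n : ℝ) else 1) * √n := by gcongr
        _ ≤ _ := by gcongr
    have he : edgeval n d w i = √(n / d) * (d / n) * Real.exp (-d) := by
      unfold edgeval; rw [hlab]
    have hexp : √d * Real.exp (-d) ≤ 1 := by
      have h1 : √d ≤ d := Real.sqrt_le_iff.2 ⟨hd0.le, by nlinarith⟩
      have h2 := Real.add_one_le_exp d
      rw [Real.exp_neg, ← div_eq_mul_inv, div_le_one (Real.exp_pos _)]
      linarith
    rw [he]
    calc vtxcost n K d w i * (√(n / d) * (d / n) * Real.exp (-d))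
        ≤ (√n * √n) * (√(n / d) * (d / n) * Real.exp (-d)) := by gcongr
      _ = (√(n / d) * (d / n) * n) * Real.exp (-d) := by rw [hs2]; ring
      _ = √n * (√d * Real.exp (-d)) := by rw [sqrt_div_mul_div hn' hd0]; ring
      _ ≤ √n * 1 := by gcongr
      _ ≤ _ := by linarith
  by_cases hF : FirstUse w i
  · have hS : ¬ SourceLast w i := fun h =>
      hO (OnlyUse.of_firstUse_of_lastUse hF (LastUse.of_sourceLast h))
    by_cases hD : DestFirst w i
    · have hlab : stepLabel w i = .fresh := by simp [stepLabel, hO, hF, hD]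
      simp only [vtxcost, destCost, edgeval, hlab, hS, hD, if_true, if_false]
      linarith
    · have hlab : stepLabel w i = .surprise := by simp [stepLabel, hO, hF, hD]
      simp only [vtxcost, destCost, edgeval, hlab, hS, hD, if_false]
      linarith
  · have hD : ¬ DestFirst w i := fun h => hF (FirstUse.of_destFirst h)
    by_cases hL : LastUse w i
    · have hlab : stepLabel w i = .ret := by simp [stepLabel, hO, hF, hL]
      simp only [vtxcost, destCost, edgeval, hlab, hD, if_false]
      split_ifs
      · linarith
      · nlinarith
    · have hS : ¬ SourceLast w i := fun h => hL (LastUse.of_sourceLast h)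
      have hlab : stepLabel w i = .highMul := by simp [stepLabel, hO, hF, hL]
      simp only [vtxcost, destCost, edgeval, hlab, hD, hS, if_false]
      have h1 : √((1 - (edgeProb n d : ℝ)) / (edgeProb n d : ℝ)) ≤ √(n / d) := by
        refine Real.sqrt_le_sqrt ?_
        rw [hp]
        have : (n : ℝ) / d = 1 / (d / n) := by rw [one_div_div]
        rw [this]
        have : 0 ≤ d / n := by positivity
        gcongr
        linarith
      calc _ ≤ 1 * (K * √d) * √(n / d) := by gcongr
        _ = _ := by
            rw [Real.sqrt_div hn'.le]
            have := (Real.sqrt_pos.2 hd0).ne'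
            field_simp

/-! ### Asymptotics -/

lemma tendsto_tail {a : ℝ} (ha : 0 < a) :
    Tendsto (fun n : ℕ => (2 * (n : ℝ) + 2) * Real.exp (-(n : ℝ) ^ a)) atTop (𝓝 0) := by
  have t : Tendsto (fun n : ℕ => (n : ℝ) ^ a) atTop atTop :=
    (tendsto_rpow_atTop ha).comp tendsto_natCast_atTop_atTop
  have h1 := (tendsto_rpow_mul_exp_neg_mul_atTop_nhds_zero (1 / a) 1 one_pos).comp t
  have h2 := (tendsto_rpow_mul_exp_neg_mul_atTop_nhds_zero 0 1 one_pos).comp t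
  have h3 := (h1.const_mul 2).add (h2.const_mul 2)
  simp only [mul_zero, add_zero] at h3
  refine h3.congr fun n => ?_
  simp only [Function.comp_apply, Real.rpow_zero, one_mul, neg_mul]
  rw [← Real.rpow_mul (Nat.cast_nonneg n), mul_one_div_cancel ha.ne', Real.rpow_one]
  ring

/-- `n ^ (6q) = exp(6 q log n)` with `q log n ≤ n ^ (a / 2) log n = o(n ^ a)`. -/
lemma eventually_crude_mul_tail_le_one {a δ : ℝ} (ha : 0 < a) (hδ : δ ≤ a / 2) :
    ∀ᶠ n : ℕ in atTop, ∀ q : ℕ, (q : ℝ) ≤ (n : ℝ) ^ δ →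
      ((n : ℝ) ^ 3) ^ (2 * q) * ((2 * n + 2) * Real.exp (-(n : ℝ) ^ a)) ≤ 1 := by
  have ha2 : 0 < a / 2 := by linarith
  have t1 : Tendsto (fun n : ℕ => Real.log n / (n : ℝ) ^ (a / 2)) atTop (𝓝 0) :=
    ((isLittleO_log_rpow_atTop ha2).tendsto_div_nhds_zero).comp tendsto_natCast_atTop_atTop
  filter_upwards [t1.eventually_le_const (show (0 : ℝ) < 1 / 8 by norm_num),
    eventually_ge_atTop 3] with n h1 h2 q hq
  have hn3 : (3 : ℝ) ≤ n := by exact_mod_cast h2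
  have hn' : (0 : ℝ) < n := by linarith
  have hna : (0 : ℝ) < (n : ℝ) ^ (a / 2) := by positivity
  have hna1 : 1 ≤ (n : ℝ) ^ (a / 2) := Real.one_le_rpow (by linarith) ha2.le
  rw [div_le_iff₀ hna] at h1
  have hlog : 0 ≤ Real.log n := Real.log_nonneg (by linarith)
  have hq' : (q : ℝ) ≤ (n : ℝ) ^ (a / 2) :=
    hq.trans (Real.rpow_le_rpow_of_exponent_le (by linarith) hδ)
  have hmain : (6 * (q : ℝ) + 2) * Real.log n ≤ (n : ℝ) ^ a := by
    calc (6 * (q : ℝ) + 2) * Real.log n ≤ (8 * (n : ℝ) ^ (a / 2)) * (1 / 8 * (n : ℝ) ^ (a / 2)) := by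
          gcongr
          linarith
      _ = (n : ℝ) ^ (a / 2) * (n : ℝ) ^ (a / 2) := by ring
      _ = (n : ℝ) ^ a := by rw [← Real.rpow_add hn', add_halves]
  have hpow : ((n : ℝ) ^ 3) ^ (2 * q) * (2 * n + 2) ≤ Real.exp ((6 * (q : ℝ) + 2) * Real.log n) := by
    have e : Real.exp ((6 * (q : ℝ) + 2) * Real.log n) = (n : ℝ) ^ (6 * q + 2) := by
      rw [show (6 * (q : ℝ) + 2) = ((6 * q + 2 : ℕ) : ℝ) by push_cast; ring, Real.exp_nat_mul,
        Real.exp_log hn']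
    rw [e, ← pow_mul, pow_add, show 3 * (2 * q) = 6 * q by ring]
    gcongr
    nlinarith
  calc _ = (((n : ℝ) ^ 3) ^ (2 * q) * (2 * n + 2)) * Real.exp (-(n : ℝ) ^ a) := by ring
    _ ≤ Real.exp ((6 * (q : ℝ) + 2) * Real.log n) * Real.exp (-(n : ℝ) ^ a) := by gcongr
    _ = Real.exp ((6 * (q : ℝ) + 2) * Real.log n - (n : ℝ) ^ a) := by
        rw [← Real.exp_add, sub_eq_add_neg]
    _ ≤ 1 := Real.exp_le_one_iff.2 (by linarith)

lemma eventually_cube_le_sqrt {δ : ℝ} (hδ : δ ≤ 1 / 12) :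
    ∀ᶠ n : ℕ in atTop, ∀ q : ℕ, (q : ℝ) ≤ (n : ℝ) ^ δ →
      ((2 * q : ℕ) : ℝ) * ((2 * q : ℕ) : ℝ) ^ 2 ≤ √n := by
  have t : ∀ᶠ n : ℕ in atTop, (8 : ℝ) ≤ (n : ℝ) ^ (1 / 4 : ℝ) :=
    ((tendsto_rpow_atTop (by norm_num : (0 : ℝ) < 1 / 4)).comp
      tendsto_natCast_atTop_atTop).eventually_ge_atTop _
  filter_upwards [t, eventually_ge_atTop 1] with n h1 h2 q hq
  have hn1 : (1 : ℝ) ≤ n := by exact_mod_cast h2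
  have hn' : (0 : ℝ) < n := by linarith
  have hq' : (q : ℝ) ≤ (n : ℝ) ^ (1 / 12 : ℝ) :=
    hq.trans (Real.rpow_le_rpow_of_exponent_le hn1 hδ)
  have e3 : ((n : ℝ) ^ (1 / 12 : ℝ)) ^ 3 = (n : ℝ) ^ (1 / 4 : ℝ) := by
    rw [← Real.rpow_natCast, ← Real.rpow_mul hn'.le]
    norm_num
  have e2 : (n : ℝ) ^ (1 / 4 : ℝ) * (n : ℝ) ^ (1 / 4 : ℝ) = √n := by
    rw [← Real.rpow_add hn', Real.sqrt_eq_rpow]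
    norm_num
  calc ((2 * q : ℕ) : ℝ) * ((2 * q : ℕ) : ℝ) ^ 2 = 8 * (q : ℝ) ^ 3 := by push_cast; ring
    _ ≤ 8 * ((n : ℝ) ^ (1 / 12 : ℝ)) ^ 3 := by gcongr
    _ = 8 * (n : ℝ) ^ (1 / 4 : ℝ) := by rw [e3]
    _ ≤ (n : ℝ) ^ (1 / 4 : ℝ) * (n : ℝ) ^ (1 / 4 : ℝ) := by gcongr
    _ = √n := e2

lemma eventually_rpow_le_one_add {q : ℕ → ℕ}
    (hq : (fun n : ℕ => Real.log n) =o[atTop] fun n : ℕ => (q n : ℝ)) {ε : ℝ} (hε : 0 < ε) :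
    ∀ᶠ n : ℕ in atTop, ((n : ℝ) * 2) ^ ((1 : ℝ) / (2 * (q n : ℝ))) ≤ 1 + ε := by
  have hη : 0 < Real.log (1 + ε) := Real.log_pos (by linarith)
  filter_upwards [hq.def hη, eventually_ge_atTop 2] with n h1 h2
  have hn2 : (2 : ℝ) ≤ n := by exact_mod_cast h2
  have hn' : (0 : ℝ) < n := by linarith
  have hlog : 0 < Real.log n := Real.log_pos (by linarith)
  rw [Real.norm_of_nonneg hlog.le, Real.norm_of_nonneg (Nat.cast_nonneg _)] at h1
  have hq0 : (0 : ℝ) < q n := by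
    by_contra hcon
    have : (q n : ℝ) = 0 := le_antisymm (not_lt.1 hcon) (Nat.cast_nonneg _)
    rw [this, mul_zero] at h1
    linarith
  have hlog2 : Real.log 2 ≤ Real.log n := Real.log_le_log (by norm_num) hn2
  rw [Real.rpow_def_of_pos (by positivity), ← Real.le_log_iff_exp_le (by linarith),
    Real.log_mul hn'.ne' (by norm_num), mul_one_div, div_le_iff₀ (by positivity)]
  nlinarith

end SparseNorm

/-! ### The main theorem -/

open SparseNorm

theorem mainTheorem4 (cTrunc : ℝ) (hcTrunc : 0 < cTrunc) (K : ℝ) (hK : 1 ≤ K) :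
    ∃ C : ℝ, 0 < C ∧ ∀ c : ℝ, 0 < c → c < 1 / 2 → ∀ d : ℝ, 1 < d →
      (∃ δ : ℝ, 0 < δ ∧ ∃ B : ℕ → ℕ → ℝ,
        (∀ q : ℕ → ℕ,
          ((fun n : ℕ => Real.log n) =o[atTop] fun n : ℕ => (q n : ℝ)) →
          (∀ᶠ n : ℕ in atTop, (q n : ℝ) ≤ (n : ℝ) ^ δ) →
          SparseNorm.IsBlockValue cTrunc K c d q (fun n => B (q n) n)) ∧
        ∀ᶠ n : ℕ in atTop, ∀ m : ℕ, (m : ℝ) ≤ (n : ℝ) ^ δ → B m n ≤ C * √n) ∧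
      Tendsto
        (fun n : ℕ => (SparseNorm.condGnp n c d).real
          {G | SparseNorm.specNorm (SparseNorm.prunedMatrix n cTrunc d G) ≤ C * √n})
        atTop (𝓝 1) := by
  have hQ := quadConst_pos hcTrunc.le
  set C : ℝ := quadConst cTrunc + K with hC
  have hC1 : 1 ≤ C := by linarith
  refine ⟨C, by linarith, fun c hc hc2 d hd => ?_⟩
  obtain ⟨a, ha, htail⟩ := eventually_condGnp_tail (cT := cTrunc) hd hcTrunc.le hc hc2
  have hsub : ∀ n : ℕ, ∀ G : SimpleGraph (Fin n),
      specNorm (prunedMatrix n cTrunc d G) ≤ quadConst cTrunc * √n →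
        specNorm (prunedMatrix n cTrunc d G) ≤ C * √n := by
    intro n G h
    refine h.trans ?_
    gcongr
    linarith
  have hlarge : ∀ᶠ n : ℕ in atTop, 2 * d ≤ n :=
    tendsto_natCast_atTop_atTop.eventually_ge_atTop (2 * d)
  constructor
  -- `a / 2` lets the tail absorb `n ^ (6q)`; `1 / 12` gives `(2q) ^ 3 ≤ 8 n ^ (1 / 4) ≤ √n`.
  · refine ⟨min (a / 2) (1 / 12), lt_min (by linarith) (by norm_num), fun _ n => C * √n,
      fun q hq hqδ => ?_, Eventually.of_forall fun n m _ => le_rfl⟩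
    -- Auxiliary cost `2`: one unit for the good event and one for the bad event.
    refine ⟨fun _ => 2, ?_, fun ε hε => eventually_rpow_le_one_add hq hε, ?_⟩
    · filter_upwards [htail, hlarge, hqδ, eventually_crude_mul_tail_le_one ha (min_le_left _ _)]
        with n h1 h2 h3 h4
      refine ⟨two_pos, by positivity, ?_⟩
      have hn' : (0 : ℝ) < n := by linarith
      have := isProbabilityMeasure_condGnp h1.1
      set bad : Set (SimpleGraph (Fin n)) :=
        {G | specNorm (prunedMatrix n cTrunc d G) ≤ quadConst cTrunc * √n}ᶜ with hbad
      have hCs : 1 ≤ (C * √n) ^ (2 * q n) := by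
        refine one_le_pow₀ ?_
        have : 1 ≤ √(n : ℝ) := Real.one_le_sqrt.2 (by linarith)
        nlinarith
      calc _ ≤ ∫ G, (n * (C * √n) ^ (2 * q n) +
              bad.indicator (fun _ => n * ((n : ℝ) ^ 3) ^ (2 * q n)) G) ∂(condGnp n c d) := by
            refine integral_mono Integrable.of_finite Integrable.of_finite fun G => ?_
            refine (trace_pow_le _ _).trans ?_
            by_cases hG : G ∈ bad
            · rw [Set.indicator_of_mem hG]
              have h5 := specNorm_prunedMatrix_le_cube hd h2 cTrunc G
              have h6 := specNorm_nonneg (prunedMatrix n cTrunc d G)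
              have h7 : 0 ≤ n * (C * √n) ^ (2 * q n) := by positivity
              have h8 : n * specNorm (prunedMatrix n cTrunc d G) ^ (2 * q n) ≤
                n * ((n : ℝ) ^ 3) ^ (2 * q n) := by gcongr
              linarith
            · rw [Set.indicator_of_notMem hG, add_zero]
              have h5 := hsub n G (not_not.1 hG)
              have h6 := specNorm_nonneg (prunedMatrix n cTrunc d G)
              gcongr
        _ = n * (C * √n) ^ (2 * q n) +
              (condGnp n c d).real bad * (n * ((n : ℝ) ^ 3) ^ (2 * q n)) := by
            rw [integral_add Integrable.of_finite Integrable.of_finite, integral_const,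
              integral_indicator_const _ (Set.toFinite bad).measurableSet]
            simp
        _ ≤ n * (C * √n) ^ (2 * q n) + ((2 * n + 2) * Real.exp (-(n : ℝ) ^ a)) *
              (n * ((n : ℝ) ^ 3) ^ (2 * q n)) := by
            gcongr
            exact h1.2
        _ = n * (C * √n) ^ (2 * q n) + n * (((n : ℝ) ^ 3) ^ (2 * q n) *
              ((2 * n + 2) * Real.exp (-(n : ℝ) ^ a))) := by ring
        _ ≤ n * (C * √n) ^ (2 * q n) + n * (C * √n) ^ (2 * q n) := by
            gcongr
            exact (h4 (q n) h3).trans hCs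
        _ = _ := by ring
    · filter_upwards [hlarge, hqδ, eventually_cube_le_sqrt (min_le_right (a / 2) _)]
        with n h1 h2 h3 w _ i
      refine (vtxcost_mul_edgeval_le hK hd h1 (h3 (q n) h2) w i).trans ?_
      gcongr
      linarith
  · have hlim : Tendsto (fun n : ℕ => 1 - (2 * (n : ℝ) + 2) * Real.exp (-(n : ℝ) ^ a)) atTop
        (𝓝 1) := by
      simpa using (tendsto_tail ha).const_sub 1
    refine tendsto_of_tendsto_of_tendsto_of_le_of_le' hlim tendsto_const_nhds ?_ ?_
    · filter_upwards [htail] with n h1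
      have := isProbabilityMeasure_condGnp h1.1
      have h2 : (condGnp n c d).real
          {G | specNorm (prunedMatrix n cTrunc d G) ≤ quadConst cTrunc * √n}ᶜ =
          1 - (condGnp n c d).real
            {G | specNorm (prunedMatrix n cTrunc d G) ≤ quadConst cTrunc * √n} :=
        probReal_compl_eq_one_sub (Set.toFinite _).measurableSet
      have h3 : (condGnp n c d).real
          {G | specNorm (prunedMatrix n cTrunc d G) ≤ quadConst cTrunc * √n} ≤
          (condGnp n c d).real {G | specNorm (prunedMatrix n cTrunc d G) ≤ C * √n} :=
        measureReal_mono fun G hG => hsub n G hG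
      linarith [h1.2]
    · filter_upwards [htail] with n h1
      have := isProbabilityMeasure_condGnp h1.1
      exact measureReal_le_one
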